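/- Let $\mu,\nu,\rho\in\mathbb C$ with $\operatorname{Re}\rho>0$, and let all powers have their principal values. For $a,b,c\in\mathbb C$ let $F(a,b;c;\cdot)$ be the regularized Gauss hypergeometric function, i.e. the holomorphic function on $\mathbb C\setminus[1,\infty)$ which equals $\sum_{k\ge0}\frac{(a)_k(b)_k}{\Gamma(c+k)\,k!}z^k$ for $|z|<1$ (so $F={}_2F_1/\Gamma(c)$ if $c\notin\{0,-1,-2,\dots\}$). Put $$a_\pm=\tfrac{1\pm\rho+\mu+\nu}{2},\qquad b_\pm=\tfrac{1\pm\rho-\mu+\nu}{2},$$ $$f(z)=z^{-1-\rho-\nu}F(a_+,b_+;\nu+1;z^{-2}),\qquad q(z)=F(a_-,b_-;\nu+1;z^{-2}).$$ Define functions $h_1,h_2^{+},h_2^{-}$ on $\mathbb R_+=(0,\infty)$, writing $w=1-x^{-2}$ and $1/\Gamma(-n)=0$ for $n=0,1,2,\dots$, as follows. (i) If $\rho\notin\mathbb Z$, $$h_1(x)=\frac{\pi}{\sin\pi\rho}\,\frac{F(a_-,b_-;1-\rho;w)}{\Gamma(a_+)\Gamma(b_+)},\qquad h_2^\pm(x)=-\frac{\pi}{\sin\pi\rho}\,\frac{x^{-2\rho}(1+x)^{\rho}\,F(a_+,b_+;\rho+1;w)}{\Gamma(a_-)\Gamma(b_-)}.$$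 (ii) If $\rho=m\in\{1,2,\dots\}$ and neither $a_-$ nor $b_-$ is a non-positive integer, $$h_1(x)=\frac{1}{\Gamma(a_+)\Gamma(b_+)}\sum_{k=0}^{m-1}\frac{(-1)^k(m-k-1)!\,(a_-)_k(b_-)_k}{k!}\,w^k,$$ $$h_2^\pm(x)=\frac{(-1)^m x^{-2m}(1+x)^m}{\Gamma(a_-)\Gamma(b_-)}\Big[T(w)-\big(\log|w|\pm i\pi\,\theta(1-x)\big)F(a_+,b_+;m+1;w)\Big],$$ where $\theta$ is the Heaviside function and $T$ is the holomorphic function on $\mathbb C\setminus[1,\infty)$ which for $|w|<1$ equals $$\sum_{k\ge0}\frac{(a_+)_k(b_+)_k}{(m+k)!\,k!}\{\psi(k+1)+\psi(m+k+1)-\psi(a_++k)-\psi(b_++k)\}\,w^k,\qquad \psi=\Gamma'/\Gamma .$$ (iii) If $\rho\in\{1,2,\dots\}$ and $a_-$ or $b_-$ is a non-positive integer, then $q$ is a polynomial in $z^{-2}$, and $h_1(x)$ is the value of this polynomial at $z=x$, while $h_2^\pm=0$. Then, for either choice of the sign: 1. $h_1$ is smooth and $h_2^\pm$ is locally integrable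 on $\mathbb R_+$, and they decompose the boundary values of $q$: for every $x>0$, $\lim_{\varepsilon\searrow0}\big[q(x\pm i\varepsilon)-(x-1\pm i\varepsilon)^{\rho}h_2^\pm(x)\big]=h_1(x)$. 2. The limit $(x-1\pm i0)^{-\rho}:=\lim_{\varepsilon\searrow0}(x-1\pm i\varepsilon)^{-\rho}$ exists in the sense of distributions on $\mathbb R_+$. 3. In the sense of distributions on $\mathbb R_+$, $$\lim_{\varepsilon\searrow0}f(x\pm i\varepsilon)=x^{-1+\rho-\nu}(x+1)^{-\rho}\Big[(x-1\pm i0)^{-\rho}h_1(x)+h_2^\pm(x)\Big].$$ -/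

import Mathlib

open Set Filter Topology MeasureTheory
open scoped ContDiff Distributions

noncomputable section

namespace WeberSchafheitlin

/-! ### Distributions on the open half-line -/

/-- The open half-line `(0, ∞)`. -/
def posReals : TopologicalSpace.Opens ℝ := ⟨Ioi 0, isOpen_Ioi⟩

/-- Complex distributions on `(0, ∞)`: continuous `ℂ`-linear functionals on the space of complex
valued smooth functions with compact support in `(0, ∞)`, with its canonical LF topology. -/
abbrev Distr : Type := 𝓓(posReals, ℂ) →L[ℂ] ℂ

/-- The regular distribution `φ ↦ ∫ φ(x) u(x) dx` of a locally integrable function `u` on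
`(0, ∞)` (and `0` when `u` is not locally integrable). -/
def regular (u : ℝ → ℂ) : Distr :=
  TestFunction.integralAgainstBilinCLM (ContinuousLinearMap.mul ℂ ℂ) volume u

theorem regular_apply {u : ℝ → ℂ} (hu : LocallyIntegrableOn u (Ioi 0)) (φ : 𝓓(posReals, ℂ)) :
    regular u φ = ∫ x, φ x * u x := by
  have hu' : LocallyIntegrableOn u (posReals : Set ℝ) := hu
  simp [regular, hu']

/-- `u ε → T` in the sense of distributions on `(0, ∞)` as `ε ↘ 0`, where the `u ε` are locally
integrable functions: `∫ φ(x) u_ε(x) dx → ⟨T, φ⟩` for every test function `φ`. -/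
def HasDistrLimit (u : ℝ → ℝ → ℂ) (T : Distr) : Prop :=
  (∀ ε > 0, LocallyIntegrableOn (u ε) (Ioi 0)) ∧
    ∀ φ : 𝓓(posReals, ℂ), Tendsto (fun ε => regular (u ε) φ) (𝓝[>] 0) (𝓝 (T φ))

theorem exists_contDiff_eqOn {g : ℝ → ℂ} (hg : ContDiffOn ℝ ∞ g (Ioi 0))
    (K : TopologicalSpace.Compacts ℝ) (hK : (K : Set ℝ) ⊆ posReals) :
    ∃ G : ℝ → ℂ, ContDiff ℝ ∞ G ∧ EqOn G g K := by
  obtain ⟨δ, hδ, hKδ⟩ : ∃ δ : ℝ, 0 < δ ∧ ∀ x ∈ K, δ ≤ x := by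
    rcases (K : Set ℝ).eq_empty_or_nonempty with h | h
    · refine ⟨1, one_pos, fun x hx => ?_⟩
      have : x ∈ (K : Set ℝ) := hx
      simp [h] at this
    · obtain ⟨δ, hδ, hmin⟩ := K.isCompact.exists_isLeast h
      exact ⟨δ, hK hδ, fun x hx => hmin hx⟩
  refine ⟨fun x => (Real.smoothTransition (2 * x / δ - 1) : ℂ) * g x, ?_, fun x hx => ?_⟩
  · rw [contDiff_iff_contDiffAt]
    intro x
    rcases lt_or_ge 0 x with hx | hx
    · have h1 : ContDiff ℝ ∞ fun x : ℝ => (Real.smoothTransition (2 * x / δ - 1) : ℂ) :=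
        Complex.ofRealCLM.contDiff.comp (Real.smoothTransition.contDiff.comp (by fun_prop))
      exact h1.contDiffAt.mul (hg.contDiffAt (Ioi_mem_nhds hx))
    · refine (contDiffAt_const (c := (0 : ℂ))).congr_of_eventuallyEq ?_
      filter_upwards [Iio_mem_nhds (show x < δ / 2 by linarith)] with y hy
      have : 2 * y / δ - 1 ≤ 0 := by
        rw [sub_nonpos, div_le_one hδ]
        have := mem_Iio.1 hy
        linarith
      simp [Real.smoothTransition.zero_of_nonpos this]
  · have : 1 ≤ 2 * x / δ - 1 := by
      have := hKδ x hx
      rw [le_sub_iff_add_le, le_div_iff₀ hδ]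
      linarith
    simp [Real.smoothTransition.one_of_one_le this]

/-- The product `g φ` of a smooth function on `(0, ∞)` and a test function. -/
def mulTest {g : ℝ → ℂ} (hg : ContDiffOn ℝ ∞ g (Ioi 0)) (φ : 𝓓(posReals, ℂ)) :
    𝓓(posReals, ℂ) where
  toFun x := g x * φ x
  contDiff' := by
    rw [contDiff_iff_contDiffAt]
    intro x
    by_cases hx : x ∈ tsupport φ
    · exact (hg.contDiffAt (Ioi_mem_nhds (φ.tsupport_subset hx))).mul φ.contDiff.contDiffAt
    · refine (contDiffAt_const (c := (0 : ℂ))).congr_of_eventuallyEq ?_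
      filter_upwards [(isClosed_tsupport φ).isOpen_compl.mem_nhds hx] with y hy
      simp [image_eq_zero_of_notMem_tsupport hy]
  hasCompactSupport' := φ.hasCompactSupport.mul_left
  tsupport_subset' := (closure_mono (Function.support_mul_subset_right g φ)).trans
    φ.tsupport_subset

/-- Multiplication by a smooth function on `(0, ∞)`, as a continuous linear map. -/
def mulTestCLM {g : ℝ → ℂ} (hg : ContDiffOn ℝ ∞ g (Ioi 0)) :
    𝓓(posReals, ℂ) →L[ℂ] 𝓓(posReals, ℂ) :=
  TestFunction.limitCLM ℂ (mulTest hg)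
    (fun K hK => (TestFunction.ofSupportedInCLM ℂ hK).comp
      (ContDiffMapSupportedIn.bilinLeftCLM (ContinuousLinearMap.mul ℂ ℂ)
        (exists_contDiff_eqOn hg K hK).choose_spec.1))
    (fun K hK φ => by
      ext x
      have h := (exists_contDiff_eqOn hg K hK).choose_spec.2
      by_cases hx : x ∈ (K : Set ℝ)
      · simp [mulTest, h hx, mul_comm]
      · simp [mulTest, φ.zero_on_compl hx])

theorem mulTestCLM_apply {g : ℝ → ℂ} (hg : ContDiffOn ℝ ∞ g (Ioi 0)) (φ : 𝓓(posReals, ℂ))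
    (x : ℝ) : mulTestCLM hg φ x = g x * φ x := rfl

open Classical in
/-- The product `g T` of a smooth function `g` on `(0, ∞)` and a distribution `T`, that is
`⟨g T, φ⟩ = ⟨T, g φ⟩` (and `0` when `g` is not smooth). -/
def smoothMul (g : ℝ → ℂ) (T : Distr) : Distr :=
  if hg : ContDiffOn ℝ ∞ g (Ioi 0) then T.comp (mulTestCLM hg) else 0

/-- The distribution `(x - 1 ± i0)^l`, for `s = ±1`: the limit, in the sense of distributions on
`(0, ∞)`, of the functions `(x - 1 ± iε)^l` as `ε ↘ 0`. -/
def subOneCpow (s : ℝ) (l : ℂ) : Distr :=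
  Classical.epsilon fun T : Distr =>
    HasDistrLimit (fun ε x => ((x : ℂ) - 1 + s * ε * Complex.I) ^ l) T

/-! ### Hypergeometric functions on the cut plane -/

/-- The cut plane `ℂ \ [1, ∞)`. -/
def cutPlane : Set ℂ := {z | 1 - z ∈ Complex.slitPlane}

/-- The holomorphic function on `ℂ \ [1, ∞)` that agrees with `p` on the open unit disc (unique
on the cut plane if it exists). Its values on the cut carry no meaning. -/
def cutContinuation (p : ℂ → ℂ) : ℂ → ℂ :=
  Classical.epsilon fun F : ℂ → ℂ =>
    DifferentiableOn ℂ F cutPlane ∧ EqOn F p (Metric.ball 0 1)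

/-- The regularized Gauss hypergeometric function `₂F₁(a, b; c; z) / Γ(c)` on `ℂ \ [1, ∞)`: the
continuation of the series `∑ₖ (a)ₖ (b)ₖ / (Γ(c + k) k!) zᵏ`. -/
def hypF (a b c : ℂ) : ℂ → ℂ := cutContinuation (Complex.regularizedGaussHGFun a b c)

/-- The series
`∑ₖ (a)ₖ (b)ₖ / ((m + k)! k!) {ψ(k + 1) + ψ(m + k + 1) - ψ(a + k) - ψ(b + k)} wᵏ`, `|w| < 1`. -/
def psiSeries (m : ℕ) (a b w : ℂ) : ℂ :=
  ∑' k : ℕ, (ascPochhammer ℂ k).eval a * (ascPochhammer ℂ k).eval b / ((Nat.factorial (m + k) : ℂ) * (Nat.factorial k : ℂ)) *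
    (Complex.digamma (k + 1) + Complex.digamma (m + k + 1) - Complex.digamma (a + k) -
      Complex.digamma (b + k)) * w ^ k

/-- The continuation of `psiSeries` to `ℂ \ [1, ∞)`. -/
def hypT (m : ℕ) (a b : ℂ) : ℂ → ℂ := cutContinuation (psiSeries m a b)

/-! ### The functions `f`, `q`, `h₁`, `h₂` -/

section Functions

variable (μ ν ρ : ℂ)

/-- `(1 + ρ + μ + ν) / 2`. -/
def aPlus : ℂ := (1 + ρ + μ + ν) / 2

/-- `(1 + ρ - μ + ν) / 2`. -/
def bPlus : ℂ := (1 + ρ - μ + ν) / 2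

/-- `(1 - ρ + μ + ν) / 2`. -/
def aMinus : ℂ := (1 - ρ + μ + ν) / 2

/-- `(1 - ρ - μ + ν) / 2`. -/
def bMinus : ℂ := (1 - ρ - μ + ν) / 2

/-- `f(z) = z^(-1-ρ-ν) F((1+ρ+μ+ν)/2, (1+ρ-μ+ν)/2; ν+1; z⁻²)`. -/
def f (z : ℂ) : ℂ :=
  z ^ (-1 - ρ - ν) * hypF (aPlus μ ν ρ) (bPlus μ ν ρ) (ν + 1) (z ^ 2)⁻¹

/-- `q(z) = F((1-ρ+μ+ν)/2, (1-ρ-μ+ν)/2; ν+1; z⁻²)`. -/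
def q (z : ℂ) : ℂ := hypF (aMinus μ ν ρ) (bMinus μ ν ρ) (ν + 1) (z ^ 2)⁻¹

/-- `1 - x⁻²`, as a complex number. -/
def argOf (x : ℝ) : ℂ := 1 - ((x : ℂ) ^ 2)⁻¹

/-- One of the upper parameters `(1-ρ±μ+ν)/2` is a non-positive integer, so that the
hypergeometric series of `q` is a polynomial in `z⁻²`. -/
def Terminating : Prop := (∃ n : ℕ, aMinus μ ν ρ = -n) ∨ ∃ n : ℕ, bMinus μ ν ρ = -n

/-- `h₁` when `ρ` is not an integer. -/
def h₁NonInt (x : ℝ) : ℂ :=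
  Real.pi / Complex.sin (Real.pi * ρ) *
    ((Complex.Gamma (aPlus μ ν ρ))⁻¹ * (Complex.Gamma (bPlus μ ν ρ))⁻¹ *
      hypF (aMinus μ ν ρ) (bMinus μ ν ρ) (1 - ρ) (argOf x))

/-- `h₂^±` (both signs) when `ρ` is not an integer. -/
def h₂NonInt (x : ℝ) : ℂ :=
  -(Real.pi / Complex.sin (Real.pi * ρ)) *
    ((Complex.Gamma (aMinus μ ν ρ))⁻¹ * (Complex.Gamma (bMinus μ ν ρ))⁻¹ *
      ((x : ℂ) ^ (-2 * ρ) * ((x : ℂ) + 1) ^ ρ *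
        hypF (aPlus μ ν ρ) (bPlus μ ν ρ) (ρ + 1) (argOf x)))

/-- `h₁` when `ρ = m` is a positive integer and the series of `q` does not terminate. -/
def h₁Int (m : ℕ) (x : ℝ) : ℂ :=
  (Complex.Gamma (aPlus μ ν m))⁻¹ * (Complex.Gamma (bPlus μ ν m))⁻¹ *
    ∑ k ∈ Finset.range m, (-1) ^ k * (Nat.factorial (m - k - 1) : ℂ) *
      (ascPochhammer ℂ k).eval (aMinus μ ν m) * (ascPochhammer ℂ k).eval (bMinus μ ν m) / (Nat.factorial k : ℂ) *
        argOf x ^ k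

/-- `log (1 - x⁻² ± i0) = log |1 - x⁻²| ± i π θ(1 - x)`. -/
def logBoundary (s x : ℝ) : ℂ :=
  Real.log |1 - (x ^ 2)⁻¹| + s * Complex.I * Real.pi * (if x < 1 then 1 else 0)

/-- `h₂^±`, for `s = ±1`, when `ρ = m` is a positive integer and the series of `q` does not
terminate. -/
def h₂Int (m : ℕ) (s x : ℝ) : ℂ :=
  (-1) ^ m * (Complex.Gamma (aMinus μ ν m))⁻¹ * (Complex.Gamma (bMinus μ ν m))⁻¹ *
    (((x : ℂ) ^ (2 * m))⁻¹ * ((x : ℂ) + 1) ^ m *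
      (hypT m (aPlus μ ν m) (bPlus μ ν m) (argOf x) -
        logBoundary s x * hypF (aPlus μ ν m) (bPlus μ ν m) (m + 1) (argOf x)))

open Classical in
/-- The smooth function `h₁`. For `ρ` an integer and `q` a polynomial in `z⁻²`, it is this
polynomial. -/
def h₁ (x : ℝ) : ℂ :=
  if ∃ m : ℕ, ρ = m then
    if Terminating μ ν ρ then
      Complex.regularizedGaussHGFun (aMinus μ ν ρ) (bMinus μ ν ρ) (ν + 1) ((x : ℂ) ^ 2)⁻¹
    else h₁Int μ ν ⌊ρ.re⌋₊ x
  else h₁NonInt μ ν ρ x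

open Classical in
/-- The locally integrable functions `h₂^±`, for `s = ±1`. -/
def h₂ (s x : ℝ) : ℂ :=
  if ∃ m : ℕ, ρ = m then
    if Terminating μ ν ρ then 0 else h₂Int μ ν ⌊ρ.re⌋₊ s x
  else h₂NonInt μ ν ρ x

end Functions

end WeberSchafheitlin

end

noncomputable section

namespace WeberSchafheitlin

/-! Everything follows from one formula, valid on the right half-plane off the real axis: q(z) =
H(z) + (z-1)^ρ (A(z) + log(z-1) B(z)), where H, A, B are holomorphic on the whole half-plane, H = h₁
on (0,∞), and A(x) + log(x-1±i0) B(x) = h₂^±(x) for x ≠ 1 (`BoundaryDecomposition`). Letting ε → 0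
gives the pointwise statement, Re ρ > 0 taking care of x = 1. Euler's transformation gives f(z) =
z^(-1+ρ-ν) (z+1)^(-ρ) (z-1)^(-ρ) q(z) (`f_eq_mul_q`), so f is a smooth factor times (z-1)^(-ρ) H + A
+ log(z-1) B, and the distributional limit is taken term by term (`hasDistrLimit_of_decomposition`).

The decomposition is the connection formula between the singular points 0 and 1 of the
hypergeometric equation in w = 1 - z⁻², where w^ρ = (z-1)^ρ (z+1)^ρ z^(-2ρ). For Re a, Re b > 0 and
0 < Re ρ < 1 it comes from comparing Wronskians of three solutions on (0,1), whose constants are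
read off at the end point 0 with Gauss's summation (`connection_of_re_pos`). Multiplied by
reciprocal Gamma factors both sides are entire in every parameter, so the identity theorem removes
the restrictions (`connection_real`). At ρ = m one factor vanishes, and differentiating the formula
in ρ yields the logarithmic case (`connection_nat_real`). A second identity theorem carries both
formulas to the doubly cut plane. If the series of q terminates, q extends across the cut and H = q.

That F and T exist on the cut plane is proved on coefficients: multiplying them by the moments of an
integrable function on (0,1) preserves continuability (`IsCutCont.moment`). Beta moments produce F
from the binomial series, and digamma differences are, up to a constant, moments too.

The distributions (x-1±i0)^l are obtained by descending from Re l > -1, where dominated convergence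
applies, through distributional derivatives. -/

theorem hasSum_congr_terms {u v : ℕ → ℂ} {S : ℂ} (h : ∀ k, u k = v k) :
    HasSum u S ↔ HasSum v S := by rw [funext h]

/-! ### Coefficients of the regularized hypergeometric series -/

/-- The Pochhammer symbol `(a)ₖ`. -/
def poch (a : ℂ) (k : ℕ) : ℂ := (ascPochhammer ℂ k).eval a

@[simp] theorem poch_zero (a : ℂ) : poch a 0 = 1 := by simp [poch]

theorem poch_succ (a : ℂ) (k : ℕ) : poch a (k + 1) = poch a k * (a + k) := by
  simp [poch, ascPochhammer_succ_eval]

theorem poch_add (a : ℂ) (m k : ℕ) : poch a (m + k) = poch a m * poch (a + m) k := by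
  induction k with
  | zero => simp
  | succ k ih => rw [← add_assoc, poch_succ, ih, poch_succ]; push_cast; ring

theorem poch_succ_left (a : ℂ) (k : ℕ) : poch a (k + 1) = a * poch (a + 1) k := by
  rw [add_comm, poch_add, poch_succ]; simp

theorem differentiable_poch (k : ℕ) : Differentiable ℂ fun a => poch a k :=
  (ascPochhammer ℂ k).differentiable

/-- The reciprocal Gamma function. -/
def rGamma (s : ℂ) : ℂ := (Complex.Gamma s)⁻¹

theorem differentiable_rGamma : Differentiable ℂ rGamma := Complex.differentiable_one_div_Gamma

theorem rGamma_eq (s : ℂ) : rGamma s = s * rGamma (s + 1) :=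
  Complex.one_div_Gamma_eq_self_mul_one_div_Gamma_add_one s

theorem rGamma_ne_zero {s : ℂ} (hs : ∀ m : ℕ, s ≠ -m) : rGamma s ≠ 0 :=
  inv_ne_zero (Complex.Gamma_ne_zero hs)

theorem rGamma_ne_zero_of_re_pos {s : ℂ} (hs : 0 < s.re) : rGamma s ≠ 0 :=
  inv_ne_zero (Complex.Gamma_ne_zero_of_re_pos hs)

theorem rGamma_eq_poch_mul (s : ℂ) (k : ℕ) : rGamma s = poch s k * rGamma (s + k) := by
  induction k with
  | zero => simp
  | succ k ih => rw [ih, rGamma_eq (s + k), poch_succ]; push_cast; ring_nf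

theorem rGamma_neg_nat (n : ℕ) : rGamma (-n) = 0 := by
  simp [rGamma, Complex.Gamma_neg_nat_eq_zero]

/-- The coefficients of the regularized Gauss hypergeometric series. -/
def hgCoeff (a b c : ℂ) (k : ℕ) : ℂ :=
  poch a k * poch b k * rGamma (c + k) / (k.factorial : ℂ)

/-- The recurrence is kept free of division because c + k may be zero; this is what allows arbitrary
complex c in the differential equation. -/
theorem hgCoeff_succ (a b c : ℂ) (k : ℕ) :
    (k + 1) * (c + k) * hgCoeff a b c (k + 1) = (a + k) * (b + k) * hgCoeff a b c k := by
  have h1 : ((k.factorial : ℕ) : ℂ) ≠ 0 := Nat.cast_ne_zero.2 k.factorial_ne_zero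
  have h2 : (k + 1 : ℂ) ≠ 0 := Nat.cast_add_one_ne_zero k
  simp only [hgCoeff, poch_succ, Nat.factorial_succ]
  rw [rGamma_eq (c + k)]
  push_cast
  rw [← add_assoc]
  field_simp

theorem hgCoeff_succ_shift (a b c : ℂ) (k : ℕ) :
    (k + 1) * hgCoeff a b c (k + 1) = a * b * hgCoeff (a + 1) (b + 1) (c + 1) k := by
  have h1 : ((k.factorial : ℕ) : ℂ) ≠ 0 := Nat.cast_ne_zero.2 k.factorial_ne_zero
  have h2 : (k + 1 : ℂ) ≠ 0 := Nat.cast_add_one_ne_zero k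
  simp only [hgCoeff, poch_succ_left, Nat.factorial_succ]
  push_cast
  rw [show c + (k + 1) = c + 1 + k by ring]
  field_simp

theorem differentiable_hgCoeff {a b c : ℂ → ℂ} (ha : Differentiable ℂ a)
    (hb : Differentiable ℂ b) (hc : Differentiable ℂ c) (k : ℕ) :
    Differentiable ℂ fun s => hgCoeff (a s) (b s) (c s) k := by
  have h1 := (differentiable_poch k).comp ha
  have h2 := (differentiable_poch k).comp hb
  have h3 := differentiable_rGamma.comp (hc.add_const (k : ℂ))
  exact ((h1.mul h2).mul h3).div_const _

theorem exists_bound_hgCoeff (R : ℝ) (k : ℕ) : ∃ B : ℝ, ∀ a b c : ℂ, ‖a‖ ≤ R → ‖b‖ ≤ R → ‖c‖ ≤ R →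
    ‖hgCoeff a b c k‖ ≤ B := by
  have hK : IsCompact ((Metric.closedBall (0 : ℂ) R) ×ˢ (Metric.closedBall (0 : ℂ) R) ×ˢ
      (Metric.closedBall (0 : ℂ) R)) :=
    (isCompact_closedBall _ _).prod ((isCompact_closedBall _ _).prod (isCompact_closedBall _ _))
  have hp := (differentiable_poch k).continuous
  have hg := differentiable_rGamma.continuous
  have hcont : Continuous fun p : ℂ × ℂ × ℂ => hgCoeff p.1 p.2.1 p.2.2 k := by
    unfold hgCoeff
    have h1 : Continuous fun p : ℂ × ℂ × ℂ => poch p.1 k := hp.comp continuous_fst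
    have h2 : Continuous fun p : ℂ × ℂ × ℂ => poch p.2.1 k :=
      hp.comp (continuous_fst.comp continuous_snd)
    have h3 : Continuous fun p : ℂ × ℂ × ℂ => rGamma (p.2.2 + k) :=
      hg.comp ((continuous_snd.comp continuous_snd).add continuous_const)
    exact ((h1.mul h2).mul h3).div_const _
  obtain ⟨B, hB⟩ := hK.exists_bound_of_continuousOn hcont.continuousOn
  refine ⟨B, fun a b c ha hb hc => hB (a, b, c) ?_⟩
  simp [ha, hb, hc]

/-- Bound of the terms of the hypergeometric series, uniform in the parameters. -/
theorem exists_summable_bound_hgCoeff (R : ℝ) {r : ℝ} (hr0 : 0 ≤ r) (hr : r < 1) :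
    ∃ u : ℕ → ℝ, Summable u ∧ ∀ a b c : ℂ, ‖a‖ ≤ R → ‖b‖ ≤ R → ‖c‖ ≤ R →
      ∀ k, ‖hgCoeff a b c k‖ * r ^ k ≤ u k := by
  rcases lt_or_ge R 0 with hR | hR
  · exact ⟨0, summable_zero, fun a b c ha => absurd (ha.trans_lt hR) (norm_nonneg a).not_gt⟩
  set q : ℝ := (1 + r) / 2 with hq
  have hrq : r < q := by rw [hq]; linarith
  have hq1 : q < 1 := by rw [hq]; linarith
  have hq0 : 0 < q := by linarith
  -- Beyond K the terms decay at least like q^k. The bound R + 1 keeps |c+k| ≥ k - R positive and k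
  -- ≥ 1; the quotient is what (R+k)² r ≤ q (k+1)(k-R) needs after expansion, the constant terms
  -- being absorbed by k ≥ 1.
  obtain ⟨K, hK⟩ := exists_nat_ge (max (R + 1) ((2 * r * R + q * R + (q * R + r * R ^ 2)) / (q - r)))
  have hK1 : R + 1 ≤ K := (le_max_left _ _).trans hK
  have hK2 : 2 * r * R + q * R + (q * R + r * R ^ 2) ≤ K * (q - r) :=
    (div_le_iff₀ (by linarith)).1 ((le_max_right _ _).trans hK)
  have hratio : ∀ k : ℕ, K ≤ k → (R + k) ^ 2 * r ≤ q * ((k + 1) * (k - R)) := by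
    intro k hk
    have hk' : (K : ℝ) ≤ k := Nat.cast_le.2 hk
    have h1 : (1 : ℝ) ≤ k := by linarith
    have h2 : 2 * r * R + q * R + (q * R + r * R ^ 2) ≤ k * (q - r) :=
      hK2.trans (mul_le_mul_of_nonneg_right hk' (by linarith))
    have h3 : 0 ≤ q * R + r * R ^ 2 := by positivity
    nlinarith [mul_le_mul_of_nonneg_right h2 (by linarith : (0 : ℝ) ≤ k),
      mul_le_mul_of_nonneg_left h1 h3]
  choose B hB using exists_bound_hgCoeff R
  -- C is large enough for the finitely many indices k ≤ K; the recurrence propagates the bound to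
  -- the others.
  set C : ℝ := ∑ k ∈ Finset.range (K + 1), |B k| * q⁻¹ ^ k with hC
  refine ⟨fun k => C * q ^ k, (summable_geometric_of_lt_one hq0.le hq1).mul_left C, ?_⟩
  intro a b c ha hb hc
  have small : ∀ k ≤ K, ‖hgCoeff a b c k‖ * r ^ k ≤ C * q ^ k := by
    intro k hk
    have h1 : |B k| * q⁻¹ ^ k ≤ C := Finset.single_le_sum
      (f := fun k => |B k| * q⁻¹ ^ k) (fun i _ => by positivity) (Finset.mem_range.2 (by omega))
    calc ‖hgCoeff a b c k‖ * r ^ k ≤ |B k| * q ^ k := by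
          gcongr
          exact (hB k a b c ha hb hc).trans (le_abs_self _)
      _ ≤ |B k| * 1 := by
          gcongr
          exact pow_le_one₀ hq0.le hq1.le
      _ = |B k| * q⁻¹ ^ k * q ^ k := by
          rw [mul_assoc, ← mul_pow, inv_mul_cancel₀ hq0.ne', one_pow]
      _ ≤ C * q ^ k := by gcongr
  intro k
  rcases le_total k K with hk | hk
  · exact small k hk
  · induction k, hk using Nat.le_induction with
    | base => exact small K le_rfl
    | succ k hk ih =>
      have hk' : (K : ℝ) ≤ k := Nat.cast_le.2 hk
      have hck : (k : ℝ) - R ≤ ‖c + k‖ := by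
        have := norm_sub_norm_le (k : ℂ) (-c)
        rw [sub_neg_eq_add, norm_neg, Complex.norm_natCast, add_comm] at this
        linarith
      have hpos : 0 < ((k : ℝ) + 1) * (k - R) := mul_pos (by positivity) (by linarith)
      have hrec := congrArg norm (hgCoeff_succ a b c k)
      rw [norm_mul, norm_mul, norm_mul, norm_mul] at hrec
      have hk1 : ‖(k + 1 : ℂ)‖ = k + 1 := by
        have := Complex.norm_natCast (k + 1)
        push_cast at this
        exact this
      rw [hk1] at hrec
      have hak : ‖a + k‖ ≤ R + k := (norm_add_le _ _).trans (by simpa using ha)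
      have hbk : ‖b + k‖ ≤ R + k := (norm_add_le _ _).trans (by simpa using hb)
      refine le_of_mul_le_mul_left ?_ hpos
      calc ((k : ℝ) + 1) * (k - R) * (‖hgCoeff a b c (k + 1)‖ * r ^ (k + 1))
          ≤ ((k : ℝ) + 1) * ‖c + k‖ * (‖hgCoeff a b c (k + 1)‖ * r ^ (k + 1)) := by gcongr
        _ = ‖a + k‖ * ‖b + k‖ * ‖hgCoeff a b c k‖ * r ^ (k + 1) := by rw [← hrec]; ring
        _ ≤ (R + k) * (R + k) * ‖hgCoeff a b c k‖ * r ^ (k + 1) := by gcongr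
        _ = ((R + k) ^ 2 * r) * (‖hgCoeff a b c k‖ * r ^ k) := by ring
        _ ≤ (q * ((k + 1) * (k - R))) * (C * q ^ k) := by
          exact mul_le_mul_of_nonneg_right (hratio k hk) (by positivity) |>.trans
            (mul_le_mul_of_nonneg_left ih (by positivity))
        _ = ((k : ℝ) + 1) * (k - R) * (C * q ^ (k + 1)) := by ring

theorem summable_hgCoeff_mul_pow (a b c : ℂ) {z : ℂ} (hz : ‖z‖ < 1) :
    Summable fun k => hgCoeff a b c k * z ^ k := by
  obtain ⟨u, hu, h⟩ := exists_summable_bound_hgCoeff (max ‖a‖ (max ‖b‖ ‖c‖)) (norm_nonneg z) hz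
  refine Summable.of_norm_bounded hu fun k => ?_
  rw [norm_mul, norm_pow]
  exact h a b c (by simp) (by simp) (by simp) k

theorem regularizedGaussHGFun_eq_tsum (a b c z : ℂ) :
    Complex.regularizedGaussHGFun a b c z = ∑' k, hgCoeff a b c k * z ^ k := by
  rw [Complex.regularizedGaussHGFun, FormalMultilinearSeries.sum]
  refine tsum_congr fun k => ?_
  rw [FormalMultilinearSeries.apply_eq_pow_smul_coeff, Complex.coeff_regularizedGaussHGFunSeries,
    smul_eq_mul, hgCoeff, rGamma, poch, poch]
  field_simp

theorem hasSum_hgCoeff (a b c : ℂ) {z : ℂ} (hz : ‖z‖ < 1) :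
    HasSum (fun k => hgCoeff a b c k * z ^ k) (Complex.regularizedGaussHGFun a b c z) := by
  rw [regularizedGaussHGFun_eq_tsum]
  exact (summable_hgCoeff_mul_pow a b c hz).hasSum

/-- Termwise differentiation of the hypergeometric series along a holomorphic curve of
parameters. -/
theorem hasSum_deriv_hgCoeff {a b c : ℂ → ℂ} (ha : Differentiable ℂ a)
    (hb : Differentiable ℂ b) (hc : Differentiable ℂ c) {z : ℂ} (hz : ‖z‖ < 1) (s : ℂ) :
    DifferentiableAt ℂ (fun s => Complex.regularizedGaussHGFun (a s) (b s) (c s) z) s ∧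
    HasSum (fun k => deriv (fun s => hgCoeff (a s) (b s) (c s) k) s * z ^ k)
      (deriv (fun s => Complex.regularizedGaussHGFun (a s) (b s) (c s) z) s) := by
  have hK := isCompact_closedBall s 1
  obtain ⟨A, hA⟩ := hK.exists_bound_of_continuousOn ha.continuous.continuousOn
  obtain ⟨B, hB⟩ := hK.exists_bound_of_continuousOn hb.continuous.continuousOn
  obtain ⟨C, hC⟩ := hK.exists_bound_of_continuousOn hc.continuous.continuousOn
  obtain ⟨u, hu, h⟩ := exists_summable_bound_hgCoeff (max A (max B C)) (norm_nonneg z) hz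
  have hd : ∀ k, Differentiable ℂ fun s => hgCoeff (a s) (b s) (c s) k * z ^ k := fun k =>
    (differentiable_hgCoeff ha hb hc k).mul_const _
  have hle : ∀ k : ℕ, ∀ w ∈ Metric.ball s 1, ‖hgCoeff (a w) (b w) (c w) k * z ^ k‖ ≤ u k := by
    intro k w hw
    have hw' := Metric.ball_subset_closedBall hw
    rw [norm_mul, norm_pow]
    exact h _ _ _ ((hA w hw').trans (by simp)) ((hB w hw').trans (by simp))
      ((hC w hw').trans (by simp)) k
  have hs : s ∈ Metric.ball s 1 := Metric.mem_ball_self one_pos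
  have e : (fun s => Complex.regularizedGaussHGFun (a s) (b s) (c s) z) =
      fun s => ∑' k, hgCoeff (a s) (b s) (c s) k * z ^ k :=
    funext fun s => regularizedGaussHGFun_eq_tsum _ _ _ _
  rw [e]
  refine ⟨(Complex.differentiableOn_tsum_of_summable_norm hu (fun k => (hd k).differentiableOn)
    Metric.isOpen_ball hle).differentiableAt (Metric.isOpen_ball.mem_nhds hs), ?_⟩
  have := Complex.hasSum_deriv_of_summable_norm hu (fun k => (hd k).differentiableOn)
    Metric.isOpen_ball hle hs
  refine (hasSum_congr_terms fun k => ?_).1 this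
  exact deriv_mul_const ((differentiable_hgCoeff ha hb hc k) s) _

theorem differentiable_regularizedGaussHGFun_param {a b c : ℂ → ℂ} (ha : Differentiable ℂ a)
    (hb : Differentiable ℂ b) (hc : Differentiable ℂ c) {z : ℂ} (hz : ‖z‖ < 1) :
    Differentiable ℂ fun s => Complex.regularizedGaussHGFun (a s) (b s) (c s) z := fun s =>
  (hasSum_deriv_hgCoeff ha hb hc hz s).1

theorem hasSum_shift_mul {u : ℕ → ℂ} {z S : ℂ} (h : HasSum (fun k => u (k + 1) * z ^ k) S) :
    HasSum (fun k => u k * z ^ k) (u 0 + z * S) := by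
  rw [← hasSum_nat_add_iff' 1]
  simp only [Finset.range_one, Finset.sum_singleton, pow_zero, mul_one, add_sub_cancel_left]
  refine (hasSum_congr_terms fun k => ?_).1 (h.mul_left z)
  ring

theorem hasSum_unshift {u : ℕ → ℂ} {z S : ℂ} (h : HasSum (fun k => u k * z ^ k) S) :
    HasSum (fun k => z * (u (k + 1) * z ^ k)) (S - u 0) := by
  rw [← hasSum_nat_add_iff' 1] at h
  simp only [Finset.range_one, Finset.sum_singleton, pow_zero, mul_one] at h
  refine (hasSum_congr_terms fun k => ?_).1 h
  ring

/-- Power series may be differentiated termwise on the open unit disc. -/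
theorem hasDerivAt_of_hasSum {u : ℕ → ℂ} {F : ℂ → ℂ}
    (h : ∀ z, ‖z‖ < 1 → HasSum (fun k => u k * z ^ k) (F z)) {z : ℂ} (hz : ‖z‖ < 1) :
    DifferentiableAt ℂ F z ∧ HasSum (fun k : ℕ => (k + 1) * u (k + 1) * z ^ k) (deriv F z) := by
  obtain ⟨r, hzr, hr1⟩ := exists_between hz
  have hr0 : 0 ≤ r := (norm_nonneg z).trans hzr.le
  have hs : Summable fun k => ‖u k‖ * r ^ k := by
    have := (h (r : ℂ) (by rwa [Complex.norm_real, Real.norm_of_nonneg hr0])).summable.norm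
    simpa [abs_of_nonneg hr0] using this
  have hle : ∀ k : ℕ, ∀ w ∈ Metric.ball (0 : ℂ) r, ‖u k * w ^ k‖ ≤ ‖u k‖ * r ^ k := by
    intro k w hw
    rw [norm_mul, norm_pow]
    have : ‖w‖ ≤ r := (mem_ball_zero_iff.1 hw).le
    gcongr
  have hd : ∀ k : ℕ, DifferentiableOn ℂ (fun w => u k * w ^ k) (Metric.ball (0 : ℂ) r) :=
    fun k => by fun_prop
  have hz' : z ∈ Metric.ball (0 : ℂ) r := mem_ball_zero_iff.2 hzr
  have e : F =ᶠ[𝓝 z] fun w => ∑' k, u k * w ^ k := by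
    filter_upwards [Metric.isOpen_ball.mem_nhds hz'] with w hw
    exact (h w ((mem_ball_zero_iff.1 hw).trans hr1)).tsum_eq.symm
  refine ⟨(((Complex.differentiableOn_tsum_of_summable_norm hs hd Metric.isOpen_ball
    hle).differentiableAt (Metric.isOpen_ball.mem_nhds hz')).congr_of_eventuallyEq e), ?_⟩
  have h1 := Complex.hasSum_deriv_of_summable_norm hs hd Metric.isOpen_ball hle hz'
  rw [← e.deriv_eq, ← hasSum_nat_add_iff' 1] at h1
  simp only [Finset.range_one, Finset.sum_singleton, pow_zero, mul_one, deriv_const,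
    sub_zero] at h1
  refine (hasSum_congr_terms fun k => ?_).1 h1
  simp
  ring

theorem hasDerivAt_regularizedGaussHGFun (a b c : ℂ) {z : ℂ} (hz : ‖z‖ < 1) :
    HasDerivAt (Complex.regularizedGaussHGFun a b c)
      (a * b * Complex.regularizedGaussHGFun (a + 1) (b + 1) (c + 1) z) z := by
  obtain ⟨h1, h2⟩ := hasDerivAt_of_hasSum (fun z hz => hasSum_hgCoeff a b c hz) hz
  have h3 := ((hasSum_hgCoeff (a + 1) (b + 1) (c + 1) hz).mul_left (a * b))
  have : deriv (Complex.regularizedGaussHGFun a b c) z =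
      a * b * Complex.regularizedGaussHGFun (a + 1) (b + 1) (c + 1) z := by
    refine h2.unique ?_
    refine (hasSum_congr_terms fun k => ?_).1 h3
    rw [hgCoeff_succ_shift]; ring
  exact this ▸ h1.hasDerivAt

/-! ### The cut plane -/

theorem isOpen_cutPlane : IsOpen cutPlane :=
  Complex.isOpen_slitPlane.preimage (continuous_const.sub continuous_id)

/-- The cut plane is star-shaped about 0. This gives its connectedness and keeps F(tz) defined under
the integral of `momentTransform`. -/
theorem smul_mem_cutPlane {z : ℂ} (hz : z ∈ cutPlane) {t : ℝ} (ht : t ∈ Icc (0 : ℝ) 1) :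
    (t : ℂ) * z ∈ cutPlane := by
  simp only [cutPlane, mem_ofPred_eq, Complex.mem_slitPlane_iff, Complex.sub_re, Complex.one_re,
    Complex.sub_im, Complex.one_im, Complex.re_ofReal_mul, Complex.im_ofReal_mul] at hz ⊢
  rcases eq_or_lt_of_le ht.1 with h0 | h0
  · left; simp [← h0]
  · rcases hz with hz | hz
    · left; nlinarith [ht.2]
    · right
      have : z.im ≠ 0 := by simpa using hz
      simp [h0.ne', this]

theorem zero_mem_cutPlane : (0 : ℂ) ∈ cutPlane := by simp [cutPlane]

theorem isPreconnected_cutPlane : IsPreconnected cutPlane := by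
  refine (StarConvex.isPathConnected (a := (0 : ℂ)) ?_ zero_mem_cutPlane).isConnected.isPreconnected
  rw [starConvex_zero_iff]
  intro z hz t h0 h1
  simpa using smul_mem_cutPlane hz ⟨h0, h1⟩

theorem mem_cutPlane_of_norm_lt_one {z : ℂ} (hz : ‖z‖ < 1) : z ∈ cutPlane := by
  left
  have := (abs_le.1 (Complex.abs_re_le_norm z)).2
  simp
  linarith

theorem ofReal_mem_cutPlane {x : ℝ} (hx : x < 1) : (x : ℂ) ∈ cutPlane := by
  left; simpa using hx

theorem mem_cutPlane_of_im_ne_zero {z : ℂ} (hz : z.im ≠ 0) : z ∈ cutPlane := by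
  right; simpa using hz

theorem eqOn_cutPlane_of_eqOn_ball {F G : ℂ → ℂ} (hF : DifferentiableOn ℂ F cutPlane)
    (hG : DifferentiableOn ℂ G cutPlane) {r : ℝ} (hr : 0 < r)
    (h : EqOn F G (Metric.ball 0 r)) : EqOn F G cutPlane :=
  (hF.analyticOnNhd isOpen_cutPlane).eqOn_of_preconnected_of_eventuallyEq
    (hG.analyticOnNhd isOpen_cutPlane) isPreconnected_cutPlane zero_mem_cutPlane
    (h.eventuallyEq_of_mem (Metric.ball_mem_nhds 0 hr))

/-! ### Power series with a continuation to the cut plane -/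

/-- The power series `∑ uₖ zᵏ` converges in the unit disc and `F` is its holomorphic continuation to
the cut plane. -/
def IsCutCont (u : ℕ → ℂ) (F : ℂ → ℂ) : Prop :=
  DifferentiableOn ℂ F cutPlane ∧ ∀ z : ℂ, ‖z‖ < 1 → HasSum (fun k => u k * z ^ k) (F z)

/-- The power series `∑ uₖ zᵏ` has a holomorphic continuation to the cut plane. -/
def CutCont (u : ℕ → ℂ) : Prop := ∃ F, IsCutCont u F

theorem CutCont.add {u v : ℕ → ℂ} (hu : CutCont u) (hv : CutCont v) :
    CutCont fun k => u k + v k := by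
  obtain ⟨F, hF, hF'⟩ := hu
  obtain ⟨G, hG, hG'⟩ := hv
  refine ⟨_, hF.add hG, fun z hz => (hasSum_congr_terms fun k => ?_).1 ((hF' z hz).add (hG' z hz))⟩
  ring

theorem CutCont.const_mul {u : ℕ → ℂ} (hu : CutCont u) (c : ℂ) : CutCont fun k => c * u k := by
  obtain ⟨F, hF, hF'⟩ := hu
  refine ⟨_, hF.const_mul c, fun z hz => (hasSum_congr_terms fun k => ?_).1 ((hF' z hz).mul_left c)⟩
  ring

theorem CutCont.congr {u v : ℕ → ℂ} (hu : CutCont u) (h : ∀ k, v k = u k) : CutCont v := by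
  rwa [funext h]

/-- Prepending a coefficient is z ↦ u₀ + z F(z). Removing one is the inverse operation, division of
F - F(0) by z, whose singularity at 0 is removable: hence `dslope`. -/
theorem cutCont_succ_iff {u : ℕ → ℂ} : CutCont (fun k => u (k + 1)) ↔ CutCont u := by
  constructor
  · rintro ⟨F, hF, hF'⟩
    exact ⟨fun z => u 0 + z * F z, (differentiableOn_id.mul hF).const_add _, fun z hz =>
      hasSum_shift_mul (hF' z hz)⟩
  · rintro ⟨F, hF, hF'⟩
    have h0 : F 0 = u 0 := by
      have h1 := hF' 0 (by simp)
      refine h1.unique ?_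
      convert hasSum_single (f := fun k => u k * (0 : ℂ) ^ k) 0 (fun k hk => by simp [hk]) using 1
      simp
    refine ⟨dslope F 0, (Complex.differentiableOn_dslope
      (isOpen_cutPlane.mem_nhds zero_mem_cutPlane)).2 hF, fun z hz => ?_⟩
    rcases eq_or_ne z 0 with rfl | hz0
    · rw [dslope_same]
      have := (hasDerivAt_of_hasSum hF' (z := 0) (by simp)).2
      refine (hasSum_congr_terms fun k => ?_).1 this
      rcases k with _ | k <;> simp
    · have := (hasSum_unshift (hF' z hz)).mul_left z⁻¹
      rw [dslope_of_ne _ hz0, slope_def_field, h0, sub_zero, div_eq_inv_mul]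
      refine (hasSum_congr_terms fun k => ?_).1 this
      rw [inv_mul_cancel_left₀ hz0]

/-- Finitely many coefficients do not affect continuability. Dropping them shifts parameters to the
right, which makes the integrals below converge. -/
theorem cutCont_add_iff {u : ℕ → ℂ} (N : ℕ) : CutCont (fun k => u (k + N)) ↔ CutCont u := by
  induction N with
  | zero => rfl
  | succ N ih =>
    rw [← ih, ← cutCont_succ_iff (u := fun k => u (k + N))]
    simp only [add_assoc, add_comm 1 N]

/-- The factor x + k on coefficients is the operator x + z d/dz on functions. -/
theorem CutCont.add_natCast_mul {u : ℕ → ℂ} (hu : CutCont u) (x : ℂ) :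
    CutCont fun k => (x + k) * u k := by
  obtain ⟨F, hF, hF'⟩ := hu
  have hd : DifferentiableOn ℂ (fun z => z * deriv F z) cutPlane :=
    differentiableOn_id.mul (hF.deriv isOpen_cutPlane)
  have : CutCont fun k => (k : ℂ) * u k := by
    refine ⟨_, hd, fun z hz => ?_⟩
    have h1 := (hasDerivAt_of_hasSum hF' hz).2
    have h2 := hasSum_shift_mul (u := fun k => (k : ℂ) * u k) (z := z) (S := deriv F z)
      (by simpa using h1)
    simpa using h2
  refine (CutCont.add (CutCont.const_mul ⟨F, hF, hF'⟩ x) this).congr fun k => ?_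
  ring

/-- The integral `∫₀¹ F(tz) g(t) dt`. -/
def momentTransform (F : ℂ → ℂ) (g : ℝ → ℂ) (z : ℂ) : ℂ := ∫ t in (0 : ℝ)..1, F (t * z) * g t

/-- Differentiation under the integral sign: the points tz, for t in [0,1] and z in a small closed
disc, fill a compact subset of the cut plane, on which F' is bounded. -/
theorem differentiableOn_momentTransform {F : ℂ → ℂ} (hF : DifferentiableOn ℂ F cutPlane)
    {g : ℝ → ℂ} (hg : IntervalIntegrable g volume 0 1) :
    DifferentiableOn ℂ (momentTransform F g) cutPlane := by
  intro z₀ hz₀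
  obtain ⟨r, hr, hball⟩ := Metric.nhds_basis_closedBall.mem_iff.1 (isOpen_cutPlane.mem_nhds hz₀)
  have hcont : ∀ z ∈ cutPlane, ∀ {G : ℂ → ℂ}, ContinuousOn G cutPlane →
      ContinuousOn (fun t : ℝ => G (t * z)) (uIcc 0 1) := by
    intro z hz G hG
    refine hG.comp (by fun_prop) fun t ht => smul_mem_cutPlane hz ?_
    rwa [uIcc_of_le zero_le_one] at ht
  have hd : ContinuousOn (deriv F) cutPlane := (hF.deriv isOpen_cutPlane).continuousOn
  have hK : IsCompact ((fun p : ℝ × ℂ => (p.1 : ℂ) * p.2) '' (Icc 0 1 ×ˢ Metric.closedBall z₀ r)) :=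
    (isCompact_Icc.prod (isCompact_closedBall _ _)).image (by fun_prop)
  have hKsub : (fun p : ℝ × ℂ => (p.1 : ℂ) * p.2) '' (Icc 0 1 ×ˢ Metric.closedBall z₀ r) ⊆
      cutPlane := by
    rintro _ ⟨⟨t, z⟩, ⟨ht, hz⟩, rfl⟩
    exact smul_mem_cutPlane (hball hz) ht
  obtain ⟨M, hM⟩ := hK.exists_bound_of_continuousOn (hd.mono hKsub)
  have hmem : ∀ t ∈ uIoc (0 : ℝ) 1, t ∈ Icc (0 : ℝ) 1 := fun t ht => by
    rw [uIoc_of_le zero_le_one] at ht; exact ⟨ht.1.le, ht.2⟩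
  have hint : ∀ z ∈ cutPlane, ∀ {G : ℂ → ℂ}, ContinuousOn G cutPlane →
      IntervalIntegrable (fun t : ℝ => G (t * z) * g t) volume 0 1 := fun z hz G hG =>
    hg.continuousOn_mul (hcont z hz hG)
  have key := intervalIntegral.hasDerivAt_integral_of_dominated_loc_of_deriv_le
    (F := fun (z : ℂ) (t : ℝ) => F (t * z) * g t)
    (F' := fun (z : ℂ) (t : ℝ) => t * deriv F (t * z) * g t) (x₀ := z₀) (μ := volume)
    (a := 0) (b := 1) (s := Metric.closedBall z₀ r) (bound := fun t => M * ‖g t‖)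
    (Metric.closedBall_mem_nhds z₀ hr) ?_ (hint z₀ hz₀ hF.continuousOn) ?_ ?_
    (hg.norm.const_mul M) ?_
  · exact key.2.differentiableAt.differentiableWithinAt
  · filter_upwards [isOpen_cutPlane.mem_nhds hz₀] with z hz
    exact (hint z hz hF.continuousOn).def'.aestronglyMeasurable
  · have : IntervalIntegrable (fun t : ℝ => t * deriv F (t * z₀) * g t) volume 0 1 :=
      hg.continuousOn_mul (Complex.continuous_ofReal.continuousOn.mul (hcont z₀ hz₀ hd))
    exact this.def'.aestronglyMeasurable
  · refine Eventually.of_forall fun t ht z hz => ?_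
    have ht' := hmem t ht
    rw [norm_mul, norm_mul, Complex.norm_real, Real.norm_of_nonneg ht'.1]
    have h1 := hM _ ⟨(t, z), ⟨ht', hz⟩, rfl⟩
    have h2 : t * ‖deriv F (t * z)‖ ≤ 1 * M :=
      mul_le_mul ht'.2 h1 (norm_nonneg _) zero_le_one
    simpa using mul_le_mul_of_nonneg_right h2 (norm_nonneg (g t))
  · refine Eventually.of_forall fun t ht z hz => ?_
    have h1 : HasDerivAt F (deriv F (t * z)) (t * z) :=
      ((hF _ (smul_mem_cutPlane (hball hz) (hmem t ht))).differentiableAt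
        (isOpen_cutPlane.mem_nhds (smul_mem_cutPlane (hball hz) (hmem t ht)))).hasDerivAt
    have h2 : HasDerivAt (fun z : ℂ => (t : ℂ) * z) t z := by
      simpa using (hasDerivAt_id z).const_mul (t : ℂ)
    have h3 := (h1.comp z h2).mul_const (g t)
    rwa [mul_comm (deriv F _)] at h3

/-- Multiplying the coefficients by the moments of an integrable function on `(0, 1)` preserves
continuability to the cut plane. -/
theorem IsCutCont.moment {u : ℕ → ℂ} {F : ℂ → ℂ} (h : IsCutCont u F) {g : ℝ → ℂ}
    (hg : IntervalIntegrable g volume 0 1) :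
    IsCutCont (fun k => u k * ∫ t in (0 : ℝ)..1, (t : ℂ) ^ k * g t) (momentTransform F g) := by
  refine ⟨differentiableOn_momentTransform h.1 hg, fun z hz => ?_⟩
  have hmem : ∀ t ∈ uIoc (0 : ℝ) 1, t ∈ Icc (0 : ℝ) 1 := fun t ht => by
    rw [uIoc_of_le zero_le_one] at ht; exact ⟨ht.1.le, ht.2⟩
  have hs : Summable fun k => ‖u k * z ^ k‖ := (h.2 z hz).summable.norm
  have key := intervalIntegral.hasSum_integral_of_dominated_convergence (a := 0) (b := 1)
    (μ := volume) (f := fun t : ℝ => F (t * z) * g t)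
    (F := fun (k : ℕ) (t : ℝ) => u k * (t * z) ^ k * g t)
    (bound := fun k t => ‖u k * z ^ k‖ * ‖g t‖) ?_ ?_ ?_ ?_ ?_
  · refine (hasSum_congr_terms fun k => ?_).1 key
    rw [mul_right_comm, ← intervalIntegral.integral_const_mul]
    congr 1
    ext t
    rw [mul_pow]; ring
  · intro k
    have hc : ContinuousOn (fun t : ℝ => u k * (t * z) ^ k) (uIcc 0 1) := by fun_prop
    exact (hg.continuousOn_mul hc).def'.aestronglyMeasurable
  · refine fun k => Eventually.of_forall fun t ht => ?_
    rw [norm_mul, mul_pow, norm_mul, norm_mul, norm_mul, norm_pow (t : ℂ), Complex.norm_real,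
      Real.norm_of_nonneg (hmem t ht).1]
    have : t ^ k ≤ 1 := pow_le_one₀ (hmem t ht).1 (hmem t ht).2
    have h2 : t ^ k * ‖z ^ k‖ ≤ 1 * ‖z ^ k‖ := mul_le_mul_of_nonneg_right this (norm_nonneg _)
    rw [one_mul] at h2
    gcongr
  · exact Eventually.of_forall fun t _ => hs.mul_right _
  · simp_rw [tsum_mul_right]
    exact hg.norm.const_mul _
  · refine Eventually.of_forall fun t ht => ?_
    refine (h.2 (t * z) ?_).mul_right (g t)
    rw [norm_mul, Complex.norm_real, Real.norm_of_nonneg (hmem t ht).1]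
    exact (mul_le_of_le_one_left (norm_nonneg _) (hmem t ht).2).trans_lt hz

/-! ### Continuation of the hypergeometric series -/

theorem isCutCont_binomial (a : ℂ) :
    IsCutCont (fun k => poch a k / (k.factorial : ℂ)) fun z => (1 - z) ^ (-a) := by
  refine ⟨fun z hz => ?_, fun z hz => ?_⟩
  · have h1 : HasDerivAt (fun z : ℂ => 1 - z) (-1) z := by
      simpa using (hasDerivAt_id z).const_sub 1
    exact (h1.cpow_const (c := -a) hz).differentiableAt.differentiableWithinAt
  · have h := (Complex.one_div_one_sub_cpow_hasFPowerSeriesOnBall_zero a).hasSum (y := z)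
      (by simpa [enorm_eq_nnnorm, ← NNReal.coe_lt_coe] using hz)
    rw [zero_add, one_div, ← Complex.cpow_neg] at h
    refine (hasSum_congr_terms fun k => ?_).1 h
    rw [FormalMultilinearSeries.apply_eq_pow_smul_coeff, FormalMultilinearSeries.coeff_ofScalars,
      smul_eq_mul, mul_comm]
    congr 1
    -- The binomial coefficient of a + k - 1 over k is a multichoose, that is (a)ₖ / k!.
    have h1 := Ring.factorial_nsmul_multichoose_eq_ascPochhammer a k
    rw [Polynomial.ascPochhammer_smeval_eq_eval, nsmul_eq_mul] at h1
    change Ring.choose _ _ = (ascPochhammer ℂ k).eval a / _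
    rw [Ring.choose, show a + k - 1 - k + 1 = a by ring, ← h1,
      mul_div_cancel_left₀ _ (Nat.cast_ne_zero.2 k.factorial_ne_zero)]

/-- The integrand of the Beta integral. -/
def betaKernel (b d : ℂ) (t : ℝ) : ℂ := (t : ℂ) ^ (b - 1) * (1 - (t : ℂ)) ^ (d - 1)

theorem intervalIntegrable_betaKernel {b d : ℂ} (hb : 0 < b.re) (hd : 0 < d.re) :
    IntervalIntegrable (betaKernel b d) volume 0 1 := Complex.betaIntegral_convergent hb hd

/-- With d = c - b these moments turn the binomial coefficients (a)ₖ / k! into `hgCoeff a b c k`, up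
to a factor independent of k. -/
theorem integral_pow_mul_betaKernel {b d : ℂ} (hb : 0 < b.re) (hd : 0 < d.re) (k : ℕ) :
    ∫ t in (0 : ℝ)..1, (t : ℂ) ^ k * betaKernel b d t =
      Complex.Gamma b * Complex.Gamma d * (poch b k * rGamma (b + d + k)) := by
  have hbk : 0 < (b + k).re := by
    rw [Complex.add_re, Complex.natCast_re]; positivity
  have h1 : ∫ t in (0 : ℝ)..1, (t : ℂ) ^ k * betaKernel b d t = Complex.betaIntegral (b + k) d := by
    rw [Complex.betaIntegral]
    refine intervalIntegral.integral_congr_ae (Eventually.of_forall fun t ht => ?_)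
    rw [uIoc_of_le zero_le_one] at ht
    have : (t : ℂ) ≠ 0 := Complex.ofReal_ne_zero.2 ht.1.ne'
    rw [betaKernel, ← mul_assoc, show b + k - 1 = b - 1 + k by ring, Complex.cpow_add _ _ this,
      Complex.cpow_natCast]
    ring
  have h2 := rGamma_eq_poch_mul b k
  have h3 := Complex.Gamma_ne_zero_of_re_pos hb
  have h4 := Complex.Gamma_ne_zero_of_re_pos hbk
  rw [h1, Complex.betaIntegral_eq_Gamma_mul_div _ _ hbk hd, show b + k + d = b + d + k by ring]
  rw [rGamma, rGamma] at h2
  have h5 : poch b k = Complex.Gamma (b + k) / Complex.Gamma b := by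
    field_simp at h2 ⊢
    exact h2.symm
  rw [h5, rGamma]
  field_simp

/-- Euler's integral representation. -/
theorem isCutCont_eulerIntegral (a : ℂ) {b c : ℂ} (hb : 0 < b.re) (hc : 0 < (c - b).re) :
    IsCutCont (fun k => Complex.Gamma b * Complex.Gamma (c - b) * hgCoeff a b c k)
      (momentTransform (fun z => (1 - z) ^ (-a)) (betaKernel b (c - b))) := by
  have := (isCutCont_binomial a).moment (intervalIntegrable_betaKernel hb hc)
  refine ⟨this.1, fun z hz => (hasSum_congr_terms fun k => ?_).1 (this.2 z hz)⟩
  beta_reduce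
  rw [integral_pow_mul_betaKernel hb hc, hgCoeff, show b + (c - b) = c by ring]
  ring

/-- Euler's integral also needs Re b > 0. Dropping N coefficients replaces b by b + N and leaves c -
b unchanged, so the Beta moments apply to the tail. -/
theorem cutCont_hgCoeff_of_re_lt (a b : ℂ) {c : ℂ} (hc : 0 < (c - b).re) :
    CutCont (hgCoeff a b c) := by
  obtain ⟨N, hN⟩ := exists_nat_gt (-b.re)
  have hbN : 0 < (b + N).re := by
    rw [Complex.add_re, Complex.natCast_re]; linarith
  rw [← cutCont_add_iff N]
  have h1 : CutCont fun k => poch a (k + N) / ((k + N).factorial : ℂ) :=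
    (cutCont_add_iff (u := fun k => poch a k / (k.factorial : ℂ)) N).2 ⟨_, isCutCont_binomial a⟩
  obtain ⟨F, hF⟩ := h1
  have h2 : CutCont _ := ⟨_, hF.moment (intervalIntegrable_betaKernel hbN hc)⟩
  have h3 := Complex.Gamma_ne_zero_of_re_pos hbN
  have h4 := Complex.Gamma_ne_zero_of_re_pos hc
  refine (h2.const_mul (poch b N * (Complex.Gamma (b + N) * Complex.Gamma (c - b))⁻¹)).congr
    fun k => ?_
  rw [integral_pow_mul_betaKernel hbN hc, hgCoeff, add_comm k N, poch_add b,
    show b + N + (c - b) + k = c + (N + k : ℕ) by push_cast; ring]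
  field_simp

theorem hgCoeff_sub_one (a b c : ℂ) (k : ℕ) :
    hgCoeff a b (c - 1) k = (c - 1 + k) * hgCoeff a b c k := by
  rw [hgCoeff, hgCoeff, rGamma_eq (c - 1 + k), show c - 1 + k + 1 = c + k by ring]
  ring

/-- Lowering c by one multiplies the k-th coefficient by a factor affine in k, which preserves
continuability; so one descends from values of c with Re c > Re b. -/
theorem cutCont_hgCoeff (a b c : ℂ) : CutCont (hgCoeff a b c) := by
  obtain ⟨N, hN⟩ := exists_nat_gt (b - c).re
  induction N generalizing c with
  | zero =>
    refine cutCont_hgCoeff_of_re_lt a b ?_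
    simp at hN ⊢
    linarith
  | succ N ih =>
    have h1 := ih (c + 1) (by simp at hN ⊢; linarith)
    have h2 := h1.add_natCast_mul c
    refine h2.congr fun k => ?_
    have := hgCoeff_sub_one a b (c + 1) k
    rwa [add_sub_cancel_right] at this

theorem cutContinuation_spec {u : ℕ → ℂ} (hu : CutCont u) {p : ℂ → ℂ}
    (hp : ∀ z, p z = ∑' k, u k * z ^ k) : IsCutCont u (cutContinuation p) := by
  obtain ⟨F, hF, hF'⟩ := hu
  have h := Classical.epsilon_spec (p := fun F : ℂ → ℂ =>
    DifferentiableOn ℂ F cutPlane ∧ EqOn F p (Metric.ball 0 1)) ⟨F, hF, fun z hz => by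
      rw [hp, (hF' z (mem_ball_zero_iff.1 hz)).tsum_eq]⟩
  refine ⟨h.1, fun z hz => ?_⟩
  rw [cutContinuation, h.2 (mem_ball_zero_iff.2 hz), hp]
  exact (hF' z hz).summable.hasSum

theorem isCutCont_hypF (a b c : ℂ) : IsCutCont (hgCoeff a b c) (hypF a b c) :=
  cutContinuation_spec (cutCont_hgCoeff a b c) (regularizedGaussHGFun_eq_tsum a b c)

theorem differentiableOn_hypF (a b c : ℂ) : DifferentiableOn ℂ (hypF a b c) cutPlane :=
  (isCutCont_hypF a b c).1

theorem hypF_eq_of_norm_lt_one (a b c : ℂ) {z : ℂ} (hz : ‖z‖ < 1) :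
    hypF a b c z = Complex.regularizedGaussHGFun a b c z :=
  ((isCutCont_hypF a b c).2 z hz).unique (hasSum_hgCoeff a b c hz)

/-! ### Continuation of the series with digamma coefficients -/

/-- The integrand of the integral representation of the difference of two digamma values. -/
def digammaKernel (p r : ℂ) (t : ℝ) : ℂ := ((t : ℂ) ^ (p - 1) - (t : ℂ) ^ (r - 1)) / (1 - t)

/-- Near 0 the powers are integrable since their exponents have real part above -1. Near 1 the
kernel is minus the difference quotient at 1 of a smooth function vanishing there, hence bounded. -/
theorem intervalIntegrable_digammaKernel {p r : ℂ} (hp : 0 < p.re) (hr : 0 < r.re) :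
    IntervalIntegrable (digammaKernel p r) volume 0 1 := by
  set φ : ℝ → ℂ := fun t => (t : ℂ) ^ (p - 1) - (t : ℂ) ^ (r - 1) with hφ
  have hd : ∀ t : ℝ, 0 < t → DifferentiableAt ℝ φ t := by
    intro t ht
    have h : ∀ x : ℂ, DifferentiableAt ℝ (fun t : ℝ => (t : ℂ) ^ x) t := fun x =>
      (((hasDerivAt_id (t : ℂ)).cpow_const (c := x)
        (Complex.ofReal_mem_slitPlane.2 ht)).comp_ofReal).differentiableAt
    exact (h _).sub (h _)
  have hi : ∀ a b : ℝ, IntervalIntegrable φ volume a b := fun a b =>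
    (intervalIntegral.intervalIntegrable_cpow' (by simpa using hp)).sub
      (intervalIntegral.intervalIntegrable_cpow' (by simpa using hr))
  refine IntervalIntegrable.trans (b := 1 / 2) ?_ ?_
  · have hc : ContinuousOn (fun t : ℝ => (1 - (t : ℂ))⁻¹) (uIcc 0 (1 / 2)) := by
      refine ContinuousOn.inv₀ (by fun_prop) fun t ht => ?_
      rw [uIcc_of_le (by norm_num)] at ht
      rw [sub_ne_zero]
      norm_cast
      linarith [ht.2]
    exact (hi 0 (1 / 2)).mul_continuousOn hc
  · have hc : ContinuousOn (dslope φ 1) (uIcc (1 / 2) 1) := by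
      rw [uIcc_of_le (by norm_num)]
      have hsub : Icc (1 / 2 : ℝ) 1 ⊆ Ioi 0 := fun t ht =>
        lt_of_lt_of_le (by norm_num : (0 : ℝ) < 1 / 2) ht.1
      refine ContinuousOn.mono ?_ hsub
      rw [continuousOn_dslope (Ioi_mem_nhds one_pos)]
      exact ⟨fun t ht => (hd t ht).continuousAt.continuousWithinAt, hd 1 one_pos⟩
    refine (hc.intervalIntegrable (μ := volume)).neg.congr_ae ?_
    filter_upwards [(measure_eq_zero_iff_ae_notMem (μ := volume.restrict (uIoc (1 / 2 : ℝ) 1))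
      (s := {(1 : ℝ)})).1 (by simp)] with t ht
    have ht1 : t ≠ 1 := by simpa using ht
    rw [Pi.neg_apply, dslope_of_ne _ ht1, slope_def_module, digammaKernel]
    have h1 : (1 - (t : ℂ)) ≠ 0 := by
      rw [sub_ne_zero]; norm_cast; exact ht1.symm
    have h2 : ((t : ℂ) - 1) ≠ 0 := by
      rw [sub_ne_zero]; norm_cast
    have h3 : φ 1 = 0 := by simp [hφ]
    rw [h3, sub_zero, hφ, Complex.real_smul]
    push_cast
    field_simp
    ring

theorem integral_pow_mul_cpow {p : ℂ} (hp : 0 < p.re) (k : ℕ) :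
    ∫ t in (0 : ℝ)..1, (t : ℂ) ^ k * (t : ℂ) ^ (p - 1) = (p + k)⁻¹ := by
  have h := integral_pow_mul_betaKernel hp (d := 1) (by simp) k
  simp only [betaKernel, sub_self, Complex.cpow_zero, mul_one, Complex.Gamma_one] at h
  have hpk : 0 < (p + k).re := by
    rw [Complex.add_re, Complex.natCast_re]; positivity
  have h0 : p + k ≠ 0 := fun h => by simp [h] at hpk
  have h2 := rGamma_eq_poch_mul p k
  have h3 := rGamma_eq (p + k)
  have h4 := rGamma_ne_zero_of_re_pos hp
  rw [h, show p + 1 + k = p + k + 1 by ring]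
  rw [h3] at h2
  have h5 : Complex.Gamma p = (rGamma p)⁻¹ := by simp [rGamma]
  rw [h5]
  field_simp
  rw [h2]
  ring

/-- Telescoping: ψ(x+1) = ψ(x) + 1/x, while 1/(p+k) - 1/(r+k) is the integral of t^k (1-t) times the
kernel. The part independent of k is zero by Gauss's integral for ψ, but its value is never needed.
-/
theorem digamma_sub_eq {p r : ℂ} (hp : 0 < p.re) (hr : 0 < r.re) (k : ℕ) :
    Complex.digamma (p + k) - Complex.digamma (r + k) =
      Complex.digamma p - Complex.digamma r + (∫ t in (0 : ℝ)..1, digammaKernel p r t) -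
        ∫ t in (0 : ℝ)..1, (t : ℂ) ^ k * digammaKernel p r t := by
  have hg := intervalIntegrable_digammaKernel hp hr
  have hgk : ∀ k : ℕ, IntervalIntegrable (fun t : ℝ => (t : ℂ) ^ k * digammaKernel p r t)
      volume 0 1 := fun k => hg.continuousOn_mul (by fun_prop)
  have hcp : ∀ {x : ℂ}, 0 < x.re → ∀ k : ℕ, IntervalIntegrable
      (fun t : ℝ => (t : ℂ) ^ k * (t : ℂ) ^ (x - 1)) volume 0 1 := fun {x} hx k =>
    (intervalIntegral.intervalIntegrable_cpow' (by simpa using hx)).continuousOn_mul (by fun_prop)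
  have hne : ∀ {x : ℂ}, 0 < x.re → ∀ k : ℕ, ∀ m : ℕ, x + k ≠ -m := by
    intro x hx k m h
    have := congrArg Complex.re h
    simp at this
    have h1 : (0 : ℝ) ≤ k := k.cast_nonneg
    have h2 : (0 : ℝ) ≤ m := m.cast_nonneg
    linarith
  induction k with
  | zero => simp
  | succ k ih =>
    have h1 : (∫ t in (0 : ℝ)..1, (t : ℂ) ^ k * digammaKernel p r t) -
        ∫ t in (0 : ℝ)..1, (t : ℂ) ^ (k + 1) * digammaKernel p r t = (p + k)⁻¹ - (r + k)⁻¹ := by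
      rw [← intervalIntegral.integral_sub (hgk k) (hgk (k + 1)), ← integral_pow_mul_cpow hp k,
        ← integral_pow_mul_cpow hr k, ← intervalIntegral.integral_sub (hcp hp k) (hcp hr k)]
      refine intervalIntegral.integral_congr_ae ?_
      filter_upwards [(measure_eq_zero_iff_ae_notMem (μ := volume) (s := {(1 : ℝ)})).1 (by simp)]
        with t ht _
      have ht1 : 1 - (t : ℂ) ≠ 0 := by
        rw [sub_ne_zero]; norm_cast; exact fun h => ht h.symm
      rw [digammaKernel]
      field_simp
      ring
    push_cast
    rw [← add_assoc, ← add_assoc, Complex.digamma_apply_add_one _ (hne hp k),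
      Complex.digamma_apply_add_one _ (hne hr k)]
    linear_combination ih - h1

theorem CutCont.mul_digamma_sub {u : ℕ → ℂ} (hu : CutCont u) (p r : ℂ) :
    CutCont fun k => u k * (Complex.digamma (p + k) - Complex.digamma (r + k)) := by
  obtain ⟨N, hN⟩ := exists_nat_gt (max (-p.re) (-r.re))
  have hp : 0 < (p + N).re := by
    have := (le_max_left _ _).trans_lt hN
    rw [Complex.add_re, Complex.natCast_re]; linarith
  have hr : 0 < (r + N).re := by
    have := (le_max_right _ _).trans_lt hN
    rw [Complex.add_re, Complex.natCast_re]; linarith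
  rw [← cutCont_add_iff N]
  obtain ⟨F, hF⟩ := (cutCont_add_iff N).2 hu
  have h1 : CutCont _ := ⟨_, hF.moment (intervalIntegrable_digammaKernel hp hr)⟩
  refine ((CutCont.const_mul ⟨F, hF⟩ (Complex.digamma (p + N) - Complex.digamma (r + N) +
    ∫ t in (0 : ℝ)..1, digammaKernel (p + N) (r + N) t)).add (h1.const_mul (-1))).congr
    fun k => ?_
  have := digamma_sub_eq hp hr k
  push_cast
  rw [show p + (k + N) = p + N + k by ring, show r + (k + N) = r + N + k by ring, this]
  ring

/-- The coefficients of `psiSeries`. -/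
def psiCoeff (m : ℕ) (a b : ℂ) (k : ℕ) : ℂ :=
  hgCoeff a b (m + 1) k * (Complex.digamma (k + 1) + Complex.digamma (m + k + 1) -
    Complex.digamma (a + k) - Complex.digamma (b + k))

theorem psiSeries_eq_tsum (m : ℕ) (a b w : ℂ) : psiSeries m a b w = ∑' k, psiCoeff m a b k * w ^ k := by
  refine tsum_congr fun k => ?_
  rw [psiCoeff, hgCoeff, rGamma, show (m : ℂ) + 1 + k = (m + k : ℕ) + 1 by push_cast; ring,
    Complex.Gamma_nat_eq_factorial, poch, poch]
  field_simp

/-- The four digamma values are paired into the differences ψ(1+k) - ψ(a+k) and ψ(m+1+k) - ψ(b+k),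
each of which is constant plus moment. -/
theorem cutCont_psiCoeff (m : ℕ) (a b : ℂ) : CutCont (psiCoeff m a b) := by
  have h := cutCont_hgCoeff a b (m + 1)
  refine ((h.mul_digamma_sub 1 a).add (h.mul_digamma_sub (m + 1) b)).congr fun k => ?_
  rw [psiCoeff, show (1 : ℂ) + k = k + 1 by ring, show (m : ℂ) + 1 + k = m + k + 1 by ring]
  ring

theorem isCutCont_hypT (m : ℕ) (a b : ℂ) : IsCutCont (psiCoeff m a b) (hypT m a b) :=
  cutContinuation_spec (cutCont_psiCoeff m a b) (psiSeries_eq_tsum m a b)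

theorem differentiableOn_hypT (m : ℕ) (a b : ℂ) : DifferentiableOn ℂ (hypT m a b) cutPlane :=
  (isCutCont_hypT m a b).1

open Complex (regularizedGaussHGFun)

/-! ### Identity theorem in the parameters -/

theorem eq_zero_of_eventually_eq_zero {E : ℂ → ℂ} (hE : Differentiable ℂ E) {s₀ : ℂ}
    (h : ∀ᶠ s in 𝓝 s₀, E s = 0) (s : ℂ) : E s = 0 := by
  have h1 : AnalyticOnNhd ℂ E univ := hE.differentiableOn.analyticOnNhd isOpen_univ
  have h2 := AnalyticOnNhd.eq_of_eventuallyEq h1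
    (analyticOnNhd_const (v := (0 : ℂ)) (s := univ)) (z₀ := s₀) h
  exact congrFun h2 s

theorem eventually_re_pos {s₀ : ℂ} (h : 0 < s₀.re) : ∀ᶠ s : ℂ in 𝓝 s₀, 0 < s.re :=
  Complex.continuous_re.continuousAt.eventually (lt_mem_nhds h)

/-- The identity theorem is applied to one variable at a time, in the order c, b, a. The open set in
c may therefore depend on a and b, and only separate holomorphy is used. -/
theorem eq_zero_of_params {E : ℂ → ℂ → ℂ → ℂ} (h1 : ∀ b c, Differentiable ℂ fun a => E a b c)
    (h2 : ∀ a c, Differentiable ℂ fun b => E a b c) (h3 : ∀ a b, Differentiable ℂ fun c => E a b c)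
    (h : ∀ a b : ℂ, 0 < a.re → 0 < b.re → ∃ s, ∀ᶠ c in 𝓝 s, E a b c = 0) (a b c : ℂ) :
    E a b c = 0 := by
  have A : ∀ a b c : ℂ, 0 < a.re → 0 < b.re → E a b c = 0 := by
    intro a b c ha hb
    obtain ⟨s, hs⟩ := h a b ha hb
    exact eq_zero_of_eventually_eq_zero (h3 a b) hs c
  have B : ∀ a b c : ℂ, 0 < a.re → E a b c = 0 := fun a b c ha =>
    eq_zero_of_eventually_eq_zero (h2 a c) (s₀ := 1)
      ((eventually_re_pos (by simp)).mono fun b hb => A a b c ha hb) b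
  exact eq_zero_of_eventually_eq_zero (h1 b c) (s₀ := 1)
    ((eventually_re_pos (by simp)).mono fun a ha => B a b c ha) a

/-! ### Euler's transformation -/

theorem norm_ofReal_lt_one {x : ℝ} (h1 : -1 < x) (h2 : x < 1) : ‖(x : ℂ)‖ < 1 := by
  rw [Complex.norm_real, Real.norm_eq_abs, abs_lt]; exact ⟨h1, h2⟩

theorem eulerIntegral_eq (a : ℂ) {b c : ℂ} (hb : 0 < b.re) (hc : 0 < (c - b).re) {z : ℂ}
    (hz : ‖z‖ < 1) :
    momentTransform (fun z => (1 - z) ^ (-a)) (betaKernel b (c - b)) z =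
      Complex.Gamma b * Complex.Gamma (c - b) * regularizedGaussHGFun a b c z := by
  refine ((isCutCont_eulerIntegral a hb hc).2 z hz).unique ?_
  refine (hasSum_congr_terms fun k => ?_).1 ((hasSum_hgCoeff a b c hz).mul_left _)
  ring

/-- The substitution t ↦ 1 - t in Euler's integral. The involution x ↦ x/(x-1) maps (-1, 1/2) onto
itself, so both series converge. -/
theorem pfaff_of_re_pos (a : ℂ) {b c : ℂ} (hb : 0 < b.re) (hc : 0 < (c - b).re) {x : ℝ}
    (h1 : -1 < x) (h2 : x < 1 / 2) :
    regularizedGaussHGFun a b c x =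
      (1 - x : ℂ) ^ (-a) * regularizedGaussHGFun a (c - b) c (x / (x - 1) : ℝ) := by
  have hx1 : x - 1 < 0 := by linarith
  have hy1 : -1 < x / (x - 1) := by rw [lt_div_iff_of_neg hx1]; linarith
  have hy2 : x / (x - 1) < 1 := by rw [div_lt_iff_of_neg hx1]; linarith
  have e1 := eulerIntegral_eq a hb hc (norm_ofReal_lt_one h1 (by linarith : x < 1))
  have e2 := eulerIntegral_eq a (b := c - b) (c := c) hc (by simpa using hb)
    (norm_ofReal_lt_one hy1 hy2)
  have h3 := mul_ne_zero (Complex.Gamma_ne_zero_of_re_pos hb) (Complex.Gamma_ne_zero_of_re_pos hc)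
  refine mul_left_cancel₀ h3 ?_
  rw [← e1, mul_left_comm, mul_comm (Complex.Gamma b),
    show Complex.Gamma b = Complex.Gamma (c - (c - b)) by rw [sub_sub_cancel], ← e2,
    momentTransform, momentTransform, ← intervalIntegral.integral_const_mul]
  have key := intervalIntegral.integral_comp_sub_left (a := 0) (b := 1)
    (fun t : ℝ => (1 - (t : ℂ) * x) ^ (-a) * betaKernel b (c - b) t) 1
  rw [sub_self, sub_zero] at key
  rw [← key]
  refine intervalIntegral.integral_congr fun t ht => ?_
  rw [uIcc_of_le zero_le_one] at ht
  have e3 : 1 - ((1 - t : ℝ) : ℂ) * x = ((1 - x : ℝ) : ℂ) * ((1 - t * (x / (x - 1)) : ℝ) : ℂ) := by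
    rw [← Complex.ofReal_one, ← Complex.ofReal_mul, ← Complex.ofReal_sub, ← Complex.ofReal_mul]
    congr 1
    field_simp [hx1.ne]
    ring
  have h4 : 0 ≤ 1 - t * (x / (x - 1)) := by nlinarith [ht.1, ht.2]
  simp only [betaKernel]
  rw [e3, Complex.mul_cpow_ofReal_nonneg (by linarith) h4]
  push_cast
  rw [sub_sub_cancel, sub_sub_cancel]
  ring

/-- Pfaff's transformation applied twice, with the upper parameters exchanged in between; the
argument returns to x because x ↦ x/(x-1) is an involution. -/
theorem euler_real_of_re_pos {a b c : ℂ} (ha : 0 < a.re) (hb : 0 < b.re) (hca : 0 < (c - a).re)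
    (hcb : 0 < (c - b).re) {x : ℝ} (h1 : -1 < x) (h2 : x < 1 / 2) :
    regularizedGaussHGFun a b c x =
      (1 - x : ℂ) ^ (c - a - b) * regularizedGaussHGFun (c - a) (c - b) c x := by
  have hx1 : x - 1 < 0 := by linarith
  have hy1 : -1 < x / (x - 1) := by rw [lt_div_iff_of_neg hx1]; linarith
  have hy2 : x / (x - 1) < 1 / 2 := by rw [div_lt_iff_of_neg hx1]; linarith
  have e0 : x / (x - 1) / (x / (x - 1) - 1) = x := by
    have : x / (x - 1) - 1 = 1 / (x - 1) := by field_simp [hx1.ne]; ring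
    rw [this]; field_simp [hx1.ne]
  have e1 : (1 - ((x / (x - 1) : ℝ) : ℂ)) = (1 - x : ℂ)⁻¹ := by
    have : 1 - x / (x - 1) = (1 - x)⁻¹ := by
      have : 1 - x ≠ 0 := by linarith
      field_simp [hx1.ne]
      ring
    have h := congrArg (fun r : ℝ => (r : ℂ)) this
    push_cast at h ⊢
    exact h
  have hne : (1 - x : ℂ) ≠ 0 := by
    have : ((1 - x : ℝ) : ℂ) ≠ 0 := Complex.ofReal_ne_zero.2 (by linarith)
    simpa using this
  have harg : (1 - x : ℂ).arg ≠ Real.pi := by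
    have : ((1 - x : ℝ) : ℂ).arg = 0 := Complex.arg_ofReal_of_nonneg (by linarith)
    push_cast at this
    rw [this]
    exact Real.pi_pos.ne
  rw [pfaff_of_re_pos a hb hcb h1 h2, Complex.regularizedGaussHGFun_symm,
    pfaff_of_re_pos (c - b) ha hca hy1 hy2, e0, e1, Complex.inv_cpow _ _ harg, Complex.cpow_neg,
    Complex.cpow_neg, inv_inv, ← mul_assoc, ← Complex.cpow_neg, ← Complex.cpow_add _ _ hne,
    Complex.regularizedGaussHGFun_symm, show -a + (c - b) = c - a - b by ring]

theorem euler_real (a b c : ℂ) {x : ℝ} (h1 : -1 < x) (h2 : x < 1 / 2) :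
    regularizedGaussHGFun a b c x =
      (1 - x : ℂ) ^ (c - a - b) * regularizedGaussHGFun (c - a) (c - b) c x := by
  have hx := norm_ofReal_lt_one h1 (by linarith : x < 1)
  have hne : (1 - x : ℂ) ≠ 0 := by
    have : ((1 - x : ℝ) : ℂ) ≠ 0 := Complex.ofReal_ne_zero.2 (by linarith)
    simpa using this
  have hS : ∀ {a b c : ℂ → ℂ}, Differentiable ℂ a → Differentiable ℂ b → Differentiable ℂ c →
      Differentiable ℂ fun s => regularizedGaussHGFun (a s) (b s) (c s) x := fun ha hb hc =>
    differentiable_regularizedGaussHGFun_param ha hb hc hx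
  have hp : ∀ {l : ℂ → ℂ}, Differentiable ℂ l → Differentiable ℂ fun s => (1 - x : ℂ) ^ l s :=
    fun hl => hl.const_cpow (Or.inl hne)
  refine sub_eq_zero.1 (eq_zero_of_params (E := fun a b c => regularizedGaussHGFun a b c x -
      (1 - x : ℂ) ^ (c - a - b) * regularizedGaussHGFun (c - a) (c - b) c x) ?_ ?_ ?_ ?_ a b c)
  · exact fun b c => (hS (by fun_prop) (by fun_prop) (by fun_prop)).sub
      ((hp (by fun_prop)).mul (hS (by fun_prop) (by fun_prop) (by fun_prop)))
  · exact fun b c => (hS (by fun_prop) (by fun_prop) (by fun_prop)).sub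
      ((hp (by fun_prop)).mul (hS (by fun_prop) (by fun_prop) (by fun_prop)))
  · exact fun b c => (hS (by fun_prop) (by fun_prop) (by fun_prop)).sub
      ((hp (by fun_prop)).mul (hS (by fun_prop) (by fun_prop) (by fun_prop)))
  · intro a b ha hb
    -- The point c = a + b lies in the open set Re c > Re a, Re c > Re b, where both Pfaff steps are
    -- available.
    refine ⟨a + b, ?_⟩
    have ea : ∀ᶠ c : ℂ in 𝓝 (a + b), a.re < c.re :=
      Complex.continuous_re.continuousAt.eventually (lt_mem_nhds (by simpa using hb))
    have eb : ∀ᶠ c : ℂ in 𝓝 (a + b), b.re < c.re :=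
      Complex.continuous_re.continuousAt.eventually (lt_mem_nhds (by simpa using ha))
    filter_upwards [ea, eb] with c hca hcb
    exact sub_eq_zero.2 (euler_real_of_re_pos ha hb (by simpa using hca) (by simpa using hcb) h1 h2)

theorem eqOn_of_eventually_eq_real {F G : ℂ → ℂ} {U : Set ℂ} (hU : IsOpen U)
    (hU' : IsPreconnected U) (hF : DifferentiableOn ℂ F U) (hG : DifferentiableOn ℂ G U) {x₀ : ℝ}
    (hx₀ : (x₀ : ℂ) ∈ U) (h : ∀ᶠ x : ℝ in 𝓝 x₀, F x = G x) : EqOn F G U := by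
  refine (hF.analyticOnNhd hU).eqOn_of_preconnected_of_frequently_eq (hG.analyticOnNhd hU) hU'
    hx₀ ?_
  have h1 : Tendsto (fun x : ℝ => (x : ℂ)) (𝓝[≠] x₀) (𝓝[≠] (x₀ : ℂ)) := by
    refine tendsto_nhdsWithin_iff.2 ⟨?_, ?_⟩
    · exact (Complex.continuous_ofReal.tendsto x₀).mono_left nhdsWithin_le_nhds
    · filter_upwards [self_mem_nhdsWithin] with x hx
      simpa using hx
  refine h1.frequently ?_
  exact (h.filter_mono nhdsWithin_le_nhds).frequently

/-- Euler's transformation on the cut plane. -/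
theorem hypF_euler (a b c : ℂ) {z : ℂ} (hz : z ∈ cutPlane) :
    hypF a b c z = (1 - z) ^ (c - a - b) * hypF (c - a) (c - b) c z := by
  refine eqOn_of_eventually_eq_real isOpen_cutPlane isPreconnected_cutPlane
    (differentiableOn_hypF a b c) (G := fun z => (1 - z) ^ (c - a - b) * hypF (c - a) (c - b) c z)
    (DifferentiableOn.mul ?_ (differentiableOn_hypF _ _ _)) (x₀ := 0)
    (by simpa using zero_mem_cutPlane) ?_ hz
  · have := (isCutCont_binomial (-(c - a - b))).1
    simpa using this
  · filter_upwards [Ioo_mem_nhds (show (-1 : ℝ) < 0 by norm_num)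
      (show (0 : ℝ) < 1 / 2 by norm_num)] with x hx
    have hx' := norm_ofReal_lt_one hx.1 (by linarith [hx.2] : x < 1)
    rw [hypF_eq_of_norm_lt_one _ _ _ hx', hypF_eq_of_norm_lt_one _ _ _ hx']
    exact euler_real a b c hx.1 hx.2

/-- Euler's transformation on the unit disc. -/
theorem regularizedGaussHGFun_euler (a b c : ℂ) {z : ℂ} (hz : ‖z‖ < 1) :
    regularizedGaussHGFun a b c z =
      (1 - z) ^ (c - a - b) * regularizedGaussHGFun (c - a) (c - b) c z := by
  rw [← hypF_eq_of_norm_lt_one _ _ _ hz, ← hypF_eq_of_norm_lt_one _ _ _ hz]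
  exact hypF_euler a b c (mem_cutPlane_of_norm_lt_one hz)

/-! ### Gauss's summation theorem -/

/-- Dominated convergence in Euler's integral: since Re a > 0, the modulus of (1 - t(1-x))^(-a) is
at most (1-t)^(-Re a), and the limit integrand is the Beta kernel with exponents b and c - a - b. -/
theorem tendsto_gauss_sum {a b c : ℂ} (ha : 0 < a.re) (hb : 0 < b.re) (hcb : 0 < (c - b).re)
    (h : 0 < (c - a - b).re) :
    Tendsto (fun x : ℝ => regularizedGaussHGFun a b c (1 - x : ℂ)) (𝓝[>] 0)
      (𝓝 (Complex.Gamma (c - a - b) * rGamma (c - a) * rGamma (c - b))) := by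
  have hb0 := Complex.Gamma_ne_zero_of_re_pos hb
  have hcb0 := Complex.Gamma_ne_zero_of_re_pos hcb
  have hlim : Tendsto (fun x : ℝ => momentTransform (fun z => (1 - z) ^ (-a))
      (betaKernel b (c - b)) (1 - x : ℂ)) (𝓝[>] 0)
      (𝓝 (∫ t in (0 : ℝ)..1, betaKernel b (c - a - b) t)) := by
    refine intervalIntegral.tendsto_integral_filter_of_dominated_convergence
      (fun t => ‖betaKernel b (c - a - b) t‖) ?_ ?_
      (intervalIntegrable_betaKernel hb h).norm ?_
    · filter_upwards [Ioo_mem_nhdsGT (show (0 : ℝ) < 1 by norm_num)] with x hx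
      have hc : ContinuousOn (fun t : ℝ => (1 - (t : ℂ) * (1 - x)) ^ (-a)) (uIcc 0 1) := by
        intro t ht
        rw [uIcc_of_le zero_le_one] at ht
        refine (ContinuousAt.cpow (by fun_prop) continuousAt_const ?_).continuousWithinAt
        left
        have : (1 - (t : ℂ) * (1 - x)) = ((1 - t * (1 - x) : ℝ) : ℂ) := by push_cast; ring
        rw [this, Complex.ofReal_re]
        nlinarith [ht.1, ht.2, hx.1, hx.2]
      exact ((intervalIntegrable_betaKernel hb hcb).continuousOn_mul hc).def'.aestronglyMeasurable
    · filter_upwards [Ioo_mem_nhdsGT (show (0 : ℝ) < 1 by norm_num)] with x hx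
      filter_upwards [(measure_eq_zero_iff_ae_notMem (μ := volume) (s := {(1 : ℝ)})).1 (by simp)]
        with t ht1 ht
      rw [uIoc_of_le zero_le_one] at ht
      have ht2 : t < 1 := lt_of_le_of_ne ht.2 ht1
      have e1 : (1 - (t : ℂ) * (1 - x)) = ((1 - t * (1 - x) : ℝ) : ℂ) := by push_cast; ring
      have e2 : (1 - (t : ℂ)) = ((1 - t : ℝ) : ℂ) := by push_cast; ring
      have hpos : 0 < 1 - t * (1 - x) := by nlinarith [ht.1, ht.2, hx.1, hx.2]
      have hpos2 : 0 < 1 - t := by linarith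
      rw [betaKernel, betaKernel, e1, e2, norm_mul, norm_mul, norm_mul,
        Complex.norm_cpow_eq_rpow_re_of_pos hpos, Complex.norm_cpow_eq_rpow_re_of_pos hpos2,
        Complex.norm_cpow_eq_rpow_re_of_pos hpos2, mul_left_comm,
        show (c - a - b - 1).re = (-a).re + (c - b - 1).re by simp; ring, Real.rpow_add hpos2]
      refine mul_le_mul_of_nonneg_left (mul_le_mul_of_nonneg_right ?_ (by positivity))
        (norm_nonneg _)
      refine Real.rpow_le_rpow_of_nonpos hpos2 ?_ (by simpa using ha.le)
      nlinarith [ht.1, ht.2, hx.1, hx.2]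
    · filter_upwards [(measure_eq_zero_iff_ae_notMem (μ := volume) (s := {(1 : ℝ)})).1 (by simp)]
        with t ht1 ht
      rw [uIoc_of_le zero_le_one] at ht
      have ht2 : t < 1 := lt_of_le_of_ne ht.2 ht1
      have hne : (1 - (t : ℂ)) ≠ 0 := by
        rw [sub_ne_zero]; norm_cast; exact ht2.ne'
      have e : betaKernel b (c - a - b) t = (1 - (t : ℂ) * (1 - (0 : ℝ))) ^ (-a) *
          betaKernel b (c - b) t := by
        rw [betaKernel, betaKernel, show c - a - b - 1 = -a + (c - b - 1) by ring,
          Complex.cpow_add _ _ hne]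
        push_cast
        rw [sub_zero, mul_one]
        ring
      rw [e]
      refine Tendsto.mul_const _ ?_
      refine Tendsto.mono_left ?_ nhdsWithin_le_nhds
      refine ContinuousAt.tendsto (x := (0 : ℝ))
        (f := fun x : ℝ => (1 - (t : ℂ) * (1 - x)) ^ (-a)) ?_
      refine ContinuousAt.cpow (by fun_prop) continuousAt_const ?_
      left
      simpa using ht2
  have hval := integral_pow_mul_betaKernel hb h 0
  simp only [pow_zero, one_mul, poch_zero, Nat.cast_zero, add_zero] at hval
  rw [hval, show b + (c - a - b) = c - a by ring] at hlim
  have := hlim.const_mul (rGamma b * rGamma (c - b))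
  have e : rGamma b * rGamma (c - b) * (Complex.Gamma b * Complex.Gamma (c - a - b) *
      rGamma (c - a)) = Complex.Gamma (c - a - b) * rGamma (c - a) * rGamma (c - b) := by
    simp only [rGamma]
    field_simp
  rw [e] at this
  refine this.congr' ?_
  filter_upwards [Ioo_mem_nhdsGT (show (0 : ℝ) < 1 by norm_num)] with x hx
  have hx' : ‖(1 - x : ℂ)‖ < 1 := by
    have := norm_ofReal_lt_one (x := 1 - x) (by linarith [hx.2]) (by linarith [hx.1])
    simpa using this
  rw [eulerIntegral_eq a hb hcb hx']
  simp only [rGamma]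
  field_simp

/-! ### The hypergeometric differential equation -/

/-- Coefficient by coefficient this is `hgCoeff_succ`; the shifts rewrite z y', z y'' and z² y'' as
series in z^k. -/
theorem hypergeometric_ode (a b c : ℂ) {z : ℂ} (hz : ‖z‖ < 1) :
    DifferentiableAt ℂ (deriv (regularizedGaussHGFun a b c)) z ∧
    z * (1 - z) * deriv (deriv (regularizedGaussHGFun a b c)) z +
      (c - (a + b + 1) * z) * deriv (regularizedGaussHGFun a b c) z =
        a * b * regularizedGaussHGFun a b c z := by
  have h0 := hasSum_hgCoeff a b c hz
  have h1 : ∀ z : ℂ, ‖z‖ < 1 → HasSum (fun k : ℕ => (k + 1) * hgCoeff a b c (k + 1) * z ^ k)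
      (deriv (regularizedGaussHGFun a b c) z) := fun z hz =>
    (hasDerivAt_of_hasSum (fun z hz => hasSum_hgCoeff a b c hz) hz).2
  obtain ⟨hd, h2⟩ := hasDerivAt_of_hasSum h1 hz
  refine ⟨hd, ?_⟩
  have hz1 := hasSum_shift_mul (u := fun k => k * hgCoeff a b c k)
    ((hasSum_congr_terms fun k => by push_cast; ring).1 (h1 z hz))
  have hz2 := hasSum_shift_mul (u := fun k => k * ((k + 1) * hgCoeff a b c (k + 1)))
    ((hasSum_congr_terms fun k => by push_cast; ring).1 h2)
  have hzz2 := hasSum_shift_mul (z := z) (u := fun k => (k - 1) * (k * hgCoeff a b c k))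
    ((hasSum_congr_terms fun k => by push_cast; ring).1 hz2)
  have hL := hz2.add ((h1 z hz).mul_left c)
  have hR := (hzz2.add (hz1.mul_left (a + b + 1))).add (h0.mul_left (a * b))
  have := hL.unique ((hasSum_congr_terms fun k => ?_).1 hR)
  · simp only [Nat.cast_zero, zero_mul, zero_add, zero_sub, mul_zero] at this
    linear_combination this
  · linear_combination -(z ^ k) * hgCoeff_succ a b c k

/-! ### Solutions of the equation on (0,1) and their Wronskians. -/

theorem cpow_eq_cpow_sub_one_mul {z : ℂ} (hz : z ≠ 0) (l : ℂ) : z ^ l = z ^ (l - 1) * z := by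
  rw [Complex.cpow_sub _ _ hz, Complex.cpow_one, div_mul_cancel₀ _ hz]

/-- `Y` with derivative `Y'` solves the hypergeometric equation on `(0, 1)`. -/
def IsHypSol (a b c : ℂ) (Y Y' : ℝ → ℂ) : Prop :=
  ∀ t ∈ Ioo (0 : ℝ) 1, HasDerivAt Y (Y' t) t ∧ ∃ y, HasDerivAt Y' y t ∧
    t * (1 - t) * y + (c - (a + b + 1) * t) * Y' t = a * b * Y t

theorem norm_ofReal_lt_one_of_mem {t : ℝ} (ht : t ∈ Ioo (0 : ℝ) 1) : ‖(t : ℂ)‖ < 1 :=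
  norm_ofReal_lt_one (by linarith [ht.1]) ht.2

theorem norm_one_sub_ofReal_lt_one {t : ℝ} (ht : t ∈ Ioo (0 : ℝ) 1) : ‖(1 - t : ℂ)‖ < 1 := by
  have := norm_ofReal_lt_one (x := 1 - t) (by linarith [ht.2]) (by linarith [ht.1])
  simpa using this

theorem isHypSol_zero (a b c : ℂ) : IsHypSol a b c (fun t => regularizedGaussHGFun a b c t)
    fun t => deriv (regularizedGaussHGFun a b c) t := by
  intro t ht
  have ht' := norm_ofReal_lt_one_of_mem ht
  obtain ⟨h1, h2⟩ := hypergeometric_ode a b c ht'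
  exact ⟨(hasDerivAt_regularizedGaussHGFun a b c ht').differentiableAt.hasDerivAt.comp_ofReal, _,
    h1.hasDerivAt.comp_ofReal, h2⟩

theorem isHypSol_one (a b c : ℂ) : IsHypSol a b (a + b + 1 - c)
    (fun t => regularizedGaussHGFun a b c (1 - t))
    fun t => -deriv (regularizedGaussHGFun a b c) (1 - t) := by
  intro t ht
  have ht' := norm_one_sub_ofReal_lt_one ht
  obtain ⟨h1, h2⟩ := hypergeometric_ode a b c ht'
  have h3 : HasDerivAt (fun z : ℂ => 1 - z) (-1) (t : ℂ) := by
    simpa using (hasDerivAt_id (t : ℂ)).const_sub 1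
  have h4 := ((hasDerivAt_regularizedGaussHGFun a b c ht').differentiableAt.hasDerivAt.comp
    (t : ℂ) h3).comp_ofReal
  have h5 := (h1.hasDerivAt.comp (t : ℂ) h3).comp_ofReal.neg
  refine ⟨by simpa using h4, deriv (deriv (regularizedGaussHGFun a b c)) (1 - t),
    h5.congr_deriv (by ring), ?_⟩
  linear_combination h2

/-- This is the second Frobenius solution at 0: for c = 1 - ρ the exponents there are 0 and 1 - c =
ρ. -/
theorem isHypSol_cpow (a b ρ : ℂ) : IsHypSol a b (1 - ρ)
    (fun t => (t : ℂ) ^ ρ * regularizedGaussHGFun (a + ρ) (b + ρ) (1 + ρ) t)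
    fun t => ρ * (t : ℂ) ^ (ρ - 1) * regularizedGaussHGFun (a + ρ) (b + ρ) (1 + ρ) t +
      (t : ℂ) ^ ρ * deriv (regularizedGaussHGFun (a + ρ) (b + ρ) (1 + ρ)) t := by
  intro t ht
  have ht' := norm_ofReal_lt_one_of_mem ht
  obtain ⟨h1, h2⟩ := hypergeometric_ode (a + ρ) (b + ρ) (1 + ρ) ht'
  have h0 := (hasDerivAt_regularizedGaussHGFun (a + ρ) (b + ρ) (1 + ρ)
    ht').differentiableAt.hasDerivAt
  have hp : ∀ l : ℂ, HasDerivAt (fun z : ℂ => z ^ l) (l * (t : ℂ) ^ (l - 1)) t := fun l => by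
    simpa using (hasDerivAt_id (t : ℂ)).cpow_const (c := l) (Complex.ofReal_mem_slitPlane.2 ht.1)
  have htne : (t : ℂ) ≠ 0 := Complex.ofReal_ne_zero.2 ht.1.ne'
  refine ⟨((hp ρ).mul h0).comp_ofReal, _,
    ((((hp (ρ - 1)).const_mul ρ).mul h0).add ((hp ρ).mul h1.hasDerivAt)).comp_ofReal, ?_⟩
  have e1 : (t : ℂ) ^ ρ = t ^ (ρ - 1) * t := 
    cpow_eq_cpow_sub_one_mul htne ρ
  have e2 : (t : ℂ) ^ (ρ - 1) = t ^ (ρ - 1 - 1) * t := 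
    cpow_eq_cpow_sub_one_mul htne _
  beta_reduce
  rw [e1, e2]
  linear_combination (t : ℂ) ^ (ρ - 1 - 1) * t ^ 2 * h2

/-- Abel's identity for the Wronskian. -/
theorem IsHypSol.wronskian {a b c : ℂ} {Y Y' Z Z' : ℝ → ℂ} (hY : IsHypSol a b c Y Y')
    (hZ : IsHypSol a b c Z Z') : ∃ C : ℂ, ∀ t ∈ Ioo (0 : ℝ) 1,
      (t : ℂ) ^ c * (1 - t : ℂ) ^ (a + b + 1 - c) * (Y t * Z' t - Z t * Y' t) = C := by
  have key : ∀ t ∈ Ioo (0 : ℝ) 1, HasDerivAt (fun t : ℝ =>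
      (t : ℂ) ^ c * (1 - t : ℂ) ^ (a + b + 1 - c) * (Y t * Z' t - Z t * Y' t)) 0 t := by
    intro t ht
    obtain ⟨hY1, y, hY2, hYe⟩ := hY t ht
    obtain ⟨hZ1, z, hZ2, hZe⟩ := hZ t ht
    have htne : (t : ℂ) ≠ 0 := Complex.ofReal_ne_zero.2 ht.1.ne'
    have e0 : (1 - t : ℂ) = ((1 - t : ℝ) : ℂ) := by push_cast; rfl
    have htne' : (1 - t : ℂ) ≠ 0 := by
      rw [e0]; exact Complex.ofReal_ne_zero.2 (by linarith [ht.2])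
    have hs : (1 - t : ℂ) ∈ Complex.slitPlane := by
      rw [e0]; exact Complex.ofReal_mem_slitPlane.2 (by linarith [ht.2])
    have hp1 : HasDerivAt (fun t : ℝ => (t : ℂ) ^ c) (c * (t : ℂ) ^ (c - 1)) t := by
      simpa using ((hasDerivAt_id (t : ℂ)).cpow_const (c := c)
        (Complex.ofReal_mem_slitPlane.2 ht.1)).comp_ofReal
    have hp2 : HasDerivAt (fun t : ℝ => (1 - t : ℂ) ^ (a + b + 1 - c))
        (-((a + b + 1 - c) * (1 - t : ℂ) ^ (a + b + 1 - c - 1))) t := by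
      have := (((hasDerivAt_id (t : ℂ)).const_sub 1).cpow_const (c := a + b + 1 - c)
        hs).comp_ofReal
      simpa using this
    have hd := (hp1.mul hp2).mul ((hY1.mul hZ2).sub (hZ1.mul hY2))
    refine hd.congr_deriv ?_
    have e1 : (t : ℂ) ^ c = t ^ (c - 1) * t := cpow_eq_cpow_sub_one_mul htne c
    have e2 : (1 - t : ℂ) ^ (a + b + 1 - c) = (1 - t : ℂ) ^ (a + b + 1 - c - 1) * (1 - t) :=
      cpow_eq_cpow_sub_one_mul htne' _
    simp only [Pi.mul_apply, Pi.sub_apply]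
    rw [e1, e2]
    linear_combination (t : ℂ) ^ (c - 1) * (1 - t : ℂ) ^ (a + b + 1 - c - 1) *
      (Y t * hZe - Z t * hYe)
  refine ⟨_, fun t ht => isOpen_Ioo.is_const_of_deriv_eq_zero isPreconnected_Ioo
    (fun t ht => (key t ht).differentiableAt.differentiableWithinAt)
    (fun t ht => (key t ht).deriv) ht (show (1 / 2 : ℝ) ∈ Ioo (0 : ℝ) 1 by norm_num)⟩

/-! ### The connection formula -/

theorem regularizedGaussHGFun_zero (a b c : ℂ) : regularizedGaussHGFun a b c 0 = rGamma c := by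
  have h := hasSum_hgCoeff a b c (z := 0) (by simp)
  refine h.unique ?_
  convert hasSum_single (f := fun k => hgCoeff a b c k * (0 : ℂ) ^ k) 0
    (fun k hk => by simp [hk]) using 1
  simp [hgCoeff]

theorem tendsto_regularizedGaussHGFun_zero (a b c : ℂ) :
    Tendsto (fun t : ℝ => regularizedGaussHGFun a b c t) (𝓝[>] 0) (𝓝 (rGamma c)) := by
  have h := (hasDerivAt_regularizedGaussHGFun a b c (z := ((0 : ℝ) : ℂ)) (by simp)).continuousAt
  have h2 := (h.comp Complex.continuous_ofReal.continuousAt).tendsto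
  simp only [Function.comp_apply, Complex.ofReal_zero, regularizedGaussHGFun_zero] at h2
  exact h2.mono_left nhdsWithin_le_nhds

theorem tendsto_deriv_regularizedGaussHGFun_zero (a b c : ℂ) :
    ∃ L, Tendsto (fun t : ℝ => deriv (regularizedGaussHGFun a b c) t) (𝓝[>] 0) (𝓝 L) := by
  have h := (hypergeometric_ode a b c (z := ((0 : ℝ) : ℂ)) (by simp)).1.continuousAt
  exact ⟨_, (h.comp Complex.continuous_ofReal.continuousAt).tendsto.mono_left nhdsWithin_le_nhds⟩

theorem tendsto_ofReal_cpow_zero {l : ℂ} (hl : 0 < l.re) :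
    Tendsto (fun t : ℝ => (t : ℂ) ^ l) (𝓝[>] 0) (𝓝 0) := by
  have h0 : l ≠ 0 := fun h => by simp [h] at hl
  have h := (Complex.continuousAt_ofReal_cpow_const 0 l (Or.inl hl)).tendsto
  simp only [Complex.ofReal_zero, Complex.zero_cpow h0] at h
  exact h.mono_left nhdsWithin_le_nhds

/-- The derivative at 1 - t may behave like t^(ρ-1) as t → 0. Euler's transformation splits this
power off and leaves a factor to which Gauss's summation applies. -/
theorem deriv_regularizedGaussHGFun_one_sub (a b ρ : ℂ) {t : ℝ} (ht : t ∈ Ioo (0 : ℝ) 1) :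
    (t : ℂ) ^ (1 - ρ) * deriv (regularizedGaussHGFun a b (a + b + ρ)) (1 - t) =
      a * b * regularizedGaussHGFun (b + ρ) (a + ρ) (a + b + ρ + 1) (1 - t) := by
  have ht' := norm_one_sub_ofReal_lt_one ht
  have htne : (t : ℂ) ≠ 0 := Complex.ofReal_ne_zero.2 ht.1.ne'
  rw [(hasDerivAt_regularizedGaussHGFun a b (a + b + ρ) ht').deriv,
    regularizedGaussHGFun_euler (a + 1) (b + 1) (a + b + ρ + 1) ht',
    show a + b + ρ + 1 - (a + 1) - (b + 1) = ρ - 1 by ring,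
    show a + b + ρ + 1 - (a + 1) = b + ρ by ring, show a + b + ρ + 1 - (b + 1) = a + ρ by ring,
    sub_sub_cancel, show 1 - ρ = -(ρ - 1) by ring, Complex.cpow_neg]
  have : (t : ℂ) ^ (ρ - 1) ≠ 0 := by simp [Complex.cpow_eq_zero_iff, htne]
  field_simp

/-- For any functions Y, Z, S one has S·W(Y,Z) = Y·W(S,Z) - Z·W(S,Y). For three solutions Abel's
identity makes the weighted Wronskians constants C0, C1, C2, so only their values are needed, not a
uniqueness theorem for the equation. They are found by letting t → 0; the strip 0 < Re ρ < 1 makes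
both t^ρ and t^(1-ρ) vanish there. -/
theorem connection_of_re_pos {a b ρ : ℂ} (ha : 0 < a.re) (hb : 0 < b.re) (hρ : 0 < ρ.re)
    (hρ1 : ρ.re < 1) {t : ℝ} (ht : t ∈ Ioo (0 : ℝ) 1) :
    rGamma ρ * rGamma (1 - ρ) * regularizedGaussHGFun a b (a + b + ρ) (1 - t) =
      rGamma (a + ρ) * rGamma (b + ρ) * regularizedGaussHGFun a b (1 - ρ) t -
        rGamma a * rGamma b *
          (t ^ ρ * regularizedGaussHGFun (a + ρ) (b + ρ) (1 + ρ) t) := by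
  have s0 : IsHypSol a b (1 - ρ) _ _ := isHypSol_zero a b (1 - ρ)
  have s1 := isHypSol_one a b (a + b + ρ)
  rw [show a + b + 1 - (a + b + ρ) = 1 - ρ by ring] at s1
  have s2 := isHypSol_cpow a b ρ
  obtain ⟨C0, h0⟩ := s0.wronskian s2
  obtain ⟨C1, h1⟩ := s1.wronskian s2
  obtain ⟨C2, h2⟩ := s1.wronskian s0
  rw [show a + b + 1 - (1 - ρ) = a + b + ρ by ring] at h0 h1 h2
  have hmem : Ioo (0 : ℝ) 1 ∈ 𝓝[>] (0 : ℝ) := Ioo_mem_nhdsGT one_pos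
  have hρ0 : ρ ≠ 0 := fun h => by simp [h] at hρ
  -- limits at the left end point
  have lt : Tendsto (fun t : ℝ => (t : ℂ)) (𝓝[>] 0) (𝓝 0) := by
    have := Complex.continuous_ofReal.tendsto 0
    simp only [Complex.ofReal_zero] at this
    exact this.mono_left nhdsWithin_le_nhds
  have lp : Tendsto (fun t : ℝ => (1 - t : ℂ) ^ (a + b + ρ)) (𝓝[>] 0) (𝓝 1) := by
    have : ContinuousAt (fun z : ℂ => (1 - z) ^ (a + b + ρ)) 0 :=
      ContinuousAt.cpow (by fun_prop) continuousAt_const (by simp)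
    have h := this.tendsto.comp lt
    simpa [Function.comp_def] using h
  have lG := tendsto_regularizedGaussHGFun_zero (a + ρ) (b + ρ) (1 + ρ)
  obtain ⟨LG, lG'⟩ := tendsto_deriv_regularizedGaussHGFun_zero (a + ρ) (b + ρ) (1 + ρ)
  have lY := tendsto_regularizedGaussHGFun_zero a b (1 - ρ)
  obtain ⟨LY, lY'⟩ := tendsto_deriv_regularizedGaussHGFun_zero a b (1 - ρ)
  have lS := tendsto_gauss_sum (a := a) (b := b) (c := a + b + ρ) ha hb
    (by simp at *; linarith) (by simp at *; linarith)
  have lS' := tendsto_gauss_sum (a := b + ρ) (b := a + ρ) (c := a + b + ρ + 1)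
    (by simp; linarith) (by simp; linarith) (by simp; linarith) (by simp; linarith)
  rw [show a + b + ρ - a - b = ρ by ring, show a + b + ρ - a = b + ρ by ring,
    show a + b + ρ - b = a + ρ by ring] at lS
  rw [show a + b + ρ + 1 - (b + ρ) - (a + ρ) = 1 - ρ by ring,
    show a + b + ρ + 1 - (b + ρ) = a + 1 by ring,
    show a + b + ρ + 1 - (a + ρ) = b + 1 by ring] at lS'
  have lρ := tendsto_ofReal_cpow_zero hρ
  have lρ1 := tendsto_ofReal_cpow_zero (l := 1 - ρ) (by simpa using hρ1)
  have cp : ∀ t ∈ Ioo (0 : ℝ) 1, (t : ℂ) ≠ 0 ∧ (t : ℂ) ^ (1 - ρ) * (t : ℂ) ^ ρ = t ∧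
      (t : ℂ) ^ (1 - ρ) * (t : ℂ) ^ (ρ - 1) = 1 := by
    intro t ht
    have htne : (t : ℂ) ≠ 0 := Complex.ofReal_ne_zero.2 ht.1.ne'
    refine ⟨htne, ?_, ?_⟩ <;> rw [← Complex.cpow_add _ _ htne] <;> simp
  have gρ := rGamma_eq ρ
  have gGρ : Complex.Gamma ρ * rGamma ρ = 1 :=
    mul_inv_cancel₀ (Complex.Gamma_ne_zero_of_re_pos hρ)
  have gGρ1 : Complex.Gamma (1 - ρ) * rGamma (1 - ρ) = 1 :=
    mul_inv_cancel₀ (Complex.Gamma_ne_zero_of_re_pos (by simpa using hρ1))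
  have ga := rGamma_eq a
  have gb := rGamma_eq b
  -- The weight t^(1-ρ) cancels the t^(ρ-1) in the derivative of the Frobenius solution; the other
  -- terms carry a factor t. The limit is ρ / (Γ(1+ρ) Γ(1-ρ)).
  have v0 : C0 = rGamma ρ * rGamma (1 - ρ) := by
    have l := lp.mul ((lY.mul ((lG.const_mul ρ).add (lt.mul lG'))).sub ((lt.mul lG).mul lY'))
    refine tendsto_nhds_unique (tendsto_const_nhds.congr' ?_) (l.trans (le_of_eq ?_))
    · filter_upwards [hmem] with t ht
      obtain ⟨htne, e1, e2⟩ := cp t ht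
      rw [← h0 t ht]
      linear_combination (1 - t : ℂ) ^ (a + b + ρ) * ((regularizedGaussHGFun a b (1 - ρ) t * ρ *
        regularizedGaussHGFun (a + ρ) (b + ρ) (1 + ρ) t) * e2 +
        (regularizedGaussHGFun a b (1 - ρ) t *
          deriv (regularizedGaussHGFun (a + ρ) (b + ρ) (1 + ρ)) t -
          regularizedGaussHGFun (a + ρ) (b + ρ) (1 + ρ) t *
          deriv (regularizedGaussHGFun a b (1 - ρ)) t) * e1)
    · congr 1
      rw [gρ, add_comm ρ 1]; ring
  have v1 : C1 = rGamma (a + ρ) * rGamma (b + ρ) := by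
    have l := lp.mul ((lS.mul ((lG.const_mul ρ).add (lt.mul lG'))).add
      ((lρ.mul lG).mul (lS'.const_mul (a * b))))
    refine tendsto_nhds_unique (tendsto_const_nhds.congr' ?_) (l.trans (le_of_eq ?_))
    · filter_upwards [hmem] with t ht
      obtain ⟨htne, e1, e2⟩ := cp t ht
      rw [← h1 t ht, ← deriv_regularizedGaussHGFun_one_sub a b ρ ht]
      linear_combination (1 - t : ℂ) ^ (a + b + ρ) *
        ((regularizedGaussHGFun a b (a + b + ρ) (1 - t) * ρ *
        regularizedGaussHGFun (a + ρ) (b + ρ) (1 + ρ) t) * e2 +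
        (regularizedGaussHGFun a b (a + b + ρ) (1 - t) *
          deriv (regularizedGaussHGFun (a + ρ) (b + ρ) (1 + ρ)) t) * e1)
    · congr 1
      rw [add_comm 1 ρ]
      linear_combination rGamma (a + ρ) * rGamma (b + ρ) * (gGρ - Complex.Gamma ρ * gρ)
  -- Here t^(1-ρ) kills the term with the derivative at 0, and only the singular derivative of the
  -- solution at 1 survives.
  have v2 : C2 = rGamma a * rGamma b := by
    have l := lp.mul (((lρ1.mul lS).mul lY').add (lY.mul (lS'.const_mul (a * b))))
    refine tendsto_nhds_unique (tendsto_const_nhds.congr' ?_) (l.trans (le_of_eq ?_))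
    · filter_upwards [hmem] with t ht
      rw [← h2 t ht, ← deriv_regularizedGaussHGFun_one_sub a b ρ ht]
      ring
    · congr 1
      rw [ga, gb]
      linear_combination a * b * rGamma (a + 1) * rGamma (b + 1) * gGρ1
  have e0 := h0 t ht
  have e1 := h1 t ht
  have e2 := h2 t ht
  rw [v0] at e0
  rw [v1] at e1
  rw [v2] at e2
  rw [← e0, ← e1, ← e2]
  ring

/-- The connection formula between the singular points `0` and `1`, on the real interval. -/
theorem connection_real (a b ρ : ℂ) {t : ℝ} (ht : t ∈ Ioo (0 : ℝ) 1) :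
    rGamma ρ * rGamma (1 - ρ) * regularizedGaussHGFun a b (a + b + ρ) (1 - t) =
      rGamma (a + ρ) * rGamma (b + ρ) * regularizedGaussHGFun a b (1 - ρ) t -
        rGamma a * rGamma b *
          (t ^ ρ * regularizedGaussHGFun (a + ρ) (b + ρ) (1 + ρ) t) := by
  have htne : (t : ℂ) ≠ 0 := Complex.ofReal_ne_zero.2 ht.1.ne'
  have hS : ∀ {a b c : ℂ → ℂ}, Differentiable ℂ a → Differentiable ℂ b → Differentiable ℂ c →
      Differentiable ℂ fun s => regularizedGaussHGFun (a s) (b s) (c s) t := fun ha hb hc =>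
    differentiable_regularizedGaussHGFun_param ha hb hc (norm_ofReal_lt_one_of_mem ht)
  have hS1 : ∀ {a b c : ℂ → ℂ}, Differentiable ℂ a → Differentiable ℂ b → Differentiable ℂ c →
      Differentiable ℂ fun s => regularizedGaussHGFun (a s) (b s) (c s) (1 - t) := fun ha hb hc =>
    differentiable_regularizedGaussHGFun_param ha hb hc (norm_one_sub_ofReal_lt_one ht)
  have hp : ∀ {l : ℂ → ℂ}, Differentiable ℂ l → Differentiable ℂ fun s => (t : ℂ) ^ l s :=
    fun hl => hl.const_cpow (Or.inl htne)
  have hg : ∀ {l : ℂ → ℂ}, Differentiable ℂ l → Differentiable ℂ fun s => rGamma (l s) :=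
    fun hl => differentiable_rGamma.comp hl
  -- The reciprocal Gamma factors and the regularized series make the difference of the two sides
  -- entire along every holomorphic curve of parameters.
  have hall : ∀ {a b ρ : ℂ → ℂ}, Differentiable ℂ a → Differentiable ℂ b → Differentiable ℂ ρ →
      Differentiable ℂ fun s => rGamma (ρ s) * rGamma (1 - ρ s) *
        regularizedGaussHGFun (a s) (b s) (a s + b s + ρ s) (1 - t) -
      (rGamma (a s + ρ s) * rGamma (b s + ρ s) * regularizedGaussHGFun (a s) (b s) (1 - ρ s) t -
        rGamma (a s) * rGamma (b s) * (t ^ ρ s *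
          regularizedGaussHGFun (a s + ρ s) (b s + ρ s) (1 + ρ s) t)) := by
    intro a b ρ ha hb hρ
    exact (((hg hρ).mul (hg (hρ.const_sub 1))).mul (hS1 ha hb ((ha.add hb).add hρ))).sub
      ((((hg (ha.add hρ)).mul (hg (hb.add hρ))).mul (hS ha hb (hρ.const_sub 1))).sub
        (((hg ha).mul (hg hb)).mul ((hp hρ).mul
          (hS (ha.add hρ) (hb.add hρ) (hρ.const_add 1)))))
  refine sub_eq_zero.1 (eq_zero_of_params (E := fun a b ρ => rGamma ρ * rGamma (1 - ρ) *
      regularizedGaussHGFun a b (a + b + ρ) (1 - t) -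
      (rGamma (a + ρ) * rGamma (b + ρ) * regularizedGaussHGFun a b (1 - ρ) t -
        rGamma a * rGamma b * (t ^ ρ * regularizedGaussHGFun (a + ρ) (b + ρ) (1 + ρ) t)))
    (fun b c => hall differentiable_id (differentiable_const _) (differentiable_const _))
    (fun b c => hall (differentiable_const _) differentiable_id (differentiable_const _))
    (fun b c => hall (differentiable_const _) (differentiable_const _) differentiable_id)
    (fun a b ha hb => ⟨1 / 2, ?_⟩) a b ρ)
  have e1 : ∀ᶠ ρ : ℂ in 𝓝 (1 / 2), ρ.re < 1 :=
    Complex.continuous_re.continuousAt.eventually (gt_mem_nhds (by norm_num))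
  filter_upwards [e1, eventually_re_pos (s₀ := 1 / 2) (by norm_num)] with ρ h1 h2
  exact sub_eq_zero.2 (connection_of_re_pos ha hb h2 h1 ht)

/-! ### The connection formula in the logarithmic case -/

theorem deriv_rGamma {s : ℂ} (hs : ∀ m : ℕ, s ≠ -m) :
    deriv rGamma s = -(Complex.digamma s * rGamma s) := by
  have h0 := Complex.Gamma_ne_zero hs
  have h1 : deriv rGamma s = _ := deriv_fun_inv'' (Complex.differentiableAt_Gamma s hs) h0
  rw [h1, Complex.digamma_def, logDeriv_apply, rGamma]
  field_simp

theorem hasDerivAt_rGamma (s : ℂ) : HasDerivAt rGamma (deriv rGamma s) s :=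
  (differentiable_rGamma s).hasDerivAt

/-- Obtained by differentiating 1/Γ(s) = s/Γ(s+1), whose first term vanishes at the next negative
integer. These derivatives at the zeros of 1/Γ are the source of the factorials (m-k-1)! in h₁. -/
theorem deriv_rGamma_neg_nat (n : ℕ) : deriv rGamma (-n) = (-1) ^ n * (n.factorial : ℂ) := by
  have h : ∀ s : ℂ, deriv rGamma s = rGamma (s + 1) + s * deriv rGamma (s + 1) := by
    intro s
    have h1 : HasDerivAt (fun s => s * rGamma (s + 1)) _ s := (hasDerivAt_id s).mul
      ((hasDerivAt_rGamma (s + 1)).comp_add_const s 1)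
    have h2 : rGamma = fun s => s * rGamma (s + 1) := funext rGamma_eq
    have h3 := (h1.congr_of_eventuallyEq (Eventually.of_forall fun s => congrFun h2 s)).deriv
    simpa using h3
  induction n with
  | zero => rw [h]; simp [rGamma]
  | succ n ih =>
    rw [h, show -((n + 1 : ℕ) : ℂ) + 1 = -n by push_cast; ring, rGamma_neg_nat, ih,
      Nat.factorial_succ]
    push_cast
    ring

theorem add_nat_ne_neg_nat {s : ℂ} (hs : ∀ m : ℕ, s ≠ -m) (k : ℕ) (m : ℕ) : s + k ≠ -m := by
  intro h
  refine hs (k + m) ?_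
  push_cast
  linear_combination h

theorem deriv_poch {s : ℂ} (hs : ∀ m : ℕ, s ≠ -m) (k : ℕ) :
    deriv (fun s => poch s k) s =
      poch s k * (Complex.digamma (s + k) - Complex.digamma s) := by
  have hk := add_nat_ne_neg_nat hs k
  have h1 : HasDerivAt (fun s => poch s k * rGamma (s + k)) _ s :=
    ((differentiable_poch k) s).hasDerivAt.mul ((hasDerivAt_rGamma (s + k)).comp_add_const s (k : ℂ))
  have h2 := (h1.congr_of_eventuallyEq
    (Eventually.of_forall fun s => rGamma_eq_poch_mul s k)).deriv
  rw [deriv_rGamma hs, deriv_rGamma hk, rGamma_eq_poch_mul s k] at h2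
  refine mul_right_cancel₀ (rGamma_ne_zero hk) ?_
  linear_combination -h2

theorem rGamma_natCast_add_one (n : ℕ) : rGamma (n + 1) = (n.factorial : ℂ)⁻¹ := by
  rw [rGamma, Complex.Gamma_nat_eq_factorial]

theorem natCast_add_one_ne_neg_nat (n m : ℕ) : (n : ℂ) + 1 ≠ -m := by
  intro h
  have : ((n + 1 + m : ℕ) : ℂ) = 0 := by push_cast; linear_combination h
  exact absurd (Nat.cast_eq_zero.1 this) (by omega)

/-- The derivative of 1/Γ is left unevaluated: at s = m the point 1 - m + k is a zero of 1/Γ for k <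
m and a positive integer for k ≥ m, and the two ranges are treated differently. -/
theorem deriv_hgCoeff_left (a b s : ℂ) (k : ℕ) :
    deriv (fun s => hgCoeff a b (1 - s) k) s =
      -(poch a k * poch b k * deriv rGamma (1 - s + k) / (k.factorial : ℂ)) := by
  have h0 : HasDerivAt (fun s : ℂ => 1 - s + k) (-1) s := by
    simpa using ((hasDerivAt_id s).const_sub 1).add_const (k : ℂ)
  have h1 : HasDerivAt (fun s => rGamma (1 - s + k)) (deriv rGamma (1 - s + k) * -1) s :=
    HasDerivAt.comp (h₂ := rGamma) s (hasDerivAt_rGamma _) h0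
  have h2 : HasDerivAt (fun s => hgCoeff a b (1 - s) k) _ s :=
    (h1.const_mul (poch a k * poch b k)).div_const _
  rw [h2.deriv]
  ring

theorem deriv_hgCoeff_right {a b c s : ℂ} (ha : ∀ m : ℕ, a + s ≠ -m) (hb : ∀ m : ℕ, b + s ≠ -m)
    (k : ℕ) (hc : ∀ m : ℕ, c + s + k ≠ -m) :
    deriv (fun s => hgCoeff (a + s) (b + s) (c + s) k) s = hgCoeff (a + s) (b + s) (c + s) k *
      (Complex.digamma (a + s + k) - Complex.digamma (a + s) + (Complex.digamma (b + s + k) -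
        Complex.digamma (b + s)) - Complex.digamma (c + s + k)) := by
  have hp : ∀ {a : ℂ}, (∀ m : ℕ, a + s ≠ -m) → HasDerivAt (fun s => poch (a + s) k)
      (poch (a + s) k * (Complex.digamma (a + s + k) - Complex.digamma (a + s))) s := by
    intro a ha
    have := ((differentiable_poch k) (a + s)).hasDerivAt.comp_const_add a s
    rwa [deriv_poch ha k] at this
  have hg : HasDerivAt (fun s => rGamma (c + s + k))
      (-(Complex.digamma (c + s + k) * rGamma (c + s + k))) s := by
    have h0 : HasDerivAt (fun s : ℂ => c + s + k) 1 s := by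
      simpa using ((hasDerivAt_id s).const_add c).add_const (k : ℂ)
    have := HasDerivAt.comp (h₂ := rGamma) s (hasDerivAt_rGamma (c + s + k)) h0
    rwa [deriv_rGamma hc, mul_one] at this
  have h : HasDerivAt (fun s => hgCoeff (a + s) (b + s) (c + s) k) _ s :=
    (((hp ha).mul (hp hb)).mul hg).div_const _
  rw [h.deriv, hgCoeff]
  simp only [Pi.mul_apply]
  ring

/-- At ρ = m the factor 1/Γ(1-ρ) vanishes, so the connection formula is differentiated in ρ at m.
The left side becomes (-1)^m times the function sought. On the right, t^ρ yields the logarithm, the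
coefficients with k < m of the first series yield the finite sum, and those with k ≥ m join the
derivative of the second series to form T. -/
theorem connection_nat_real {a b : ℂ} (ha : ∀ n : ℕ, a ≠ -n) (hb : ∀ n : ℕ, b ≠ -n) {m : ℕ}
    (hm : 0 < m) {t : ℝ} (ht : t ∈ Ioo (0 : ℝ) 1) :
    regularizedGaussHGFun a b (a + b + m) (1 - t) =
      rGamma (a + m) * rGamma (b + m) *
        (∑ k ∈ Finset.range m, (-1) ^ k * ((m - k - 1).factorial : ℂ) * poch a k * poch b k /
          (k.factorial : ℂ) * t ^ k) +
      (-1) ^ m * rGamma a * rGamma b * (t ^ m * (hypT m (a + m) (b + m) t -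
        Complex.log t * regularizedGaussHGFun (a + m) (b + m) (m + 1) t)) := by
  have ht' := norm_ofReal_lt_one_of_mem ht
  have htne : (t : ℂ) ≠ 0 := Complex.ofReal_ne_zero.2 ht.1.ne'
  have ham := add_nat_ne_neg_nat ha m
  have hbm := add_nat_ne_neg_nat hb m
  obtain ⟨n, rfl⟩ : ∃ n, m = n + 1 := ⟨m - 1, by omega⟩
  set M : ℂ := ((n + 1 : ℕ) : ℂ) with hM
  have hM1 : 1 - M = -n := by rw [hM]; push_cast; ring
  -- derivatives of both sides of the connection formula
  have dS : DifferentiableAt ℂ (fun ρ => regularizedGaussHGFun a b (a + b + ρ) (1 - t)) M :=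
    (differentiable_regularizedGaussHGFun_param (differentiable_const a) (differentiable_const b)
      (differentiable_id.const_add (a + b)) (norm_one_sub_ofReal_lt_one ht)) M
  obtain ⟨d1, sum1⟩ := hasSum_deriv_hgCoeff (differentiable_const a) (differentiable_const b)
    (differentiable_id.const_sub 1) ht' M
  obtain ⟨d2, sum2⟩ := hasSum_deriv_hgCoeff (differentiable_id.const_add a)
    (differentiable_id.const_add b) (differentiable_id.const_add 1) ht' M
  simp only [id] at d1 d2 sum1 sum2
  set D1 := deriv (fun s => regularizedGaussHGFun a b (1 - s) t) M
  set D2 := deriv (fun s => regularizedGaussHGFun (a + s) (b + s) (1 + s) t) M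
  have dg1 : HasDerivAt (fun ρ => rGamma (1 - ρ)) (deriv rGamma (1 - M) * -1) M :=
    HasDerivAt.comp (h₂ := rGamma) M (hasDerivAt_rGamma (1 - M)) (by simpa using (hasDerivAt_id M).const_sub 1)
  have dga := (hasDerivAt_rGamma (a + M)).comp_const_add a M
  have dgb := (hasDerivAt_rGamma (b + M)).comp_const_add b M
  have dt : HasDerivAt (fun ρ : ℂ => (t : ℂ) ^ ρ) ((t : ℂ) ^ M * Complex.log t) M := by
    simpa using (hasDerivAt_id M).const_cpow (c := (t : ℂ)) (Or.inl htne)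
  have hL := ((hasDerivAt_rGamma M).mul dg1).mul dS.hasDerivAt
  have hR := ((dga.mul dgb).mul d1.hasDerivAt).sub ((dt.mul d2.hasDerivAt).const_mul
    (rGamma a * rGamma b))
  have hfun : (fun ρ => rGamma ρ * rGamma (1 - ρ) *
      regularizedGaussHGFun a b (a + b + ρ) (1 - t)) = fun ρ =>
      rGamma (a + ρ) * rGamma (b + ρ) * regularizedGaussHGFun a b (1 - ρ) t -
        rGamma a * rGamma b *
          (t ^ ρ * regularizedGaussHGFun (a + ρ) (b + ρ) (1 + ρ) t) :=
    funext fun ρ => connection_real a b ρ ht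
  have key := hL.unique (hR.congr_of_eventuallyEq (Eventually.of_forall fun ρ => congrFun hfun ρ))
  simp only [Pi.mul_apply] at key
  rw [hM1, rGamma_neg_nat, deriv_rGamma_neg_nat, deriv_rGamma ham, deriv_rGamma hbm, hM] at key
  rw [← hM] at key
  have hgM : rGamma M * (n.factorial : ℂ) = 1 := by
    rw [hM]
    push_cast
    rw [rGamma_natCast_add_one, inv_mul_cancel₀ (Nat.cast_ne_zero.2 n.factorial_ne_zero)]
  -- the combined series
  have hS1 := hasSum_hgCoeff a b (1 - M) ht'
  set P := rGamma (a + M) * rGamma (b + M) with hP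
  set ψ₀ := Complex.digamma (a + M) + Complex.digamma (b + M) with hψ₀
  -- The subtraction of ψ₀ accounts for the derivative of the prefactor 1/(Γ(a+ρ) Γ(b+ρ)), which is
  -- -ψ₀ P at ρ = m.
  have hX := (sum1.sub (hS1.mul_left ψ₀)).mul_left P
  rw [← hasSum_nat_add_iff' (n + 1)] at hX
  have hY := sum2.mul_left (-(rGamma a * rGamma b * t ^ (n + 1)))
  have hZ := ((isCutCont_hypT (n + 1) (a + M) (b + M)).2 t ht').mul_left
    (rGamma a * rGamma b * t ^ (n + 1))
  have hga : rGamma a = poch a (n + 1) * rGamma (a + M) := rGamma_eq_poch_mul a (n + 1)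
  have hgb : rGamma b = poch b (n + 1) * rGamma (b + M) := rGamma_eq_poch_mul b (n + 1)
  -- For i < m the coefficient itself is zero, because 1 - m + i is a non-positive integer, so only
  -- the derivative of 1/Γ contributes.
  have hhead : ∀ i ∈ Finset.range (n + 1),
      P * (deriv (fun s => hgCoeff a b (1 - s) i) M * t ^ i - ψ₀ * (hgCoeff a b (1 - M) i * t ^ i)) =
      (-1) ^ (n + 1) * (P * ((-1) ^ i * ((n + 1 - i - 1).factorial : ℂ) * poch a i * poch b i /
          (i.factorial : ℂ) * t ^ i)) := by
    intro i hi
    obtain ⟨j, hj⟩ : ∃ j, n = i + j := ⟨n - i, by have := Finset.mem_range.1 hi; omega⟩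
    have e1 : 1 - M + i = -(j : ℂ) := by rw [hM1, hj]; push_cast; ring
    rw [deriv_hgCoeff_left, hgCoeff, e1, rGamma_neg_nat, deriv_rGamma_neg_nat,
      show n + 1 - i - 1 = j by omega, hj]
    have e2 : ((-1 : ℂ) ^ i) * (-1) ^ i = 1 := by rw [← mul_pow]; simp
    rw [pow_succ, pow_add]
    linear_combination (P * t ^ i * (poch a i * poch b i * ((-1) ^ j * (j.factorial : ℂ)) /
      (i.factorial : ℂ))) * e2
  -- The term j + m of the first series meets the term j of the second in the same power of t. The
  -- splittings (a)_(m+j) = (a)_m (a+m)_j and 1/Γ(a) = (a)_m / Γ(a+m) match the prefactors, and ψ₀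
  -- cancels against ψ(a+m) + ψ(b+m) from the Pochhammer derivatives.
  have htail : ∀ j : ℕ, P * (deriv (fun s => hgCoeff a b (1 - s) (j + (n + 1))) M *
      t ^ (j + (n + 1)) - ψ₀ * (hgCoeff a b (1 - M) (j + (n + 1)) * t ^ (j + (n + 1)))) +
      -(rGamma a * rGamma b * t ^ (n + 1)) *
        (deriv (fun s => hgCoeff (a + s) (b + s) (1 + s) j) M * t ^ j) =
      rGamma a * rGamma b * t ^ (n + 1) * (psiCoeff (n + 1) (a + M) (b + M) j * t ^ j) := by
    intro j
    have e1 : 1 - M + (j + (n + 1) : ℕ) = (j : ℂ) + 1 := by rw [hM1]; push_cast; ring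
    have e2 : 1 + M + j = ((j + (n + 1) : ℕ) : ℂ) + 1 := by rw [hM]; push_cast; ring
    have e3 : M + 1 + j = ((j + (n + 1) : ℕ) : ℂ) + 1 := by rw [hM]; push_cast; ring
    have e4 : M + j + 1 = ((j + (n + 1) : ℕ) : ℂ) + 1 := by rw [hM]; push_cast; ring
    rw [deriv_hgCoeff_left, deriv_hgCoeff_right ham hbm j
      (by rw [e2]; exact natCast_add_one_ne_neg_nat _), psiCoeff]
    simp only [hgCoeff]
    rw [← hM, e1, e2, e3, e4, deriv_rGamma (natCast_add_one_ne_neg_nat j), rGamma_natCast_add_one,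
      rGamma_natCast_add_one, hga, hgb, add_comm j (n + 1), poch_add a, poch_add b, ← hM, hP, hψ₀]
    ring
  have hsum := (hX.add hY).unique ((hasSum_congr_terms fun j => htail j).2 hZ)
  rw [Finset.sum_congr rfl hhead, ← Finset.mul_sum, ← Finset.mul_sum] at hsum
  have e5 : ((-1 : ℂ) ^ (n + 1)) * (-1) ^ (n + 1) = 1 := by rw [← mul_pow]; simp
  have e6 : (t : ℂ) ^ M = (t : ℂ) ^ (n + 1) := by rw [hM, Complex.cpow_natCast]
  rw [e6] at key
  rw [add_comm M 1]
  set S := regularizedGaussHGFun a b (a + b + M) (1 - t)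
  have key2 : (-1) ^ (n + 1) * S = P * (D1 - ψ₀ * regularizedGaussHGFun a b (1 - M) t) -
      rGamma a * rGamma b * (t ^ (n + 1) * Complex.log t *
        regularizedGaussHGFun (a + M) (b + M) (1 + M) t + t ^ (n + 1) * D2) := by
    rw [hM1]
    linear_combination key - (-1) ^ (n + 1) * S * hgM
  set Q := ∑ k ∈ Finset.range (n + 1), (-1) ^ k * ((n + 1 - k - 1).factorial : ℂ) * poch a k *
    poch b k / (k.factorial : ℂ) * (t : ℂ) ^ k
  linear_combination (-1) ^ (n + 1) * key2 + (-1) ^ (n + 1) * hsum + (P * Q - S) * e5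

/-! ### The connection formula on the doubly cut plane -/

/-- The plane cut along `(-∞, 0]` and `[1, ∞)`. -/
def doublyCutPlane : Set ℂ := Complex.slitPlane ∩ cutPlane

theorem isOpen_doublyCutPlane : IsOpen doublyCutPlane :=
  Complex.isOpen_slitPlane.inter isOpen_cutPlane

theorem half_mem_doublyCutPlane : ((1 / 2 : ℝ) : ℂ) ∈ doublyCutPlane :=
  ⟨Complex.ofReal_mem_slitPlane.2 (by norm_num), ofReal_mem_cutPlane (by norm_num)⟩

theorem isPreconnected_doublyCutPlane : IsPreconnected doublyCutPlane := by
  have h1 : StarConvex ℝ ((1 / 2 : ℝ) : ℂ) Complex.slitPlane :=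
    Complex.starConvex_ofReal_slitPlane (by norm_num)
  have h2 : StarConvex ℝ ((1 / 2 : ℝ) : ℂ) cutPlane := by
    intro z hz p r hp hr hpr
    have := h1 (show 1 - z ∈ Complex.slitPlane from hz) hp hr hpr
    have e : p • ((1 / 2 : ℝ) : ℂ) + r • (1 - z) = 1 - (p • ((1 / 2 : ℝ) : ℂ) + r • z) := by
      simp only [Complex.real_smul]
      have : (p : ℂ) + r = 1 := by rw [← Complex.ofReal_add, hpr, Complex.ofReal_one]
      push_cast
      linear_combination this
    rwa [e] at this
  exact ((h1.inter h2).isPathConnected half_mem_doublyCutPlane).isConnected.isPreconnected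

theorem one_sub_mem_cutPlane {w : ℂ} (hw : w ∈ Complex.slitPlane) : 1 - w ∈ cutPlane := by
  simpa [cutPlane] using hw

theorem differentiableOn_hypF_one_sub (a b c : ℂ) :
    DifferentiableOn ℂ (fun w => hypF a b c (1 - w)) doublyCutPlane :=
  (differentiableOn_hypF a b c).comp (by fun_prop) fun _ hw => one_sub_mem_cutPlane hw.1

theorem differentiableOn_cpow_doublyCutPlane (ρ : ℂ) :
    DifferentiableOn ℂ (fun w : ℂ => w ^ ρ) doublyCutPlane := fun _ hw =>
  ((hasDerivAt_id _).cpow_const (c := ρ) hw.1).differentiableAt.differentiableWithinAt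

theorem hypF_connection (a b ρ : ℂ) {w : ℂ} (hw : w ∈ doublyCutPlane) :
    rGamma ρ * rGamma (1 - ρ) * hypF a b (a + b + ρ) (1 - w) =
      rGamma (a + ρ) * rGamma (b + ρ) * hypF a b (1 - ρ) w -
        rGamma a * rGamma b * (w ^ ρ * hypF (a + ρ) (b + ρ) (1 + ρ) w) := by
  have hF : ∀ a b c : ℂ, DifferentiableOn ℂ (hypF a b c) doublyCutPlane := fun a b c =>
    (differentiableOn_hypF a b c).mono inter_subset_right
  refine eqOn_of_eventually_eq_real isOpen_doublyCutPlane isPreconnected_doublyCutPlane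
    (F := fun w => rGamma ρ * rGamma (1 - ρ) * hypF a b (a + b + ρ) (1 - w))
    (G := fun w => rGamma (a + ρ) * rGamma (b + ρ) * hypF a b (1 - ρ) w -
        rGamma a * rGamma b * (w ^ ρ * hypF (a + ρ) (b + ρ) (1 + ρ) w))
    ((differentiableOn_hypF_one_sub _ _ _).const_mul _)
    (((hF _ _ _).const_mul _).sub
      (((differentiableOn_cpow_doublyCutPlane ρ).mul (hF _ _ _)).const_mul _))
    half_mem_doublyCutPlane ?_ hw
  filter_upwards [Ioo_mem_nhds (show (0 : ℝ) < 1 / 2 by norm_num)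
      (show (1 / 2 : ℝ) < 1 by norm_num)] with t ht
  have h1 := norm_ofReal_lt_one_of_mem ht
  have h2 := norm_one_sub_ofReal_lt_one ht
  rw [hypF_eq_of_norm_lt_one _ _ _ h1, hypF_eq_of_norm_lt_one _ _ _ h1,
    hypF_eq_of_norm_lt_one _ _ _ h2]
  exact connection_real a b ρ ht

theorem hypF_connection_nat {a b : ℂ} (ha : ∀ n : ℕ, a ≠ -n) (hb : ∀ n : ℕ, b ≠ -n) {m : ℕ}
    (hm : 0 < m) {w : ℂ} (hw : w ∈ doublyCutPlane) :
    hypF a b (a + b + m) (1 - w) =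
      rGamma (a + m) * rGamma (b + m) *
        (∑ k ∈ Finset.range m, (-1) ^ k * ((m - k - 1).factorial : ℂ) * poch a k * poch b k /
          (k.factorial : ℂ) * w ^ k) +
      (-1) ^ m * rGamma a * rGamma b * (w ^ m * (hypT m (a + m) (b + m) w -
        Complex.log w * hypF (a + m) (b + m) (m + 1) w)) := by
  have hF : ∀ a b c : ℂ, DifferentiableOn ℂ (hypF a b c) doublyCutPlane := fun a b c =>
    (differentiableOn_hypF a b c).mono inter_subset_right
  have hT : ∀ a b : ℂ, DifferentiableOn ℂ (hypT m a b) doublyCutPlane := fun a b =>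
    (differentiableOn_hypT m a b).mono inter_subset_right
  have hlog : DifferentiableOn ℂ Complex.log doublyCutPlane := fun w hw =>
    (Complex.differentiableAt_log hw.1).differentiableWithinAt
  refine eqOn_of_eventually_eq_real isOpen_doublyCutPlane isPreconnected_doublyCutPlane
    (differentiableOn_hypF_one_sub a b (a + b + m))
    (G := fun w => rGamma (a + m) * rGamma (b + m) *
        (∑ k ∈ Finset.range m, (-1) ^ k * ((m - k - 1).factorial : ℂ) * poch a k * poch b k /
          (k.factorial : ℂ) * w ^ k) +
      (-1) ^ m * rGamma a * rGamma b * (w ^ m * (hypT m (a + m) (b + m) w -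
        Complex.log w * hypF (a + m) (b + m) (m + 1) w)))
    (DifferentiableOn.add (by fun_prop) (DifferentiableOn.const_mul (DifferentiableOn.mul
      (by fun_prop) ((hT _ _).sub (hlog.mul (hF _ _ _)))) _))
    half_mem_doublyCutPlane ?_ hw
  filter_upwards [Ioo_mem_nhds (show (0 : ℝ) < 1 / 2 by norm_num)
      (show (1 / 2 : ℝ) < 1 by norm_num)] with t ht
  have h1 := norm_ofReal_lt_one_of_mem ht
  have h2 := norm_one_sub_ofReal_lt_one ht
  rw [hypF_eq_of_norm_lt_one _ _ _ h1, hypF_eq_of_norm_lt_one _ _ _ h2]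
  exact connection_nat_real ha hb hm ht

/-! ### Boundary values of holomorphic functions as distributions -/

/-- The point `x - 1 + s ε i`, which tends to `x - 1 ± i0` as `ε ↘ 0` for `s = ±1`. -/
def nearSubOne (s ε x : ℝ) : ℂ := (x : ℂ) - 1 + s * ε * Complex.I

theorem nearSubOne_re (s ε x : ℝ) : (nearSubOne s ε x).re = x - 1 := by simp [nearSubOne]

theorem nearSubOne_im (s ε x : ℝ) : (nearSubOne s ε x).im = s * ε := by simp [nearSubOne]

theorem nearSubOne_zero (s x : ℝ) : nearSubOne s 0 x = ((x - 1 : ℝ) : ℂ) := by simp [nearSubOne]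

variable {s : ℝ}

theorem nearSubOne_im_ne_zero (hs : s = 1 ∨ s = -1) {ε : ℝ} (hε : 0 < ε) (x : ℝ) :
    (nearSubOne s ε x).im ≠ 0 := by
  rw [nearSubOne_im]
  rcases hs with rfl | rfl <;> simp [hε.ne']

theorem nearSubOne_mem_slitPlane (hs : s = 1 ∨ s = -1) {ε : ℝ} (hε : 0 < ε) (x : ℝ) :
    nearSubOne s ε x ∈ Complex.slitPlane := Or.inr (nearSubOne_im_ne_zero hs hε x)

theorem abs_le_norm_nearSubOne (s ε x : ℝ) : |x - 1| ≤ ‖nearSubOne s ε x‖ := by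
  rw [← nearSubOne_re s ε x]; exact Complex.abs_re_le_norm _

theorem norm_nearSubOne_le (hs : s = 1 ∨ s = -1) {ε : ℝ} (hε : ε ∈ Ioc (0 : ℝ) 1) (x : ℝ) :
    ‖nearSubOne s ε x‖ ≤ |x - 1| + 1 := by
  refine (Complex.norm_le_abs_re_add_abs_im _).trans ?_
  rw [nearSubOne_re, nearSubOne_im]
  have : |s * ε| ≤ 1 := by
    rcases hs with rfl | rfl <;> simp [abs_of_pos hε.1, hε.2]
  linarith

theorem hasDerivAt_nearSubOne (s ε x : ℝ) : HasDerivAt (nearSubOne s ε) 1 x := by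
  unfold nearSubOne
  exact ((Complex.ofRealCLM.hasDerivAt (x := x)).sub_const 1).add_const _

/-- `log (x - 1 ± i0)`. -/
def logSubOne (s x : ℝ) : ℂ :=
  Real.log |x - 1| + s * Complex.I * Real.pi * (if x < 1 then 1 else 0)

theorem tendsto_nearSubOne (s x : ℝ) :
    Tendsto (fun ε => nearSubOne s ε x) (𝓝[>] 0) (𝓝 ((x - 1 : ℝ) : ℂ)) := by
  have : Continuous fun ε => nearSubOne s ε x := by unfold nearSubOne; fun_prop
  have h := this.tendsto 0
  rw [nearSubOne_zero] at h
  exact h.mono_left nhdsWithin_le_nhds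

theorem tendsto_log_nearSubOne (hs : s = 1 ∨ s = -1) {x : ℝ} (hx : x ≠ 1) :
    Tendsto (fun ε => Complex.log (nearSubOne s ε x)) (𝓝[>] 0) (𝓝 (logSubOne s x)) := by
  have ht := tendsto_nearSubOne s x
  rcases lt_or_gt_of_ne hx with h | h
  · have hre : (((x - 1 : ℝ) : ℂ)).re < 0 := by rw [Complex.ofReal_re]; linarith
    have him : (((x - 1 : ℝ) : ℂ)).im = 0 := Complex.ofReal_im _
    rcases hs with rfl | rfl
    · have h1 := (Complex.tendsto_log_nhdsWithin_im_nonneg_of_re_neg_of_im_zero hre him).comp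
        (tendsto_nhdsWithin_iff.2 ⟨ht, by
          filter_upwards [self_mem_nhdsWithin] with ε hε
          rw [nearSubOne_im, one_mul]; exact (mem_Ioi.1 hε).le⟩)
      rw [Complex.norm_real, Real.norm_eq_abs] at h1
      simpa [Function.comp_def, logSubOne, h, mul_comm] using h1
    · have h1 := (Complex.tendsto_log_nhdsWithin_im_neg_of_re_neg_of_im_zero hre him).comp
        (tendsto_nhdsWithin_iff.2 ⟨ht, by
          filter_upwards [self_mem_nhdsWithin] with ε hε
          rw [nearSubOne_im]; linarith [mem_Ioi.1 hε]⟩)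
      rw [Complex.norm_real, Real.norm_eq_abs] at h1
      simpa [Function.comp_def, logSubOne, h, mul_comm, sub_eq_add_neg] using h1
  · have hpos : 0 < x - 1 := by linarith
    have h1 := ht.clog (Complex.ofReal_mem_slitPlane.2 hpos)
    rw [← Complex.ofReal_log hpos.le] at h1
    simpa [logSubOne, not_lt.2 h.le, abs_of_pos hpos] using h1

theorem locallyIntegrable_of_forall_intervalIntegrable {f : ℝ → ℝ}
    (h : ∀ a b : ℝ, IntervalIntegrable f volume a b) : LocallyIntegrable f := by
  rw [locallyIntegrable_iff]
  intro K hK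
  obtain ⟨R, hR⟩ := hK.isBounded.subset_closedBall 0
  rw [Real.closedBall_eq_Icc, zero_sub, zero_add] at hR
  rcases le_or_gt (-R) R with h1 | h1
  · exact ((intervalIntegrable_iff_integrableOn_Icc_of_le h1).1 (h (-R) R)).mono_set hR
  · rw [Icc_eq_empty (not_le.2 h1)] at hR
    rw [subset_empty_iff.1 hR]
    exact integrableOn_empty

theorem ae_ne_one : ∀ᵐ x : ℝ, x ≠ 1 :=
  (measure_eq_zero_iff_ae_notMem (s := {(1 : ℝ)})).1 (by simp)

theorem continuous_comp_nearSubOne (hs : s = 1 ∨ s = -1) {g : ℂ → ℂ}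
    (hg : ContinuousOn g Complex.slitPlane) {ε : ℝ} (hε : 0 < ε) :
    Continuous fun x => g (nearSubOne s ε x) :=
  hg.comp_continuous (by unfold nearSubOne; fun_prop) fun x => nearSubOne_mem_slitPlane hs hε x

/-- The function `g` has the boundary values `g₀` at `x - 1 ± i0`, dominated by `B`. -/
structure DominatedBoundary (s : ℝ) (g : ℂ → ℂ) (g₀ : ℝ → ℂ) (B : ℝ → ℝ) : Prop where
  continuousOn : ContinuousOn g Complex.slitPlane
  locallyIntegrable_bound : LocallyIntegrable B
  norm_le : ∀ ε ∈ Ioc (0 : ℝ) 1, ∀ x ≠ 1, ‖g (nearSubOne s ε x)‖ ≤ B x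
  tendsto : ∀ x ≠ 1, Tendsto (fun ε => g (nearSubOne s ε x)) (𝓝[>] 0) (𝓝 (g₀ x))

theorem DominatedBoundary.locallyIntegrable (hs : s = 1 ∨ s = -1) {g : ℂ → ℂ} {g₀ : ℝ → ℂ}
    {B : ℝ → ℝ} (h : DominatedBoundary s g g₀ B) : LocallyIntegrable g₀ := by
  have hseq : Tendsto (fun n : ℕ => 1 / ((n : ℝ) + 1)) atTop (𝓝[>] 0) :=
    tendsto_nhdsWithin_iff.2 ⟨tendsto_one_div_add_atTop_nhds_zero_nat,
      Eventually.of_forall fun n => by simp only [mem_Ioi]; positivity⟩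
  have hm : AEStronglyMeasurable g₀ volume := by
    refine aestronglyMeasurable_of_tendsto_ae (u := atTop)
      (f := fun (n : ℕ) x => g (nearSubOne s (1 / ((n : ℝ) + 1)) x)) (fun n => ?_) ?_
    · exact (continuous_comp_nearSubOne hs h.continuousOn (by positivity)).aestronglyMeasurable
    · filter_upwards [ae_ne_one] with x hx
      exact (h.tendsto x hx).comp hseq
  refine h.locallyIntegrable_bound.mono hm ?_
  filter_upwards [ae_ne_one] with x hx
  refine le_trans (le_of_tendsto (h.tendsto x hx).norm ?_) (le_abs_self _)
  filter_upwards [Ioc_mem_nhdsGT one_pos] with ε hε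
  exact h.norm_le ε hε x hx

theorem DominatedBoundary.tendsto_integral (hs : s = 1 ∨ s = -1) {g : ℂ → ℂ} {g₀ : ℝ → ℂ}
    {B : ℝ → ℝ} (h : DominatedBoundary s g g₀ B) {ψ : ℝ × ℝ → ℂ} (hψ : Continuous ψ)
    {K : Set ℝ} (hK : IsCompact K) (hψK : ∀ ε, ∀ x ∉ K, ψ (ε, x) = 0) :
    Tendsto (fun ε => ∫ x, ψ (ε, x) * g (nearSubOne s ε x)) (𝓝[>] 0)
      (𝓝 (∫ x, ψ (0, x) * g₀ x)) := by
  obtain ⟨M, hM⟩ := ((isCompact_Icc (a := (0 : ℝ)) (b := 1)).prod hK).exists_bound_of_continuousOn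
    hψ.continuousOn
  refine tendsto_integral_filter_of_dominated_convergence
    (K.indicator fun x => |M| * |B x|) ?_ ?_ ?_ ?_
  · filter_upwards [self_mem_nhdsWithin] with ε hε
    exact ((hψ.comp (by fun_prop : Continuous fun x : ℝ => (ε, x))).mul
      (continuous_comp_nearSubOne hs h.continuousOn hε)).aestronglyMeasurable
  · filter_upwards [Ioc_mem_nhdsGT one_pos] with ε hε
    filter_upwards [ae_ne_one] with x hx
    by_cases hxK : x ∈ K
    · rw [indicator_of_mem hxK, norm_mul]
      exact mul_le_mul ((hM (ε, x) ⟨⟨hε.1.le, hε.2⟩, hxK⟩).trans (le_abs_self _))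
        ((h.norm_le ε hε x hx).trans (le_abs_self _)) (norm_nonneg _) (abs_nonneg _)
    · rw [hψK ε x hxK, indicator_of_notMem hxK]; simp
  · refine (integrable_indicator_iff hK.measurableSet).2 ?_
    exact ((h.locallyIntegrable_bound.integrableOn_isCompact hK).abs).const_mul _
  · filter_upwards [ae_ne_one] with x hx
    have h1 : Continuous fun ε : ℝ => ψ (ε, x) := hψ.comp (by fun_prop)
    exact ((h1.tendsto 0).mono_left nhdsWithin_le_nhds).mul (h.tendsto x hx)

/-- A power is monotone or antitone according to the sign of its exponent, so one of the two end
points always dominates. -/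
theorem rpow_le_add {a b c : ℝ} (ha : 0 < a) (hab : a ≤ b) (hbc : b ≤ c) (σ : ℝ) :
    b ^ σ ≤ a ^ σ + c ^ σ := by
  rcases le_total 0 σ with h | h
  · exact (Real.rpow_le_rpow (ha.le.trans hab) hbc h).trans
      (le_add_of_nonneg_left (Real.rpow_nonneg ha.le _))
  · exact (Real.rpow_le_rpow_of_nonpos ha hab h).trans
      (le_add_of_nonneg_right (Real.rpow_nonneg ((ha.le.trans hab).trans hbc) _))

/-- The modulus of z^l is |z|^(Re l) exp(-arg z · Im l), and |x-1| ≤ |z| ≤ |x-1| + 1 for z = x - 1 ±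
iε with 0 < ε ≤ 1. The condition -1 < Re l makes |x-1|^(Re l) locally integrable. -/
theorem dominatedBoundary_cpow (hs : s = 1 ∨ s = -1) {l : ℂ} (hl : -1 < l.re) :
    ∃ g₀ B, DominatedBoundary s (fun z => z ^ l) g₀ B := by
  refine ⟨fun x => Complex.exp (logSubOne s x * l), fun x => (|x - 1| ^ l.re +
    (|x - 1| + 1) ^ l.re) * Real.exp (Real.pi * |l.im|), ⟨?_, ?_, ?_, ?_⟩⟩
  · exact fun z hz => (continuousAt_cpow_const hz).continuousWithinAt
  · refine locallyIntegrable_of_forall_intervalIntegrable fun a b => ?_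
    refine IntervalIntegrable.mul_const (IntervalIntegrable.add ?_ ?_) _
    · have h1 : IntervalIntegrable (fun x : ℝ => ‖(x : ℂ) ^ (l.re : ℂ)‖) volume (a - 1) (b - 1) :=
        (intervalIntegral.intervalIntegrable_cpow' (by simpa using hl)).norm
      have h2 := h1.comp_sub_right 1
      simp only [Complex.norm_cpow_real, Complex.norm_real, Real.norm_eq_abs, sub_add_cancel] at h2
      exact h2
    · refine Continuous.intervalIntegrable ?_ _ _
      exact Continuous.rpow_const (by fun_prop) fun x => Or.inl (by positivity)
  · intro ε hε x hx
    have h0 : 0 < |x - 1| := abs_pos.2 (sub_ne_zero.2 hx)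
    have hz : nearSubOne s ε x ≠ 0 :=
      Complex.slitPlane_ne_zero (nearSubOne_mem_slitPlane hs hε.1 x)
    rw [Complex.norm_cpow_of_ne_zero hz, div_eq_mul_inv, ← Real.exp_neg]
    refine mul_le_mul (rpow_le_add h0 (abs_le_norm_nearSubOne s ε x) (norm_nearSubOne_le hs hε x) _)
      (Real.exp_le_exp.2 ?_) (Real.exp_pos _).le (by positivity)
    refine (neg_le_abs _).trans ?_
    rw [abs_mul]
    exact mul_le_mul_of_nonneg_right (Complex.abs_arg_le_pi _) (abs_nonneg _)
  · intro x hx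
    have h1 := ((tendsto_log_nearSubOne hs hx).mul_const l).cexp
    refine h1.congr' ?_
    filter_upwards [self_mem_nhdsWithin] with ε hε
    rw [Complex.cpow_def_of_ne_zero
      (Complex.slitPlane_ne_zero (nearSubOne_mem_slitPlane hs hε x))]

theorem dominatedBoundary_log (hs : s = 1 ∨ s = -1) :
    ∃ B, DominatedBoundary s Complex.log (logSubOne s) B := by
  refine ⟨fun x => |Real.log (x - 1)| + |Real.log (|x - 1| + 1)| + Real.pi, ⟨?_, ?_, ?_, ?_⟩⟩
  · exact fun z hz => (continuousAt_clog hz).continuousWithinAt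
  · refine locallyIntegrable_of_forall_intervalIntegrable fun a b => ?_
    refine IntervalIntegrable.add (IntervalIntegrable.add ?_ ?_) intervalIntegrable_const
    · have h1 : IntervalIntegrable Real.log volume (a - 1) (b - 1) :=
        intervalIntegral.intervalIntegrable_log'
      have h2 := (h1.comp_sub_right 1).norm
      simpa only [sub_add_cancel, Real.norm_eq_abs] using h2
    · refine Continuous.intervalIntegrable ?_ _ _
      refine (Continuous.log (by fun_prop) fun x => ?_).abs
      positivity
  · intro ε hε x hx
    have h0 : 0 < |x - 1| := abs_pos.2 (sub_ne_zero.2 hx)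
    have h1 := abs_le_norm_nearSubOne s ε x
    have h2 := norm_nearSubOne_le hs hε x
    have h3 : ‖Complex.log (nearSubOne s ε x)‖ ≤
        |Real.log ‖nearSubOne s ε x‖| + Real.pi := by
      refine (Complex.norm_le_abs_re_add_abs_im _).trans ?_
      rw [Complex.log_re, Complex.log_im]
      exact add_le_add_right (Complex.abs_arg_le_pi _) _
    have h4 : Real.log |x - 1| ≤ Real.log ‖nearSubOne s ε x‖ := Real.log_le_log h0 h1
    have h5 : Real.log ‖nearSubOne s ε x‖ ≤ Real.log (|x - 1| + 1) :=
      Real.log_le_log (h0.trans_le h1) h2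
    rw [Real.log_abs] at h4
    have h6 : |Real.log ‖nearSubOne s ε x‖| ≤ |Real.log (x - 1)| + |Real.log (|x - 1| + 1)| := by
      rw [abs_le]
      constructor
      · linarith [neg_abs_le (Real.log (x - 1)), abs_nonneg (Real.log (|x - 1| + 1))]
      · linarith [le_abs_self (Real.log (|x - 1| + 1)), abs_nonneg (Real.log (x - 1))]
    linarith
  · exact fun x hx => tendsto_log_nearSubOne hs hx

/-- The distribution `T` on `(0, ∞)` is the boundary value of `g` at `x - 1 ± i0`, tested against
smooth families of test functions. -/
def IsBoundaryValue (s : ℝ) (g : ℂ → ℂ) (T : Distr) : Prop :=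
  ∀ (ψ : ℝ × ℝ → ℂ) (K : Set ℝ) (φ : 𝓓(posReals, ℂ)), ContDiff ℝ ∞ ψ → IsCompact K →
    (∀ ε, ∀ x ∉ K, ψ (ε, x) = 0) → (∀ x, φ x = ψ (0, x)) →
    Tendsto (fun ε => ∫ x, ψ (ε, x) * g (nearSubOne s ε x)) (𝓝[>] 0) (𝓝 (T φ))

theorem DominatedBoundary.isBoundaryValue (hs : s = 1 ∨ s = -1) {g : ℂ → ℂ} {g₀ : ℝ → ℂ}
    {B : ℝ → ℝ} (h : DominatedBoundary s g g₀ B) : IsBoundaryValue s g (regular g₀) := by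
  intro ψ K φ hψ hK hψK hφ
  rw [regular_apply ((h.locallyIntegrable hs).locallyIntegrableOn _)]
  simp_rw [hφ]
  exact h.tendsto_integral hs hψ.continuous hK hψK

theorem IsBoundaryValue.const_mul {g : ℂ → ℂ} {T : Distr} (h : IsBoundaryValue s g T) (c : ℂ) :
    IsBoundaryValue s (fun z => c * g z) (c • T) := by
  intro ψ K φ hψ hK hψK hφ
  have := (h ψ K φ hψ hK hψK hφ).const_mul c
  simp_rw [← integral_const_mul] at this
  simpa [mul_left_comm] using this

/-- Boundary values of derivatives are distributional derivatives of boundary values. -/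
theorem IsBoundaryValue.deriv (hs : s = 1 ∨ s = -1) {G g : ℂ → ℂ} {T : Distr}
    (h : IsBoundaryValue s G T) (hG : ∀ z ∈ Complex.slitPlane, HasDerivAt G (g z) z)
    (hg : ContinuousOn g Complex.slitPlane) :
    IsBoundaryValue s g (-(T.comp (TestFunction.lineDerivCLM ℂ (1 : ℝ)))) := by
  intro ψ K φ hψ hK hψK hφ
  set ψ' : ℝ × ℝ → ℂ := fun p => fderiv ℝ ψ p (0, 1) with hψ'
  have hψ'_contDiff : ContDiff ℝ ∞ ψ' :=
    (hψ.fderiv_right (m := ∞) (by simp)).clm_apply contDiff_const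
  have hderiv : ∀ ε x : ℝ, HasDerivAt (fun x => ψ (ε, x)) (ψ' (ε, x)) x := by
    intro ε x
    have h1 : HasFDerivAt ψ (fderiv ℝ ψ (ε, x)) (ε, x) :=
      (hψ.differentiable (by simp)).differentiableAt.hasFDerivAt
    exact h1.comp_hasDerivAt x ((hasDerivAt_const x ε).prodMk (hasDerivAt_id x))
  have hψ'K : ∀ ε, ∀ x ∉ K, ψ' (ε, x) = 0 := by
    intro ε x hx
    refine (hderiv ε x).unique ((hasDerivAt_const x (0 : ℂ)).congr_of_eventuallyEq ?_)
    filter_upwards [hK.isClosed.isOpen_compl.mem_nhds hx] with y hy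
    exact hψK ε y hy
  have hφ' : ∀ x, (TestFunction.lineDerivCLM ℂ (1 : ℝ) φ : 𝓓(posReals, ℂ)) x = ψ' (0, x) := by
    intro x
    have h0 : HasDerivAt φ (ψ' (0, x)) x := by
      have := hderiv 0 x
      rwa [← funext hφ] at this
    rw [TestFunction.lineDerivCLM_apply_of_le (by simp),
      h0.differentiableAt.lineDeriv_eq_fderiv]
    simpa using h0.deriv
  have key := (h ψ' K (TestFunction.lineDerivCLM ℂ (1 : ℝ) φ) hψ'_contDiff hK hψ'K hφ').neg
  refine key.congr' ?_
  filter_upwards [self_mem_nhdsWithin] with ε hε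
  have hGc : ContinuousOn G Complex.slitPlane := fun z hz =>
    (hG z hz).continuousAt.continuousWithinAt
  have c1 : Continuous fun x => ψ (ε, x) := hψ.continuous.comp (by fun_prop)
  have c2 : Continuous fun x => ψ' (ε, x) := hψ'_contDiff.continuous.comp (by fun_prop)
  have c3 := continuous_comp_nearSubOne hs hGc (mem_Ioi.1 hε)
  have c4 := continuous_comp_nearSubOne hs hg (mem_Ioi.1 hε)
  have s1 : HasCompactSupport fun x => ψ (ε, x) := HasCompactSupport.intro hK (hψK ε)
  have s2 : HasCompactSupport fun x => ψ' (ε, x) := HasCompactSupport.intro hK (hψ'K ε)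
  have hparts := integral_mul_deriv_eq_deriv_mul_of_integrable
    (u := fun x => ψ (ε, x)) (v := fun x => G (nearSubOne s ε x)) (u' := fun x => ψ' (ε, x))
    (v' := fun x => g (nearSubOne s ε x)) (fun x _ => hderiv ε x)
    (fun x _ => by
      have := (hG _ (nearSubOne_mem_slitPlane hs (mem_Ioi.1 hε) x)).comp x
        (hasDerivAt_nearSubOne s ε x)
      exact this.congr_deriv (mul_one _))
    ((c1.mul c4).integrable_of_hasCompactSupport s1.mul_right)
    ((c2.mul c3).integrable_of_hasCompactSupport s2.mul_right)
    ((c1.mul c3).integrable_of_hasCompactSupport s1.mul_right)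
  rw [hparts]

/-- Induction on the distance of Re l from the integrable range: z^l is the derivative of
z^(l+1)/(l+1), or of log z if l = -1, and boundary values commute with differentiation. -/
theorem exists_isBoundaryValue_cpow (hs : s = 1 ∨ s = -1) (l : ℂ) :
    ∃ T, IsBoundaryValue s (fun z => z ^ l) T := by
  obtain ⟨N, hN⟩ := exists_nat_gt (-1 - l.re)
  have hc : ∀ l : ℂ, ContinuousOn (fun z : ℂ => z ^ l) Complex.slitPlane := fun l z hz =>
    (continuousAt_cpow_const hz).continuousWithinAt
  induction N generalizing l with
  | zero =>
    obtain ⟨g₀, B, h⟩ := dominatedBoundary_cpow hs (l := l) (by simp at hN; linarith)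
    exact ⟨_, h.isBoundaryValue hs⟩
  | succ N ih =>
    by_cases hl : l = -1
    · obtain ⟨B, h⟩ := dominatedBoundary_log hs
      refine ⟨_, (h.isBoundaryValue hs).deriv hs (fun z hz => ?_) (hc l)⟩
      rw [hl, Complex.cpow_neg_one]
      exact Complex.hasDerivAt_log hz
    · obtain ⟨T, hT⟩ := ih (l + 1) (by simp at hN ⊢; linarith)
      have hl' : l + 1 ≠ 0 := fun h => hl (eq_neg_of_add_eq_zero_left h)
      refine ⟨_, (hT.const_mul (l + 1)⁻¹).deriv hs (fun z hz => ?_) (hc l)⟩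
      have h1 := ((hasDerivAt_id z).cpow_const (c := l + 1) hz).const_mul (l + 1)⁻¹
      simpa [inv_mul_cancel_left₀ hl'] using h1

theorem IsBoundaryValue.hasDistrLimit (hs : s = 1 ∨ s = -1) {g : ℂ → ℂ} {T : Distr}
    (h : IsBoundaryValue s g T) (hg : ContinuousOn g Complex.slitPlane) :
    HasDistrLimit (fun ε x => g (nearSubOne s ε x)) T := by
  have hloc : ∀ ε > 0, LocallyIntegrableOn (fun x => g (nearSubOne s ε x)) (Ioi 0) := fun ε hε =>
    (continuous_comp_nearSubOne hs hg hε).continuousOn.locallyIntegrableOn measurableSet_Ioi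
  refine ⟨hloc, fun φ => ?_⟩
  refine (h (fun p => φ p.2) (tsupport φ) φ (φ.contDiff.comp contDiff_snd) φ.hasCompactSupport
    (fun ε x hx => image_eq_zero_of_notMem_tsupport hx) fun x => rfl).congr' ?_
  filter_upwards [self_mem_nhdsWithin] with ε hε
  rw [regular_apply (hloc ε hε)]

/-- Distributional limits are unique, so the distribution chosen in the definition is the one
constructed above and inherits the stronger convergence, against test functions that vary with ε. -/
theorem subOneCpow_spec (hs : s = 1 ∨ s = -1) (l : ℂ) :
    HasDistrLimit (fun ε x => ((x : ℂ) - 1 + s * ε * Complex.I) ^ l) (subOneCpow s l) ∧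
      IsBoundaryValue s (fun z => z ^ l) (subOneCpow s l) := by
  obtain ⟨T, hT⟩ := exists_isBoundaryValue_cpow hs l
  have h1 := hT.hasDistrLimit hs
    fun z hz => (continuousAt_cpow_const hz).continuousWithinAt
  have h2 : HasDistrLimit (fun ε x => ((x : ℂ) - 1 + s * ε * Complex.I) ^ l) (subOneCpow s l) :=
    Classical.epsilon_spec (p := fun T : Distr =>
      HasDistrLimit (fun ε x => ((x : ℂ) - 1 + s * ε * Complex.I) ^ l) T) ⟨T, h1⟩
  have h3 : subOneCpow s l = T := by
    ext φ
    exact tendsto_nhds_unique (h2.2 φ) (h1.2 φ)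
  exact ⟨h2, h3 ▸ hT⟩

/-! ### Boundary values of `H(z) + (z - 1)^ρ (A(z) + log(z - 1) B(z))` -/

/-- The open right half-plane. -/
def rightHalfPlane : Set ℂ := {z | 0 < z.re}

theorem isOpen_rightHalfPlane : IsOpen rightHalfPlane :=
  isOpen_lt continuous_const Complex.continuous_re

theorem ofReal_mem_rightHalfPlane {x : ℝ} (hx : 0 < x) : (x : ℂ) ∈ rightHalfPlane := by
  simpa [rightHalfPlane] using hx

theorem contDiffAt_of_mem_rightHalfPlane {G : ℂ → ℂ} (hG : DifferentiableOn ℂ G rightHalfPlane)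
    {z : ℂ} (hz : z ∈ rightHalfPlane) : ContDiffAt ℝ ∞ G z :=
  ((hG.contDiffOn (n := ∞) isOpen_rightHalfPlane).contDiffAt
    (isOpen_rightHalfPlane.mem_nhds hz)).restrict_scalars ℝ

theorem contDiffOn_ofReal {G : ℂ → ℂ} (hG : DifferentiableOn ℂ G rightHalfPlane) :
    ContDiffOn ℝ ∞ (fun x : ℝ => G x) (Ioi 0) := fun x hx =>
  ((contDiffAt_of_mem_rightHalfPlane hG (ofReal_mem_rightHalfPlane hx)).comp x
    Complex.ofRealCLM.contDiff.contDiffAt).contDiffWithinAt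

theorem add_mem_rightHalfPlane (s ε : ℝ) {x : ℝ} (hx : 0 < x) :
    (x : ℂ) + s * ε * Complex.I ∈ rightHalfPlane := by
  simpa [rightHalfPlane] using hx

theorem add_im_ne_zero {s : ℝ} (hs : s = 1 ∨ s = -1) {ε : ℝ} (hε : 0 < ε) (x : ℝ) :
    ((x : ℂ) + s * ε * Complex.I).im ≠ 0 := by
  rcases hs with rfl | rfl <;> simp [hε.ne']

theorem add_sub_one_eq_nearSubOne (s ε x : ℝ) :
    (x : ℂ) + s * ε * Complex.I - 1 = nearSubOne s ε x := by rw [nearSubOne]; ring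

/-- The family of test functions `φ(x) G(x + s ε i)`. -/
theorem contDiff_testFamily (s : ℝ) {G : ℂ → ℂ} (hG : DifferentiableOn ℂ G rightHalfPlane)
    (φ : 𝓓(posReals, ℂ)) :
    ContDiff ℝ ∞ fun p : ℝ × ℝ => φ p.2 * G ((p.2 : ℂ) + s * p.1 * Complex.I) := by
  rw [contDiff_iff_contDiffAt]
  intro p
  by_cases hp : p.2 ∈ tsupport φ
  · have hp0 : 0 < p.2 := φ.tsupport_subset hp
    have h1 : ContDiff ℝ ∞ fun p : ℝ × ℝ => (p.2 : ℂ) + s * p.1 * Complex.I := by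
      have e1 : ContDiff ℝ ∞ fun p : ℝ × ℝ => (p.1 : ℂ) :=
        Complex.ofRealCLM.contDiff.comp contDiff_fst
      have e2 : ContDiff ℝ ∞ fun p : ℝ × ℝ => (p.2 : ℂ) :=
        Complex.ofRealCLM.contDiff.comp contDiff_snd
      exact e2.add ((contDiff_const.mul e1).mul contDiff_const)
    exact (φ.contDiff.comp contDiff_snd).contDiffAt.mul
      (ContDiffAt.comp p (contDiffAt_of_mem_rightHalfPlane hG (add_mem_rightHalfPlane s p.1 hp0))
        h1.contDiffAt)
  · refine (contDiffAt_const (c := (0 : ℂ))).congr_of_eventuallyEq ?_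
    filter_upwards [((isClosed_tsupport φ).isOpen_compl.preimage continuous_snd).mem_nhds hp]
      with y hy
    simp [image_eq_zero_of_notMem_tsupport hy]

theorem dominatedBoundary_one (s : ℝ) :
    DominatedBoundary s (fun _ => 1) (fun _ => 1) (fun _ => 1) where
  continuousOn := continuousOn_const
  locallyIntegrable_bound := locallyIntegrable_const 1
  norm_le := by simp
  tendsto := fun _ _ => tendsto_const_nhds

theorem smoothMul_apply {g : ℝ → ℂ} (hg : ContDiffOn ℝ ∞ g (Ioi 0)) (T : Distr)
    (φ : 𝓓(posReals, ℂ)) : smoothMul g T φ = T (mulTestCLM hg φ) := by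
  rw [smoothMul, dif_pos hg]; rfl

section Decomposition

variable {s : ℝ} {H A B : ℂ → ℂ} {h₂ : ℝ → ℂ}

theorem locallyIntegrableOn_of_eq_add_logSubOne (hs : s = 1 ∨ s = -1)
    (hA : DifferentiableOn ℂ A rightHalfPlane) (hB : DifferentiableOn ℂ B rightHalfPlane)
    (hh₂ : ∀ x : ℝ, 0 < x → x ≠ 1 → h₂ x = A x + logSubOne s x * B x) :
    LocallyIntegrableOn h₂ (Ioi 0) := by
  obtain ⟨C, hC⟩ := dominatedBoundary_log hs
  have h1 := ((hC.locallyIntegrable hs).locallyIntegrableOn (Ioi 0)).continuousOn_mul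
    (contDiffOn_ofReal hB).continuousOn isOpen_Ioi.isLocallyClosed
  have h2 := ((contDiffOn_ofReal hA).continuousOn.locallyIntegrableOn (μ := volume)
    measurableSet_Ioi).add h1
  refine h2.congr ?_
  filter_upwards [ae_restrict_mem measurableSet_Ioi, ae_restrict_of_ae ae_ne_one] with x hx hx1
  rw [hh₂ x hx hx1, Pi.add_apply, mul_comm]

/-- At x = 1 the logarithm diverges as ε → 0, but (±iε)^ρ decays like a positive power of ε and
wins. -/
theorem tendsto_nearSubOne_cpow_one (hs : s = 1 ∨ s = -1) {ρ : ℂ} (hρ : 0 < ρ.re) :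
    Tendsto (fun ε => nearSubOne s ε 1 ^ ρ) (𝓝[>] 0) (𝓝 0) ∧
    Tendsto (fun ε => nearSubOne s ε 1 ^ ρ * Complex.log (nearSubOne s ε 1)) (𝓝[>] 0) (𝓝 0) := by
  have hnorm : ∀ ε : ℝ, 0 < ε → ‖nearSubOne s ε 1‖ = ε := by
    intro ε hε
    rcases hs with rfl | rfl <;> simp [nearSubOne, abs_of_pos hε]
  have hbound : ∀ ε : ℝ, 0 < ε →
      ‖nearSubOne s ε 1 ^ ρ‖ ≤ ε ^ ρ.re * Real.exp (Real.pi * |ρ.im|) := by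
    intro ε hε
    have hz := Complex.slitPlane_ne_zero (nearSubOne_mem_slitPlane hs hε 1)
    rw [Complex.norm_cpow_of_ne_zero hz, hnorm ε hε, div_eq_mul_inv, ← Real.exp_neg]
    refine mul_le_mul_of_nonneg_left (Real.exp_le_exp.2 ?_) (Real.rpow_nonneg hε.le _)
    refine (neg_le_abs _).trans ?_
    rw [abs_mul]
    exact mul_le_mul_of_nonneg_right (Complex.abs_arg_le_pi _) (abs_nonneg _)
  have l1 : Tendsto (fun ε : ℝ => ε ^ ρ.re) (𝓝[>] 0) (𝓝 0) := by
    have := (Real.continuousAt_rpow_const 0 ρ.re (Or.inr hρ.le)).tendsto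
    rw [Real.zero_rpow hρ.ne'] at this
    exact this.mono_left nhdsWithin_le_nhds
  have l2 := (tendsto_log_mul_rpow_nhdsGT_zero hρ).abs
  rw [abs_zero] at l2
  constructor
  · refine squeeze_zero_norm' ?_ (by simpa using l1.mul_const (Real.exp (Real.pi * |ρ.im|)))
    filter_upwards [self_mem_nhdsWithin] with ε hε
    exact hbound ε hε
  · have l3 := (l2.add (l1.mul_const Real.pi)).mul_const (Real.exp (Real.pi * |ρ.im|))
    rw [zero_mul, zero_add, zero_mul] at l3
    refine squeeze_zero_norm' ?_ l3
    filter_upwards [self_mem_nhdsWithin] with ε hε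
    have hε' : 0 < ε := hε
    have h3 : ‖Complex.log (nearSubOne s ε 1)‖ ≤ |Real.log ε| + Real.pi := by
      refine (Complex.norm_le_abs_re_add_abs_im _).trans ?_
      rw [Complex.log_re, Complex.log_im, hnorm ε hε']
      exact add_le_add_right (Complex.abs_arg_le_pi _) _
    rw [norm_mul, abs_mul, abs_of_nonneg (Real.rpow_nonneg hε'.le _)]
    refine (mul_le_mul (hbound ε hε') h3 (norm_nonneg _) (by positivity)).trans (le_of_eq ?_)
    ring

/-- The difference is H(z) + (z-1)^ρ (A(z) - h₂(x) + log(z-1) B(z)). For x ≠ 1 the bracket tends to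
0; at x = 1 the prefactor does the work, whatever value h₂ takes there. -/
theorem tendsto_sub_of_decomposition (hs : s = 1 ∨ s = -1) {ρ : ℂ} (hρ : 0 < ρ.re)
    (hH : DifferentiableOn ℂ H rightHalfPlane) (hA : DifferentiableOn ℂ A rightHalfPlane)
    (hB : DifferentiableOn ℂ B rightHalfPlane)
    (hh₂ : ∀ x : ℝ, 0 < x → x ≠ 1 → h₂ x = A x + logSubOne s x * B x) {Q : ℂ → ℂ}
    (hQ : ∀ z ∈ rightHalfPlane, z.im ≠ 0 →
      Q z = H z + (z - 1) ^ ρ * (A z + Complex.log (z - 1) * B z)) {x : ℝ} (hx : 0 < x) :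
    Tendsto (fun ε : ℝ => Q ((x : ℂ) + s * ε * Complex.I) -
      ((x : ℂ) - 1 + s * ε * Complex.I) ^ ρ * h₂ x) (𝓝[>] 0) (𝓝 (H x)) := by
  have hlim : ∀ {G : ℂ → ℂ}, DifferentiableOn ℂ G rightHalfPlane →
      Tendsto (fun ε : ℝ => G ((x : ℂ) + s * ε * Complex.I)) (𝓝[>] 0) (𝓝 (G x)) := by
    intro G hG
    have h1 : ContinuousAt G x := (hG.differentiableAt
      (isOpen_rightHalfPlane.mem_nhds (ofReal_mem_rightHalfPlane hx))).continuousAt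
    have h2 : Tendsto (fun ε : ℝ => (x : ℂ) + s * ε * Complex.I) (𝓝[>] 0) (𝓝 (x : ℂ)) := by
      have : Continuous fun ε : ℝ => (x : ℂ) + s * ε * Complex.I := by fun_prop
      have h := this.tendsto 0
      simp only [Complex.ofReal_zero, mul_zero, zero_mul, add_zero] at h
      exact h.mono_left nhdsWithin_le_nhds
    exact h1.tendsto.comp h2
  have hzero : Tendsto (fun ε : ℝ => nearSubOne s ε x ^ ρ *
      (A ((x : ℂ) + s * ε * Complex.I) - h₂ x) +
      nearSubOne s ε x ^ ρ * Complex.log (nearSubOne s ε x) *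
        B ((x : ℂ) + s * ε * Complex.I)) (𝓝[>] 0) (𝓝 0) := by
    rcases eq_or_ne x 1 with rfl | hx1
    · obtain ⟨l1, l2⟩ := tendsto_nearSubOne_cpow_one hs hρ
      simpa using (l1.mul ((hlim hA).sub_const (h₂ 1))).add (l2.mul (hlim hB))
    · have l1 := tendsto_log_nearSubOne hs hx1
      have l2 : Tendsto (fun ε => nearSubOne s ε x ^ ρ) (𝓝[>] 0)
          (𝓝 (Complex.exp (logSubOne s x * ρ))) := by
        refine ((l1.mul_const ρ).cexp).congr' ?_
        filter_upwards [self_mem_nhdsWithin] with ε hε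
        rw [Complex.cpow_def_of_ne_zero
          (Complex.slitPlane_ne_zero (nearSubOne_mem_slitPlane hs hε x))]
      have l3 := (l2.mul ((hlim hA).sub_const (h₂ x))).add ((l2.mul l1).mul (hlim hB))
      convert l3 using 2
      rw [hh₂ x hx hx1]; ring
  have := (hlim hH).add hzero
  rw [add_zero] at this
  refine this.congr' ?_
  filter_upwards [self_mem_nhdsWithin] with ε hε
  rw [hQ _ (add_mem_rightHalfPlane s ε hx) (add_im_ne_zero hs hε x), add_sub_one_eq_nearSubOne,
    nearSubOne]
  ring

/-- The holomorphic multipliers are evaluated at x ± iε and not at x, so they are absorbed into test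
functions φ(x) K(x ± iε) depending smoothly on ε. The power term then uses the boundary value of z^l
against such families; the other two use dominated convergence. -/
theorem hasDistrLimit_of_decomposition (hs : s = 1 ∨ s = -1) {l : ℂ} {G : ℂ → ℂ}
    (hG : DifferentiableOn ℂ G rightHalfPlane)
    (hH : DifferentiableOn ℂ H rightHalfPlane) (hA : DifferentiableOn ℂ A rightHalfPlane)
    (hB : DifferentiableOn ℂ B rightHalfPlane)
    (hh₂ : ∀ x : ℝ, 0 < x → x ≠ 1 → h₂ x = A x + logSubOne s x * B x) {F : ℂ → ℂ}
    (hF : ∀ z ∈ rightHalfPlane, z.im ≠ 0 →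
      F z = G z * ((z - 1) ^ l * H z + (A z + Complex.log (z - 1) * B z)))
    {g h₁ : ℝ → ℂ} (hg : ∀ x : ℝ, 0 < x → g x = G x) (hh₁ : ∀ x : ℝ, 0 < x → h₁ x = H x) :
    HasDistrLimit (fun ε x => F ((x : ℂ) + s * ε * Complex.I))
      (smoothMul g (smoothMul h₁ (subOneCpow s l) + regular h₂)) := by
  have hgd : ContDiffOn ℝ ∞ g (Ioi 0) := (contDiffOn_ofReal hG).congr hg
  have hh₁d : ContDiffOn ℝ ∞ h₁ (Ioi 0) := (contDiffOn_ofReal hH).congr hh₁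
  have hpow : ContinuousOn (fun z : ℂ => z ^ l) Complex.slitPlane := fun z hz =>
    (continuousAt_cpow_const hz).continuousWithinAt
  have hlog : ContinuousOn Complex.log Complex.slitPlane := fun z hz =>
    (continuousAt_clog hz).continuousWithinAt
  have hFe : ∀ ε : ℝ, 0 < ε → ∀ x : ℝ, 0 < x → F ((x : ℂ) + s * ε * Complex.I) =
      G ((x : ℂ) + s * ε * Complex.I) * (nearSubOne s ε x ^ l * H ((x : ℂ) + s * ε * Complex.I) +
        (A ((x : ℂ) + s * ε * Complex.I) + Complex.log (nearSubOne s ε x) *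
          B ((x : ℂ) + s * ε * Complex.I))) := by
    intro ε hε x hx
    rw [hF _ (add_mem_rightHalfPlane s ε hx) (add_im_ne_zero hs hε x), add_sub_one_eq_nearSubOne]
  have hloc : ∀ ε : ℝ, ε > 0 → LocallyIntegrableOn (fun x : ℝ => F ((x : ℂ) + s * ε * Complex.I))
      (Ioi 0) := by
    intro ε hε
    have hc : ∀ {K : ℂ → ℂ}, DifferentiableOn ℂ K rightHalfPlane →
        ContinuousOn (fun x : ℝ => K ((x : ℂ) + s * ε * Complex.I)) (Ioi 0) := fun hK =>
      hK.continuousOn.comp (by fun_prop) fun x hx => add_mem_rightHalfPlane s ε hx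
    have h1 := (hc hG).mul ((((continuous_comp_nearSubOne hs hpow hε).continuousOn).mul
      (hc hH)).add ((hc hA).add (((continuous_comp_nearSubOne hs hlog hε).continuousOn).mul
        (hc hB))))
    exact (h1.congr fun x hx => hFe ε hε x hx).locallyIntegrableOn measurableSet_Ioi
  refine ⟨hloc, fun φ => ?_⟩
  -- The identities for F, g, h₁ and h₂ are available only for x > 0; elsewhere the test function
  -- vanishes.
  have hφ0 : ∀ x : ℝ, x ≤ 0 → φ x = 0 := fun x hx =>
    image_eq_zero_of_notMem_tsupport fun h => (not_lt.2 hx) (φ.tsupport_subset h)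
  -- three smooth families of test functions
  have hfam : ∀ {K : ℂ → ℂ}, DifferentiableOn ℂ K rightHalfPlane →
      ContDiff ℝ ∞ (fun p : ℝ × ℝ => φ p.2 * K ((p.2 : ℂ) + s * p.1 * Complex.I)) ∧
      ∀ ε : ℝ, ∀ x ∉ tsupport φ, φ x * K ((x : ℂ) + s * ε * Complex.I) = 0 := fun hK =>
    ⟨contDiff_testFamily s hK φ, fun ε x hx => by
      rw [image_eq_zero_of_notMem_tsupport hx, zero_mul]⟩
  obtain ⟨c1, v1⟩ := hfam (hG.mul hH)
  obtain ⟨c2, v2⟩ := hfam (hG.mul hA)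
  obtain ⟨c3, v3⟩ := hfam (hG.mul hB)
  obtain ⟨C, hC⟩ := dominatedBoundary_log hs
  have hone := dominatedBoundary_one s
  have l1 := (subOneCpow_spec hs l).2 _ (tsupport φ) (mulTestCLM hh₁d (mulTestCLM hgd φ)) c1
    φ.hasCompactSupport v1 (by
      intro x
      rw [mulTestCLM_apply, mulTestCLM_apply]
      rcases lt_or_ge 0 x with hx | hx
      · rw [hh₁ x hx, hg x hx]; simp; ring
      · simp [hφ0 x hx])
  have l2 := hone.tendsto_integral hs c2.continuous φ.hasCompactSupport v2
  have l3 := hC.tendsto_integral hs c3.continuous φ.hasCompactSupport v3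
  have hint : ∀ {ψ : ℝ × ℝ → ℂ}, ContDiff ℝ ∞ ψ → (∀ ε : ℝ, ∀ x ∉ tsupport φ, ψ (ε, x) = 0) →
      ∀ {k : ℝ → ℂ}, LocallyIntegrable k → ∀ ε : ℝ, Integrable fun x => ψ (ε, x) * k x := by
    intro ψ hψ hψ0 k hk ε
    exact hk.integrable_smul_left_of_hasCompactSupport
      (hψ.continuous.comp (by fun_prop : Continuous fun x : ℝ => (ε, x)))
      (HasCompactSupport.intro φ.hasCompactSupport (hψ0 ε))
  have htarget : smoothMul g (smoothMul h₁ (subOneCpow s l) + regular h₂) φ =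
      subOneCpow s l (mulTestCLM hh₁d (mulTestCLM hgd φ)) +
      ((∫ x : ℝ, φ x * (G * A) ((x : ℂ) + s * (0 : ℝ) * Complex.I) * 1) +
        ∫ x : ℝ, φ x * (G * B) ((x : ℂ) + s * (0 : ℝ) * Complex.I) * logSubOne s x) := by
    rw [smoothMul_apply hgd]
    have hadd : (smoothMul h₁ (subOneCpow s l) + regular h₂) (mulTestCLM hgd φ) =
      smoothMul h₁ (subOneCpow s l) (mulTestCLM hgd φ) + regular h₂ (mulTestCLM hgd φ) := rfl
    rw [hadd, smoothMul_apply hh₁d,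
      regular_apply (locallyIntegrableOn_of_eq_add_logSubOne hs hA hB hh₂),
      ← integral_add (hint c2 v2 (hone.locallyIntegrable hs) 0)
        (hint c3 v3 (hC.locallyIntegrable hs) 0)]
    congr 1
    refine integral_congr_ae ?_
    filter_upwards [ae_ne_one] with x hx1
    rw [mulTestCLM_apply]
    rcases lt_or_ge 0 x with hx | hx
    · rw [hg x hx, hh₂ x hx hx1]; simp; ring
    · simp [hφ0 x hx]
  rw [htarget]
  refine (l1.add (l2.add l3)).congr' ?_
  filter_upwards [self_mem_nhdsWithin] with ε hε
  have i1 := hint c1 v1 (continuous_comp_nearSubOne hs hpow hε).locallyIntegrable ε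
  have i2 := hint c2 v2 (locallyIntegrable_const 1) ε
  have i3 := hint c3 v3 (continuous_comp_nearSubOne hs hlog hε).locallyIntegrable ε
  rw [regular_apply (hloc ε hε), ← integral_add i2 i3]
  refine (integral_add i1 (i2.add i3)).symm.trans ?_
  refine integral_congr_ae (Eventually.of_forall fun x => ?_)
  rcases lt_or_ge 0 x with hx | hx
  · simp only [hFe ε hε x hx, Pi.mul_apply, Pi.add_apply]; ring
  · simp [hφ0 x hx]

end Decomposition

/-! ### The variable `1 - z⁻²` -/

theorem inv_sq_mem_slitPlane {z : ℂ} (hz : z ∈ rightHalfPlane) :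
    (z ^ 2)⁻¹ ∈ Complex.slitPlane := by
  have hz' : 0 < z.re := hz
  have h : z ^ 2 ∈ Complex.slitPlane := by
    rcases eq_or_ne z.im 0 with h0 | h0
    · left; simp [sq, h0, hz'.ne']
    · right
      simp only [sq, Complex.mul_im]
      have := mul_ne_zero hz'.ne' h0
      intro h; apply this; linarith [mul_comm z.re z.im]
  rw [Complex.mem_slitPlane_iff_arg] at h ⊢
  refine ⟨?_, inv_ne_zero h.2⟩
  rw [Complex.arg_inv, if_neg h.1]
  exact fun h' => absurd (Complex.neg_pi_lt_arg (z ^ 2)) (by linarith)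

theorem one_sub_inv_sq_mem_cutPlane {z : ℂ} (hz : z ∈ rightHalfPlane) :
    1 - (z ^ 2)⁻¹ ∈ cutPlane := one_sub_mem_cutPlane (inv_sq_mem_slitPlane hz)

theorem inv_sq_im_ne_zero {z : ℂ} (hz : z ∈ rightHalfPlane) (him : z.im ≠ 0) :
    ((z ^ 2)⁻¹).im ≠ 0 := by
  have hz' : 0 < z.re := hz
  have hne : z ^ 2 ≠ 0 := pow_ne_zero 2 fun h => him (by simp [h])
  rw [Complex.inv_im]
  refine div_ne_zero (neg_ne_zero.2 ?_) (Complex.normSq_pos.2 hne).ne'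
  simp only [sq, Complex.mul_im]
  have := mul_ne_zero hz'.ne' him
  intro h; apply this; linarith [mul_comm z.re z.im]

theorem inv_sq_mem_cutPlane {z : ℂ} (hz : z ∈ rightHalfPlane) (him : z.im ≠ 0) :
    (z ^ 2)⁻¹ ∈ cutPlane := mem_cutPlane_of_im_ne_zero (inv_sq_im_ne_zero hz him)

theorem one_sub_inv_sq_mem_doublyCutPlane {z : ℂ} (hz : z ∈ rightHalfPlane) (him : z.im ≠ 0) :
    1 - (z ^ 2)⁻¹ ∈ doublyCutPlane :=
  ⟨inv_sq_mem_cutPlane hz him, one_sub_inv_sq_mem_cutPlane hz⟩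

theorem ne_zero_of_mem_rightHalfPlane {z : ℂ} (hz : z ∈ rightHalfPlane) : z ≠ 0 := fun h => by
  simp [rightHalfPlane, h] at hz

theorem mem_slitPlane_of_mem_rightHalfPlane {z : ℂ} (hz : z ∈ rightHalfPlane) :
    z ∈ Complex.slitPlane := Or.inl hz

theorem add_one_mem_rightHalfPlane {z : ℂ} (hz : z ∈ rightHalfPlane) :
    z + 1 ∈ rightHalfPlane := by
  have hz' : 0 < z.re := hz
  show 0 < (z + 1).re
  rw [Complex.add_re, Complex.one_re]
  linarith

theorem norm_le_norm_add_one {z : ℂ} (hz : z ∈ rightHalfPlane) : ‖z‖ ≤ ‖z + 1‖ := by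
  have hz' : 0 < z.re := hz
  rw [Complex.norm_def, Complex.norm_def]
  refine Real.sqrt_le_sqrt ?_
  simp [Complex.normSq_apply]
  nlinarith

/-- Both sides have the same exponential, so it suffices that the imaginary part on the right lies
in (-π, π). For Im z > 0 this follows from 0 ≤ arg(z+1) ≤ arg z < π/2 and 0 ≤ arg(z-1) < π; for Im z
< 0 the signs are reversed. The bound on arg z is where Re z > 0 is essential. -/
theorem log_one_sub_inv_sq {z : ℂ} (hz : z ∈ rightHalfPlane) (him : z.im ≠ 0) :
    Complex.log (1 - (z ^ 2)⁻¹) =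
      Complex.log (z - 1) + Complex.log (z + 1) - 2 * Complex.log z := by
  have hz0 := ne_zero_of_mem_rightHalfPlane hz
  have hz1 : z - 1 ≠ 0 := fun h => him (by simpa using congrArg Complex.im h)
  have hz2 := ne_zero_of_mem_rightHalfPlane (add_one_mem_rightHalfPlane hz)
  have hexp : Complex.exp (Complex.log (z - 1) + Complex.log (z + 1) - 2 * Complex.log z) =
      1 - (z ^ 2)⁻¹ := by
    rw [Complex.exp_sub, Complex.exp_add, Complex.exp_log hz1, Complex.exp_log hz2, two_mul,
      Complex.exp_add, Complex.exp_log hz0]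
    field_simp
    ring
  have hbd : |z.arg| < Real.pi / 2 := Complex.abs_arg_lt_pi_div_two_iff.2 (Or.inl hz)
  obtain ⟨b1, b2⟩ := abs_lt.1 hbd
  have hle : (z + 1).arg = Real.arcsin (z.im / ‖z + 1‖) := by
    rw [Complex.arg_of_re_nonneg (le_of_lt (add_one_mem_rightHalfPlane hz))]; simp
  have hle' : z.arg = Real.arcsin (z.im / ‖z‖) := Complex.arg_of_re_nonneg (le_of_lt hz)
  have hn := norm_le_norm_add_one hz
  have hpos : 0 < ‖z‖ := norm_pos_iff.2 hz0
  have him1 : (z - 1).im = z.im := by simp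
  have him2 : (z + 1).im = z.im := by simp
  have hsum : Complex.im (Complex.log (z - 1) + Complex.log (z + 1) - 2 * Complex.log z) =
      (z - 1).arg + (z + 1).arg - 2 * z.arg := by
    simp [Complex.log_im]
  have key : -Real.pi < (z - 1).arg + (z + 1).arg - 2 * z.arg ∧
      (z - 1).arg + (z + 1).arg - 2 * z.arg < Real.pi := by
    rcases lt_or_gt_of_ne him with h | h
    · have a1 : (z - 1).arg < 0 := Complex.arg_neg_iff.2 (him1 ▸ h)
      have a2 : (z + 1).arg < 0 := Complex.arg_neg_iff.2 (him2 ▸ h)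
      have a3 : z.arg < 0 := Complex.arg_neg_iff.2 h
      have a4 : z.arg ≤ (z + 1).arg := by
        rw [hle, hle']
        refine Real.monotone_arcsin ?_
        rw [div_le_div_iff₀ hpos (hpos.trans_le hn)]
        nlinarith
      have a5 := Complex.neg_pi_lt_arg (z - 1)
      constructor <;> linarith
    · have a1 : 0 ≤ (z - 1).arg := Complex.arg_nonneg_iff.2 (by rw [him1]; exact h.le)
      have a2 : 0 ≤ (z + 1).arg := Complex.arg_nonneg_iff.2 (by rw [him2]; exact h.le)
      have a4 : (z + 1).arg ≤ z.arg := by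
        rw [hle, hle']
        exact Real.monotone_arcsin (div_le_div_of_nonneg_left h.le hpos hn)
      have a5 : (z - 1).arg < Real.pi := Complex.arg_lt_pi_iff.2 (Or.inr (by rw [him1]; exact him))
      have a6 : 0 ≤ z.arg := Complex.arg_nonneg_iff.2 h.le
      constructor <;> linarith
  rw [← hexp, Complex.log_exp (hsum ▸ key.1) (hsum ▸ key.2.le)]

theorem one_sub_inv_sq_cpow {z : ℂ} (hz : z ∈ rightHalfPlane) (him : z.im ≠ 0) (l : ℂ) :
    (1 - (z ^ 2)⁻¹) ^ l = (z - 1) ^ l * (z + 1) ^ l * z ^ (-2 * l) := by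
  have hz0 := ne_zero_of_mem_rightHalfPlane hz
  have hz1 : z - 1 ≠ 0 := fun h => him (by simpa using congrArg Complex.im h)
  have hz2 := ne_zero_of_mem_rightHalfPlane (add_one_mem_rightHalfPlane hz)
  have hw : 1 - (z ^ 2)⁻¹ ≠ 0 :=
    Complex.slitPlane_ne_zero (one_sub_inv_sq_mem_doublyCutPlane hz him).1
  rw [Complex.cpow_def_of_ne_zero hw, Complex.cpow_def_of_ne_zero hz0,
    Complex.cpow_def_of_ne_zero hz1, Complex.cpow_def_of_ne_zero hz2, log_one_sub_inv_sq hz him,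
    ← Complex.exp_add, ← Complex.exp_add]
  congr 1; ring

theorem differentiableOn_one_sub_inv_sq :
    DifferentiableOn ℂ (fun z : ℂ => 1 - (z ^ 2)⁻¹) rightHalfPlane := fun _ hz =>
  (((differentiableAt_id.pow 2).inv (pow_ne_zero 2 (ne_zero_of_mem_rightHalfPlane hz))).const_sub
    1).differentiableWithinAt

theorem differentiableOn_comp_one_sub_inv_sq {G : ℂ → ℂ} (hG : DifferentiableOn ℂ G cutPlane) :
    DifferentiableOn ℂ (fun z => G (1 - (z ^ 2)⁻¹)) rightHalfPlane :=
  hG.comp differentiableOn_one_sub_inv_sq fun _ hz => one_sub_inv_sq_mem_cutPlane hz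

theorem differentiableOn_cpow_rightHalfPlane (l : ℂ) :
    DifferentiableOn ℂ (fun z : ℂ => z ^ l) rightHalfPlane := fun _ hz =>
  (differentiableAt_id.cpow_const
    (mem_slitPlane_of_mem_rightHalfPlane hz)).differentiableWithinAt

theorem differentiableOn_log_rightHalfPlane :
    DifferentiableOn ℂ Complex.log rightHalfPlane := fun _ hz =>
  (Complex.differentiableAt_log
    (mem_slitPlane_of_mem_rightHalfPlane hz)).differentiableWithinAt

theorem differentiableOn_comp_add_one {G : ℂ → ℂ} (hG : DifferentiableOn ℂ G rightHalfPlane) :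
    DifferentiableOn ℂ (fun z => G (z + 1)) rightHalfPlane :=
  hG.comp (by fun_prop) fun _ hz => add_one_mem_rightHalfPlane hz

/-! ### Relation between `f` and `q` -/

theorem hypF_comm (a b c : ℂ) : hypF a b c = hypF b a c := by
  rw [hypF, Complex.regularizedGaussHGFun_symm, ← hypF]

/-- Euler's transformation with c - a₊ - b₊ = -ρ takes the upper parameters a₊, b₊ to b₋, a₋, and (1
- z⁻²)^(-ρ) splits into powers of z - 1, z + 1 and z. -/
theorem f_eq_mul_q (μ ν ρ : ℂ) {z : ℂ} (hz : z ∈ rightHalfPlane) (him : z.im ≠ 0) :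
    f μ ν ρ z = z ^ (-1 + ρ - ν) * (z + 1) ^ (-ρ) * ((z - 1) ^ (-ρ) * q μ ν ρ z) := by
  have hz0 := ne_zero_of_mem_rightHalfPlane hz
  rw [f, q, hypF_euler _ _ _ (inv_sq_mem_cutPlane hz him),
    show ν + 1 - aPlus μ ν ρ - bPlus μ ν ρ = -ρ by simp only [aPlus, bPlus]; ring,
    show ν + 1 - aPlus μ ν ρ = bMinus μ ν ρ by simp only [aPlus, bMinus]; ring,
    show ν + 1 - bPlus μ ν ρ = aMinus μ ν ρ by simp only [bPlus, aMinus]; ring,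
    hypF_comm (bMinus μ ν ρ), one_sub_inv_sq_cpow hz him,
    show -1 + ρ - ν = (-1 - ρ - ν) + -2 * -ρ by ring, Complex.cpow_add _ _ hz0]
  ring

/-- A decomposition of `q` of the form `H(z) + (z - 1)^ρ (A(z) + log(z - 1) B(z))`, whose
components restrict to `h₁` and `h₂^±` on the half-line. -/
structure BoundaryDecomposition (μ ν ρ : ℂ) (s : ℝ) (H A B : ℂ → ℂ) : Prop where
  differentiableOn_H : DifferentiableOn ℂ H rightHalfPlane
  differentiableOn_A : DifferentiableOn ℂ A rightHalfPlane
  differentiableOn_B : DifferentiableOn ℂ B rightHalfPlane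
  h₁_eq : ∀ x : ℝ, 0 < x → h₁ μ ν ρ x = H x
  h₂_eq : ∀ x : ℝ, 0 < x → x ≠ 1 → h₂ μ ν ρ s x = A x + logSubOne s x * B x
  q_eq : ∀ z ∈ rightHalfPlane, z.im ≠ 0 →
    q μ ν ρ z = H z + (z - 1) ^ ρ * (A z + Complex.log (z - 1) * B z)

/-! ### The decomposition of q in the three cases. -/

theorem aMinus_add (μ ν ρ : ℂ) : aMinus μ ν ρ + ρ = aPlus μ ν ρ := by
  simp only [aMinus, aPlus]; ring

theorem bMinus_add (μ ν ρ : ℂ) : bMinus μ ν ρ + ρ = bPlus μ ν ρ := by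
  simp only [bMinus, bPlus]; ring

theorem aMinus_add_bMinus_add (μ ν ρ : ℂ) : aMinus μ ν ρ + bMinus μ ν ρ + ρ = ν + 1 := by
  simp only [aMinus, bMinus]; ring

theorem boundaryDecomposition_of_not_nat (μ ν : ℂ) {ρ : ℂ} (hρ : 0 < ρ.re)
    (h : ¬ ∃ m : ℕ, ρ = m) (s : ℝ) :
    BoundaryDecomposition μ ν ρ s
      (fun z => Real.pi / Complex.sin (Real.pi * ρ) *
        ((Complex.Gamma (aPlus μ ν ρ))⁻¹ * (Complex.Gamma (bPlus μ ν ρ))⁻¹ *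
          hypF (aMinus μ ν ρ) (bMinus μ ν ρ) (1 - ρ) (1 - (z ^ 2)⁻¹)))
      (fun z => -(Real.pi / Complex.sin (Real.pi * ρ)) *
        ((Complex.Gamma (aMinus μ ν ρ))⁻¹ * (Complex.Gamma (bMinus μ ν ρ))⁻¹ *
          (z ^ (-2 * ρ) * (z + 1) ^ ρ *
            hypF (aPlus μ ν ρ) (bPlus μ ν ρ) (ρ + 1) (1 - (z ^ 2)⁻¹))))
      (fun _ => 0) where
  differentiableOn_H :=
    ((differentiableOn_comp_one_sub_inv_sq (differentiableOn_hypF _ _ _)).const_mul _).const_mul _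
  differentiableOn_A := by
    refine DifferentiableOn.const_mul (DifferentiableOn.const_mul ?_ _) _
    exact ((differentiableOn_cpow_rightHalfPlane _).mul
      (differentiableOn_comp_add_one (differentiableOn_cpow_rightHalfPlane ρ))).mul
      (differentiableOn_comp_one_sub_inv_sq (differentiableOn_hypF _ _ _))
  differentiableOn_B := differentiableOn_const 0
  h₁_eq x _ := by rw [h₁, if_neg h, h₁NonInt, argOf]
  h₂_eq x _ _ := by rw [h₂, if_neg h, h₂NonInt, argOf, mul_zero, add_zero]
  q_eq z hz him := by
    have hconn := hypF_connection (aMinus μ ν ρ) (bMinus μ ν ρ) ρ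
      (one_sub_inv_sq_mem_doublyCutPlane hz him)
    rw [sub_sub_cancel, aMinus_add, bMinus_add, aMinus_add_bMinus_add,
      one_sub_inv_sq_cpow hz him, add_comm (1 : ℂ) ρ] at hconn
    -- Euler's reflection formula. Since Re ρ > 0 and ρ is not a natural number, neither ρ nor 1 - ρ
    -- is a pole of Γ.
    have hκ : (Real.pi : ℂ) / Complex.sin (Real.pi * ρ) * (rGamma ρ * rGamma (1 - ρ)) = 1 := by
      rw [← Complex.Gamma_mul_Gamma_one_sub, rGamma, rGamma]
      have h1 : Complex.Gamma ρ ≠ 0 := Complex.Gamma_ne_zero_of_re_pos hρ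
      have h2 : Complex.Gamma (1 - ρ) ≠ 0 := Complex.Gamma_ne_zero fun m hm =>
        h ⟨m + 1, by push_cast; linear_combination -hm⟩
      field_simp
    simp only [rGamma] at hconn hκ
    rw [q]
    linear_combination
      Real.pi / Complex.sin (Real.pi * ρ) * hconn -
        hypF (aMinus μ ν ρ) (bMinus μ ν ρ) (ν + 1) (z ^ 2)⁻¹ * hκ

theorem logBoundary_eq (s : ℝ) {x : ℝ} (hx : 0 < x) (hx1 : x ≠ 1) :
    logBoundary s x = logSubOne s x + (Complex.log (x + 1) - 2 * Complex.log x) := by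
  have h1 : x - 1 ≠ 0 := sub_ne_zero.2 hx1
  have h2 : x + 1 ≠ 0 := by positivity
  have e : 1 - (x ^ 2)⁻¹ = (x - 1) * (x + 1) / x ^ 2 := by field_simp; ring
  have h3 : Real.log |1 - (x ^ 2)⁻¹| = Real.log |x - 1| + (Real.log (x + 1) - 2 * Real.log x) := by
    rw [e, Real.log_abs, Real.log_abs, Real.log_div (mul_ne_zero h1 h2) (by positivity),
      Real.log_mul h1 h2, Real.log_pow]
    push_cast; ring
  rw [logBoundary, logSubOne, h3, ← Complex.ofReal_one, ← Complex.ofReal_add,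
    ← Complex.ofReal_log hx.le, ← Complex.ofReal_log (by positivity)]
  push_cast; ring

/-- In the logarithmic connection formula log w = log(z-1) + log(z+1) - 2 log z. Only the first
logarithm is singular on the half-line, so its coefficient is B; the other two are holomorphic and
belong to A. -/
theorem boundaryDecomposition_nat (μ ν : ℂ) {m : ℕ} (hm : 0 < m) (h : ¬ Terminating μ ν m)
    (s : ℝ) :
    BoundaryDecomposition μ ν m s
      (fun z => (Complex.Gamma (aPlus μ ν m))⁻¹ * (Complex.Gamma (bPlus μ ν m))⁻¹ *
        ∑ k ∈ Finset.range m, (-1) ^ k * (Nat.factorial (m - k - 1) : ℂ) *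
          (ascPochhammer ℂ k).eval (aMinus μ ν m) * (ascPochhammer ℂ k).eval (bMinus μ ν m) /
            (Nat.factorial k : ℂ) * (1 - (z ^ 2)⁻¹) ^ k)
      (fun z => (-1) ^ m * (Complex.Gamma (aMinus μ ν m))⁻¹ * (Complex.Gamma (bMinus μ ν m))⁻¹ *
        ((z ^ (2 * m))⁻¹ * (z + 1) ^ m *
          (hypT m (aPlus μ ν m) (bPlus μ ν m) (1 - (z ^ 2)⁻¹) -
            (Complex.log (z + 1) - 2 * Complex.log z) *
              hypF (aPlus μ ν m) (bPlus μ ν m) (m + 1) (1 - (z ^ 2)⁻¹))))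
      (fun z => -((-1) ^ m * (Complex.Gamma (aMinus μ ν m))⁻¹ *
        (Complex.Gamma (bMinus μ ν m))⁻¹ * ((z ^ (2 * m))⁻¹ * (z + 1) ^ m *
          hypF (aPlus μ ν m) (bPlus μ ν m) (m + 1) (1 - (z ^ 2)⁻¹)))) := by
  have hpow : DifferentiableOn ℂ (fun z : ℂ => (z ^ (2 * m))⁻¹ * (z + 1) ^ m)
      rightHalfPlane := fun z hz =>
    (((differentiableAt_id.pow _).inv (pow_ne_zero _ (ne_zero_of_mem_rightHalfPlane hz))).mul
      ((differentiableAt_id.add_const 1).pow m)).differentiableWithinAt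
  have hF := differentiableOn_comp_one_sub_inv_sq
    (differentiableOn_hypF (aPlus μ ν m) (bPlus μ ν m) (m + 1))
  refine ⟨?_, ?_, ?_, ?_, ?_, ?_⟩
  · refine DifferentiableOn.const_mul (DifferentiableOn.fun_sum fun k _ => ?_) _
    exact (differentiableOn_one_sub_inv_sq.pow k).const_mul _
  · refine DifferentiableOn.const_mul (hpow.mul
      ((differentiableOn_comp_one_sub_inv_sq (differentiableOn_hypT _ _ _)).sub
        (DifferentiableOn.mul ?_ hF))) _
    exact (differentiableOn_comp_add_one differentiableOn_log_rightHalfPlane).sub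
      (differentiableOn_log_rightHalfPlane.const_mul 2)
  · exact ((hpow.mul hF).const_mul _).neg
  · intro x _
    rw [h₁, if_pos ⟨m, rfl⟩, if_neg h, Complex.natCast_re, Nat.floor_natCast, h₁Int]
    rfl
  · intro x hx hx1
    rw [h₂, if_pos ⟨m, rfl⟩, if_neg h, Complex.natCast_re, Nat.floor_natCast, h₂Int,
      logBoundary_eq s hx hx1, argOf]
    ring
  · intro z hz him
    simp only [Terminating, not_or, not_exists] at h
    have hconn := hypF_connection_nat h.1 h.2 hm (one_sub_inv_sq_mem_doublyCutPlane hz him)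
    rw [sub_sub_cancel, aMinus_add, bMinus_add, aMinus_add_bMinus_add,
      log_one_sub_inv_sq hz him] at hconn
    have hw : (1 - (z ^ 2)⁻¹) ^ m = (z - 1) ^ m * (z + 1) ^ m * (z ^ (2 * m))⁻¹ := by
      have hz0 := ne_zero_of_mem_rightHalfPlane hz
      rw [pow_mul, ← inv_pow (z ^ 2), ← mul_pow, ← mul_pow]
      congr 1
      field_simp
      ring
    rw [q, hconn, Complex.cpow_natCast, hw]
    simp only [rGamma, poch]
    ring

theorem differentiable_regularizedGaussHGFun_of_neg_nat (n : ℕ) (b c : ℂ) :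
    Differentiable ℂ (Complex.regularizedGaussHGFun (-n) b c) := by
  intro z
  have hr := Complex.radius_regularizedGaussHGFunSeries_eq_top_of_left b c n
  have h := (Complex.regularizedGaussHGFunSeries (-n) b c).hasFPowerSeriesOnBall (by simp [hr])
  rw [hr] at h
  exact (h.analyticOnNhd z (by simp)).differentiableAt

/-- A terminating series is entire, so q has no jump across the cut and is entirely absorbed by H.
-/
theorem boundaryDecomposition_of_terminating (μ ν : ℂ) {m : ℕ} (h : Terminating μ ν m) (s : ℝ) :
    BoundaryDecomposition μ ν m s
      (fun z => Complex.regularizedGaussHGFun (aMinus μ ν m) (bMinus μ ν m) (ν + 1) (z ^ 2)⁻¹)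
      (fun _ => 0) (fun _ => 0) := by
  have hd : Differentiable ℂ
      (Complex.regularizedGaussHGFun (aMinus μ ν m) (bMinus μ ν m) (ν + 1)) := by
    rcases h with ⟨n, hn⟩ | ⟨n, hn⟩
    · rw [hn]; exact differentiable_regularizedGaussHGFun_of_neg_nat n _ _
    · rw [hn, Complex.regularizedGaussHGFun_symm]
      exact differentiable_regularizedGaussHGFun_of_neg_nat n _ _
  refine ⟨fun z hz => ?_, differentiableOn_const 0, differentiableOn_const 0, ?_, ?_, ?_⟩
  · exact (hd.differentiableAt.comp z ((differentiableAt_id.pow 2).inv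
      (pow_ne_zero 2 (ne_zero_of_mem_rightHalfPlane hz)))).differentiableWithinAt
  · intro x _
    rw [h₁, if_pos ⟨m, rfl⟩, if_pos h]
  · intro x _ _
    rw [h₂, if_pos ⟨m, rfl⟩, if_pos h, mul_zero, add_zero]
  · intro z hz him
    rw [q, mul_zero, add_zero, mul_zero, add_zero]
    exact eqOn_cutPlane_of_eqOn_ball (differentiableOn_hypF _ _ _) hd.differentiableOn one_pos
      (fun w hw => hypF_eq_of_norm_lt_one _ _ _ (mem_ball_zero_iff.1 hw))
      (inv_sq_mem_cutPlane hz him)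

theorem exists_boundaryDecomposition (μ ν : ℂ) {ρ : ℂ} (hρ : 0 < ρ.re) (s : ℝ) :
    ∃ H A B, BoundaryDecomposition μ ν ρ s H A B := by
  by_cases h : ∃ m : ℕ, ρ = m
  · obtain ⟨m, rfl⟩ := h
    by_cases ht : Terminating μ ν m
    · exact ⟨_, _, _, boundaryDecomposition_of_terminating μ ν ht s⟩
    · exact ⟨_, _, _, boundaryDecomposition_nat μ ν (by simpa using hρ) ht s⟩
  · exact ⟨_, _, _, boundaryDecomposition_of_not_nat μ ν hρ h s⟩

end WeberSchafheitlin

end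

/-! ### Assembly of the theorem. -/

theorem mainTheorem3 (μ ν ρ : ℂ) (hρ : 0 < ρ.re) (s : ℝ) (hs : s = 1 ∨ s = -1) :
    -- `h₁` is smooth and `h₂^±` is locally integrable on `(0, ∞)`
    ContDiffOn ℝ ∞ (WeberSchafheitlin.h₁ μ ν ρ) (Ioi 0) ∧
    LocallyIntegrableOn (WeberSchafheitlin.h₂ μ ν ρ s) (Ioi 0) ∧
    -- they decompose the boundary values: `q(x ± i0) = h₁(x) + (x - 1 ± i0)^ρ h₂^±(x)`
    (∀ x : ℝ, 0 < x → Tendsto (fun ε : ℝ =>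
        WeberSchafheitlin.q μ ν ρ ((x : ℂ) + s * ε * Complex.I) -
          ((x : ℂ) - 1 + s * ε * Complex.I) ^ ρ * WeberSchafheitlin.h₂ μ ν ρ s x)
      (𝓝[>] 0) (𝓝 (WeberSchafheitlin.h₁ μ ν ρ x))) ∧
    -- the distribution `(x - 1 ± i0)^(-ρ)` exists as a limit
    WeberSchafheitlin.HasDistrLimit
      (fun ε x => ((x : ℂ) - 1 + s * ε * Complex.I) ^ (-ρ))
      (WeberSchafheitlin.subOneCpow s (-ρ)) ∧
    -- `lim f(x ± iε) = x^(-1+ρ-ν) (x+1)^(-ρ) [(x - 1 ± i0)^(-ρ) h₁(x) + h₂^±(x)]`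
    WeberSchafheitlin.HasDistrLimit
      (fun ε x => WeberSchafheitlin.f μ ν ρ ((x : ℂ) + s * ε * Complex.I))
      (WeberSchafheitlin.smoothMul
        (fun x => (x : ℂ) ^ (-1 + ρ - ν) * ((x : ℂ) + 1) ^ (-ρ))
        (WeberSchafheitlin.smoothMul (WeberSchafheitlin.h₁ μ ν ρ)
            (WeberSchafheitlin.subOneCpow s (-ρ)) +
          WeberSchafheitlin.regular (WeberSchafheitlin.h₂ μ ν ρ s))) := by
  obtain ⟨H, A, B, hd⟩ := WeberSchafheitlin.exists_boundaryDecomposition μ ν hρ s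
  refine ⟨?_, ?_, ?_, ?_, ?_⟩
  · exact (WeberSchafheitlin.contDiffOn_ofReal hd.differentiableOn_H).congr hd.h₁_eq
  · exact WeberSchafheitlin.locallyIntegrableOn_of_eq_add_logSubOne hs hd.differentiableOn_A
      hd.differentiableOn_B hd.h₂_eq
  · intro x hx
    rw [hd.h₁_eq x hx]
    exact WeberSchafheitlin.tendsto_sub_of_decomposition hs hρ hd.differentiableOn_H
      hd.differentiableOn_A hd.differentiableOn_B hd.h₂_eq hd.q_eq hx
  · exact (WeberSchafheitlin.subOneCpow_spec hs (-ρ)).1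
  · have hG : DifferentiableOn ℂ (fun z : ℂ => z ^ (-1 + ρ - ν) * (z + 1) ^ (-ρ))
        WeberSchafheitlin.rightHalfPlane :=
      (WeberSchafheitlin.differentiableOn_cpow_rightHalfPlane _).mul
        (WeberSchafheitlin.differentiableOn_comp_add_one
          (WeberSchafheitlin.differentiableOn_cpow_rightHalfPlane (-ρ)))
    refine WeberSchafheitlin.hasDistrLimit_of_decomposition hs hG hd.differentiableOn_H
      hd.differentiableOn_A hd.differentiableOn_B hd.h₂_eq (fun z hz him => ?_)
      (fun _ _ => rfl) hd.h₁_eq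
    have hz1 : z - 1 ≠ 0 := fun h => him (by simpa using congrArg Complex.im h)
    -- The factor (z-1)^(-ρ) from f cancels the (z-1)^ρ in q, so h₂^± enters the limit of f without
    -- a singular power.
    have hpow : (z - 1) ^ (-ρ) * (z - 1) ^ ρ = 1 := by
      rw [← Complex.cpow_add _ _ hz1, neg_add_cancel, Complex.cpow_zero]
    rw [WeberSchafheitlin.f_eq_mul_q μ ν ρ hz him, hd.q_eq z hz him]
    linear_combination z ^ (-1 + ρ - ν) * (z + 1) ^ (-ρ) *
      (A z + Complex.log (z - 1) * B z) * hpow
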